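/- Let $u_0\in H^1(\mathbb R)\cap W^{1,4}(\mathbb R)$ and let $Y\mapsto x(0,Y)$ be the inverse of the bijection $x\mapsto\int_0^x(1+u_0'(s)^2)^2\,ds$ of $\mathbb R$. Let $$X=\big[H^1(\mathbb R)\cap W^{1,4}(\mathbb R)\big]\times\big[L^2(\mathbb R)\cap L^\infty(\mathbb R)\big]\times L^\infty(\mathbb R)$$ be the Banach space with norm $\|(u,v,\xi)\|_X=\|u\|_{H^1}+\|u\|_{W^{1,4}}+\|v\|_{L^2}+\|v\|_{L^\infty}+\|\xi\|_{L^\infty}$. For $(u,v,\xi)\in X$ put $$k(Y,\bar Y)=\exp\Big(-\Big|\int_{\bar Y}^{Y}\xi\cos^4\tfrac v2\,d\tilde Y\Big|\Big),\qquad g_1=\big(\tfrac38u\sin^2v+u^3\cos^4\tfrac v2\big)\xi,\qquad g_2=\xi\sin v\,\sin^2\tfrac v2,$$ $$P_1(Y)=\tfrac12\int_{-\infty}^\infty k(Y,\bar Y)g_1(\bar Y)\,d\bar Y,\qquad \partial_xP_1(Y)=\tfrac12\Big(\int_Y^\infty-\int_{-\infty}^Y\Big)k(Y,\bar Y)g_1(\bar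 Y)\,d\bar Y,$$ $$P_2(Y)=\tfrac18\int_{-\infty}^\infty k(Y,\bar Y)g_2(\bar Y)\,d\bar Y,\qquad \partial_xP_2(Y)=\tfrac18\Big(\int_Y^\infty-\int_{-\infty}^Y\Big)k(Y,\bar Y)g_2(\bar Y)\,d\bar Y.$$ Then the initial value problem $$u_T=-\partial_xP_1-P_2,\qquad v_T=-u\sin^2\tfrac v2+2u^3\cos^2\tfrac v2-2\cos^2\tfrac v2\,(P_1+\partial_xP_2),$$ $$\xi_T=\xi\big[(2u^3+u)-2(P_1+\partial_xP_2)\big]\sin v,$$ $$u(0,Y)=u_0(x(0,Y)),\qquad v(0,Y)=2\arctan\big(u_0'(x(0,Y))\big),\qquad \xi(0,Y)=1,$$ has a unique solution defined for all $T\ge0$. Here a solution is a map $T\mapsto(u,v,\xi)(T)$ from $[0,\infty)$ to $X$ that is differentiable in the norm of $X$ at every $T\ge0$ (one-sidedly at $T=0$), for which the integrals defining $P_1,P_2,\partial_xP_1,\partial_xP_2$ converge absolutely for every $Y$ and every $T\ge 0$, and which satisfies the system as an ordinary differential equation in $X$ together with the initial condition. -/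

import Mathlib

open MeasureTheory Set Filter Topology
open scoped ENNReal ContDiff

noncomputable section

namespace Novikov

/-! ### Function spaces -/

instance factOneLeFour : Fact ((1 : ℝ≥0∞) ≤ 4) := ⟨by norm_num⟩

/-- `g` is the weak (distributional) derivative of `f` on the real line. -/
def HasWeakDeriv (f g : ℝ → ℝ) : Prop :=
  ∀ φ : ℝ → ℝ, ContDiff ℝ ∞ φ → HasCompactSupport φ →
    ∫ x, f x * deriv φ x = - ∫ x, g x * φ x

/-- The ambient space for pairs (function, derivative), with the norm
`(‖f‖_{L²}² + ‖g‖_{L²}²)^{1/2} + (‖f'‖_{L⁴}⁴ + ‖g'‖_{L⁴}⁴)^{1/4}`. -/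
abbrev SobAmbient : Type :=
  WithLp 1 (WithLp 2 (Lp ℝ 2 (volume : Measure ℝ) × Lp ℝ 2 (volume : Measure ℝ)) ×
    WithLp 4 (Lp ℝ 4 (volume : Measure ℝ) × Lp ℝ 4 (volume : Measure ℝ)))

lemma integrable_mul_test (f : Lp ℝ 2 (volume : Measure ℝ)) {ψ : ℝ → ℝ}
    (hψ : Continuous ψ) (hc : HasCompactSupport ψ) : Integrable (fun x => f x * ψ x) :=
  (Lp.memLp f).integrable_mul (q := 2) (hψ.memLp_of_hasCompactSupport hc)

/-- `H¹(ℝ) ∩ W^{1,4}(ℝ)`: the function and its weak derivative lie in `L² ∩ L⁴`. The inherited norm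
is `‖u‖_{H¹} + ‖u‖_{W^{1,4}}`. -/
def H1W14 : Submodule ℝ SobAmbient where
  carrier := {p | (p.fst.fst : ℝ → ℝ) =ᵐ[volume] p.snd.fst ∧
    (p.fst.snd : ℝ → ℝ) =ᵐ[volume] p.snd.snd ∧ HasWeakDeriv p.fst.fst p.fst.snd}
  zero_mem' := by
    refine ⟨?_, ?_, ?_⟩
    · exact (Lp.coeFn_zero ℝ 2 volume).trans (Lp.coeFn_zero ℝ 4 volume).symm
    · exact (Lp.coeFn_zero ℝ 2 volume).trans (Lp.coeFn_zero ℝ 4 volume).symm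
    · intro φ _ _
      simp
  add_mem' := by
    rintro p q ⟨hp1, hp2, hp3⟩ ⟨hq1, hq2, hq3⟩
    refine ⟨?_, ?_, ?_⟩
    · exact (Lp.coeFn_add _ _).trans ((hp1.add hq1).trans (Lp.coeFn_add _ _).symm)
    · exact (Lp.coeFn_add _ _).trans ((hp2.add hq2).trans (Lp.coeFn_add _ _).symm)
    · intro φ hφ hc
      have key : ∀ (f g : Lp ℝ 2 (volume : Measure ℝ)) (ψ : ℝ → ℝ), Continuous ψ →
          HasCompactSupport ψ →
          ∫ x, (f + g : Lp ℝ 2 (volume : Measure ℝ)) x * ψ x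
            = (∫ x, f x * ψ x) + ∫ x, g x * ψ x := by
        intro f g ψ hψ hψc
        rw [← integral_add (integrable_mul_test f hψ hψc) (integrable_mul_test g hψ hψc)]
        refine integral_congr_ae ?_
        filter_upwards [Lp.coeFn_add f g] with x hx
        rw [hx, Pi.add_apply, add_mul]
      have e1 := key p.fst.fst q.fst.fst _ (hφ.continuous_deriv (by simp)) hc.deriv
      have e2 := key p.fst.snd q.fst.snd _ hφ.continuous hc
      have := hp3 φ hφ hc
      have := hq3 φ hφ hc
      simp only [WithLp.add_fst, WithLp.add_snd]
      rw [e1, e2]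
      linarith
  smul_mem' := by
    rintro c p ⟨hp1, hp2, hp3⟩
    refine ⟨?_, ?_, ?_⟩
    · exact (Lp.coeFn_smul _ _).trans ((hp1.const_smul c).trans (Lp.coeFn_smul _ _).symm)
    · exact (Lp.coeFn_smul _ _).trans ((hp2.const_smul c).trans (Lp.coeFn_smul _ _).symm)
    · intro φ hφ hc
      have key : ∀ (f : Lp ℝ 2 (volume : Measure ℝ)) (ψ : ℝ → ℝ),
          ∫ x, (c • f : Lp ℝ 2 (volume : Measure ℝ)) x * ψ x = c * ∫ x, f x * ψ x := by
        intro f ψ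
        rw [← integral_const_mul]
        refine integral_congr_ae ?_
        filter_upwards [Lp.coeFn_smul c f] with x hx
        rw [hx, Pi.smul_apply, smul_eq_mul, mul_assoc]
      simp only [WithLp.smul_fst, WithLp.smul_snd]
      rw [key, key, hp3 φ hφ hc]
      ring

/-- `L²(ℝ) ∩ L^∞(ℝ)`, with norm `‖v‖_{L²} + ‖v‖_{L^∞}`. -/
def L2Linf : Submodule ℝ
    (WithLp 1 (Lp ℝ 2 (volume : Measure ℝ) × Lp ℝ ∞ (volume : Measure ℝ))) where
  carrier := {p | (p.fst : ℝ → ℝ) =ᵐ[volume] p.snd}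
  zero_mem' := (Lp.coeFn_zero ℝ 2 volume).trans (Lp.coeFn_zero ℝ ∞ volume).symm
  add_mem' := by
    intro p q hp hq
    exact (Lp.coeFn_add _ _).trans ((EventuallyEq.add (show (p.fst : ℝ → ℝ) =ᵐ[volume] p.snd from hp)
      (show (q.fst : ℝ → ℝ) =ᵐ[volume] q.snd from hq)).trans (Lp.coeFn_add _ _).symm)
  smul_mem' := by
    intro c p hp
    exact (Lp.coeFn_smul _ _).trans ((EventuallyEq.const_smul
      (show (p.fst : ℝ → ℝ) =ᵐ[volume] p.snd from hp) c).trans (Lp.coeFn_smul _ _).symm)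

/-- The space `X = (H¹ ∩ W^{1,4}) × (L² ∩ L^∞) × L^∞` with the sum norm
`‖u‖_{H¹} + ‖u‖_{W^{1,4}} + ‖v‖_{L²} + ‖v‖_{L^∞} + ‖ξ‖_{L^∞}`. -/
abbrev X : Type := WithLp 1 (H1W14 × WithLp 1 (L2Linf × Lp ℝ ∞ (volume : Measure ℝ)))

/-- A representative of an element of `H¹ ∩ W^{1,4}`. -/
def sobFn (u : H1W14) : ℝ → ℝ := u.1.fst.fst

/-- A representative of the weak derivative of an element of `H¹ ∩ W^{1,4}`. -/
def sobDeriv (u : H1W14) : ℝ → ℝ := u.1.fst.snd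

/-- Representatives of the three components `u`, `v`, `ξ` of a point of `X`. -/
def X.u (z : X) : ℝ → ℝ := sobFn z.fst

def X.v (z : X) : ℝ → ℝ := z.snd.fst.1.fst

def X.ξ (z : X) : ℝ → ℝ := z.snd.snd

/-! `X` is a Banach space. -/

lemma isClosed_ae_eq {E : Type*} [TopologicalSpace E] [FirstCountableTopology E] {p q : ℝ≥0∞}
    [Fact (1 ≤ p)] [Fact (1 ≤ q)] (f : E → Lp ℝ p (volume : Measure ℝ))
    (g : E → Lp ℝ q (volume : Measure ℝ)) (hf : Continuous f) (hg : Continuous g) :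
    IsClosed {z : E | (f z : ℝ → ℝ) =ᵐ[volume] g z} := by
  refine IsSeqClosed.isClosed ?_
  intro s z hs hz
  have h1 := tendstoInMeasure_of_tendsto_Lp ((hf.tendsto z).comp hz)
  have h2 := tendstoInMeasure_of_tendsto_Lp ((hg.tendsto z).comp hz)
  have h3 := h1.congr (g := (f z : ℝ → ℝ)) (fun i => hs i) (EventuallyEq.refl _ _)
  exact tendstoInMeasure_ae_unique h3 h2

lemma continuous_integral_mul_test {ψ : ℝ → ℝ} (hψ : Continuous ψ) (hc : HasCompactSupport ψ) :
    Continuous (fun f : Lp ℝ 2 (volume : Measure ℝ) => ∫ x, f x * ψ x) := by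
  have hm : MemLp ψ 2 (volume : Measure ℝ) := hψ.memLp_of_hasCompactSupport hc
  have : (fun f : Lp ℝ 2 (volume : Measure ℝ) => ∫ x, f x * ψ x)
      = fun f => inner ℝ (hm.toLp ψ) f := by
    funext f
    rw [L2.inner_def]
    refine integral_congr_ae ?_
    filter_upwards [hm.coeFn_toLp] with x hx
    simp [hx]
  rw [this]
  fun_prop

instance : CompleteSpace H1W14 := by
  refine IsClosed.completeSpace_coe (s := (H1W14 : Set SobAmbient)) (hs := ?_)
  have c1 : Continuous fun p : SobAmbient => p.fst := WithLp.continuous_fst ..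
  have c2 : Continuous fun p : SobAmbient => p.snd := WithLp.continuous_snd ..
  have c11 : Continuous fun p : SobAmbient => p.fst.fst := (WithLp.continuous_fst ..).comp c1
  have c12 : Continuous fun p : SobAmbient => p.fst.snd := (WithLp.continuous_snd ..).comp c1
  have c21 : Continuous fun p : SobAmbient => p.snd.fst := (WithLp.continuous_fst ..).comp c2
  have c22 : Continuous fun p : SobAmbient => p.snd.snd := (WithLp.continuous_snd ..).comp c2
  refine (isClosed_ae_eq _ _ c11 c21).inter ((isClosed_ae_eq _ _ c12 c22).inter ?_)
  change IsClosed {p : SobAmbient | HasWeakDeriv p.fst.fst p.fst.snd}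
  simp only [HasWeakDeriv, ofPred_forall]
  refine isClosed_iInter fun φ => isClosed_iInter fun hφ => isClosed_iInter fun hc => ?_
  exact isClosed_eq
    ((continuous_integral_mul_test (hφ.continuous_deriv (by simp)) hc.deriv).comp c11)
    ((continuous_integral_mul_test hφ.continuous hc).comp c12).neg

instance : CompleteSpace L2Linf := by
  refine IsClosed.completeSpace_coe (s := (L2Linf : Set (WithLp 1 (Lp ℝ 2 (volume : Measure ℝ) ×
    Lp ℝ ∞ (volume : Measure ℝ))))) (hs := ?_)
  exact isClosed_ae_eq _ _ (WithLp.continuous_fst ..) (WithLp.continuous_snd ..)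

instance : CompleteSpace X := inferInstance

/-! ### The nonlocal terms -/

/-- `exp(-|∫_Z^Y ξ cos⁴(v/2)|)`. -/
def kernel (v ξ : ℝ → ℝ) (Y Z : ℝ) : ℝ :=
  Real.exp (-|∫ s in Z..Y, ξ s * Real.cos (v s / 2) ^ 4|)

/-- Integrand of `P₁` and `∂ₓP₁` (without the factor `1/2`). -/
def integrand₁ (u v ξ : ℝ → ℝ) (Y Z : ℝ) : ℝ :=
  kernel v ξ Y Z *
    ((3 / 8 * u Z * Real.sin (v Z) ^ 2 + u Z ^ 3 * Real.cos (v Z / 2) ^ 4) * ξ Z)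

/-- Integrand of `P₂` and `∂ₓP₂` (without the factor `1/8`). -/
def integrand₂ (v ξ : ℝ → ℝ) (Y Z : ℝ) : ℝ :=
  kernel v ξ Y Z * (ξ Z * Real.sin (v Z) * Real.sin (v Z / 2) ^ 2)

def P₁ (u v ξ : ℝ → ℝ) (Y : ℝ) : ℝ :=
  1 / 2 * ∫ Z, integrand₁ u v ξ Y Z

def dxP₁ (u v ξ : ℝ → ℝ) (Y : ℝ) : ℝ :=
  1 / 2 * ((∫ Z in Ioi Y, integrand₁ u v ξ Y Z) - ∫ Z in Iio Y, integrand₁ u v ξ Y Z)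

def P₂ (v ξ : ℝ → ℝ) (Y : ℝ) : ℝ :=
  1 / 8 * ∫ Z, integrand₂ v ξ Y Z

def dxP₂ (v ξ : ℝ → ℝ) (Y : ℝ) : ℝ :=
  1 / 8 * ((∫ Z in Ioi Y, integrand₂ v ξ Y Z) - ∫ Z in Iio Y, integrand₂ v ξ Y Z)

/-- The nonlocal integrals converge absolutely at every `Y`. -/
def NonlocalConverges (u v ξ : ℝ → ℝ) : Prop :=
  ∀ Y : ℝ, Integrable (integrand₁ u v ξ Y) ∧ Integrable (integrand₂ v ξ Y)

/-! ### The initial value problem -/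

/-- `d ∈ X` is the right-hand side of the semilinear system at the point `z ∈ X`. -/
structure IsRHS (z d : X) : Prop where
  converges : NonlocalConverges z.u z.v z.ξ
  u_eq : ∀ᵐ Y : ℝ, d.u Y = - dxP₁ z.u z.v z.ξ Y - P₂ z.v z.ξ Y
  v_eq : ∀ᵐ Y : ℝ, d.v Y =
    - z.u Y * Real.sin (z.v Y / 2) ^ 2 + 2 * z.u Y ^ 3 * Real.cos (z.v Y / 2) ^ 2
      - 2 * Real.cos (z.v Y / 2) ^ 2 * (P₁ z.u z.v z.ξ Y + dxP₂ z.v z.ξ Y)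
  ξ_eq : ∀ᵐ Y : ℝ, d.ξ Y =
    z.ξ Y * ((2 * z.u Y ^ 3 + z.u Y) - 2 * (P₁ z.u z.v z.ξ Y + dxP₂ z.v z.ξ Y))
      * Real.sin (z.v Y)

/-- The initial characteristic coordinate `Y(0,x) = ∫₀ˣ (1 + u₀'²)²`. -/
def Y₀ (u₀ : H1W14) (x : ℝ) : ℝ := ∫ s in (0 : ℝ)..x, (1 + sobDeriv u₀ s ^ 2) ^ 2

/-- `Y ↦ x(0,Y)`, the inverse of `x ↦ Y(0,x)` (a bijection of `ℝ`, see `Y₀_bijective`). -/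
def x₀ (u₀ : H1W14) : ℝ → ℝ := Function.invFun (Y₀ u₀)

lemma Y₀_integrable (u₀ : H1W14) (a b : ℝ) :
    IntervalIntegrable (fun s => (1 + sobDeriv u₀ s ^ 2) ^ 2) volume a b := by
  have h2 : Integrable (fun s => sobDeriv u₀ s ^ 2) := (Lp.memLp u₀.1.fst.snd).integrable_sq
  have h4 : Integrable (fun s => sobDeriv u₀ s ^ 4) := by
    have := (Lp.memLp u₀.1.snd.snd).integrable_norm_rpow (by norm_num) (by norm_num)
    refine this.congr ?_
    filter_upwards [u₀.2.2.1] with s hs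
    have h : sobDeriv u₀ s = u₀.1.snd.snd s := hs
    rw [h]
    norm_num [Even.pow_abs]
  have : (fun s => (1 + sobDeriv u₀ s ^ 2) ^ 2)
      = fun s => 1 + 2 * sobDeriv u₀ s ^ 2 + sobDeriv u₀ s ^ 4 := by funext s; ring
  rw [this]
  exact (intervalIntegrable_const.add (h2.const_mul 2).intervalIntegrable).add
    h4.intervalIntegrable

lemma Y₀_bijective (u₀ : H1W14) : Function.Bijective (Y₀ u₀) := by
  have key : ∀ a b, a ≤ b → b - a ≤ Y₀ u₀ b - Y₀ u₀ a := by
    intro a b hab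
    have h : Y₀ u₀ b - Y₀ u₀ a = ∫ s in a..b, (1 + sobDeriv u₀ s ^ 2) ^ 2 := by
      unfold Y₀
      rw [intervalIntegral.integral_interval_sub_left (Y₀_integrable u₀ _ _)
        (Y₀_integrable u₀ _ _)]
    rw [h]
    have h1 : ∫ _ in a..b, (1 : ℝ) = b - a := by simp
    rw [← h1]
    refine intervalIntegral.integral_mono_on hab intervalIntegrable_const
      (Y₀_integrable u₀ a b) fun s _ => ?_
    nlinarith [sq_nonneg (sobDeriv u₀ s), sq_nonneg (sobDeriv u₀ s ^ 2)]
  have hmono : StrictMono (Y₀ u₀) := fun a b hab => by linarith [key a b hab.le]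
  refine ⟨hmono.injective, ?_⟩
  have hcont : Continuous (Y₀ u₀) :=
    intervalIntegral.continuous_primitive (fun a b => Y₀_integrable u₀ a b) 0
  have h0 : Y₀ u₀ 0 = 0 := by simp [Y₀]
  refine hcont.surjective ?_ ?_
  · refine tendsto_atTop_mono' atTop ?_ tendsto_id
    filter_upwards [eventually_ge_atTop 0] with x hx
    have := key 0 x hx
    simp only [id]; linarith
  · refine tendsto_atBot_mono' atBot ?_ tendsto_id
    filter_upwards [eventually_le_atBot 0] with x hx
    have := key x 0 hx
    simp only [id]; linarith

/-- `z ∈ X` is the initial datum `(u₀(x(0,Y)), 2 arctan u₀'(x(0,Y)), 1)`. -/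
structure IsInitial (u₀ : H1W14) (z : X) : Prop where
  u_eq : ∀ᵐ Y : ℝ, z.u Y = sobFn u₀ (x₀ u₀ Y)
  v_eq : ∀ᵐ Y : ℝ, z.v Y = 2 * Real.arctan (sobDeriv u₀ (x₀ u₀ Y))
  ξ_eq : ∀ᵐ Y : ℝ, z.ξ Y = 1

/-- `w = (u, v, ξ)` solves the initial value problem for all `T ≥ 0`, as an ordinary differential
equation in the Banach space `X` (one-sided derivative at `T = 0`). -/
structure IsGlobalSolution (u₀ : H1W14) (w : ℝ → X) : Prop where
  initial : IsInitial u₀ (w 0)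
  ode : ∀ T : ℝ, 0 ≤ T → ∃ d : X, IsRHS (w T) d ∧ HasDerivWithinAt w d (Ici 0) T

end Novikov

end

/-! In the original space variable, `dx = ξ cos⁴(v/2) dY` and `u_x = tan(v/2)`. The system is
therefore an ordinary differential equation whose nonlocal terms are integral operators with kernel
`exp(-|x - x'|)` written in `Y`. The right-hand side makes sense, and is Lipschitz and bounded, on
sets where `u`, `v`, `ξ` are bounded and `ξ` is bounded below: there `∫ ξ cos⁴(v/2)` grows linearly,
so the kernels decay exponentially. Global existence then reduces to a priori bounds
(`IsLipschitzExhaustion.exists_global`).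

The equation is solved in the larger space `St`, where `u` is only in `L² ∩ L^∞`. The derivative of
`u` is recovered from the relation `u_Y = ξ sin(v/2) cos³(v/2)`. It holds at time zero
(`hasWeakDeriv_initSt`) and persists, because both sides have the same time derivative (`deriv_stN`,
`IsSolOn.hasWeakDeriv`). Its right-hand side lies in `L² ∩ L^∞`, hence in `L⁴`, so the curve lifts
to a differentiable curve in `X` (`isGlobalSolution_ofSt`).

The bounds come as follows. The energy `∫ (u² + u_x²) dx` is conserved, since the time derivative of
its density is the `Y`-derivative of `u⁴ - 2u(P₁ + ∂ₓP₂)` (`IsSolOn.energy_eq`). It controls `sup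
|u|` and `P₁`. The quantity `∫ u_x⁴ dx` is not shown to be conserved, but its derivative is at most
affine in itself, because `∫ |u_x|³ dx` lies between the two integrals by Cauchy–Schwarz
(`IsSolOn.abs_quartic_deriv_le`). Grönwall bounds it on finite time intervals, and with it `∂ₓP₂`.
Then `|ξ_T| ≤ B ξ`, which bounds `ξ` above and below. The energy and the quartic integral also bound
`∫ sin²(v/2)`, hence fix the decay of the kernels independently of `‖v‖`. What remains is an
estimate linear in `(‖u‖, ‖v‖)`, closed by Grönwall (`exists_apriori_bound`).

For uniqueness, any solution in `X` projects to `St`, where it must follow the solution constructed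
(`IsGlobalSolution.toSt_eqOn`), and the projection is injective. -/

noncomputable section

namespace Novikov

/-! ### Autonomous differential equations in a Banach space -/

section ODE

open Metric
open scoped NNReal

variable {E : Type*} [NormedAddCommGroup E] [NormedSpace ℝ E]

/-- `w` is an integral curve of `f` on `[0, T]` that stays in the union of the sets `K R`. -/
structure IsSolOn (f : E → E) (K : ℝ → Set E) (T : ℝ) (w : ℝ → E) : Prop where
  deriv : ∀ t ∈ Icc 0 T, HasDerivWithinAt w (f (w t)) (Icc 0 T) t
  mem : ∀ t ∈ Icc 0 T, ∃ R, w t ∈ K R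

lemma IsSolOn.mono {f : E → E} {K : ℝ → Set E} {T T' : ℝ} {w : ℝ → E} (h : IsSolOn f K T w)
    (hT : T' ≤ T) : IsSolOn f K T' w :=
  ⟨fun t ht => (h.deriv t ⟨ht.1, ht.2.trans hT⟩).mono (Icc_subset_Icc_right hT),
    fun t ht => h.mem t ⟨ht.1, ht.2.trans hT⟩⟩

lemma IsSolOn.continuousOn {f : E → E} {K : ℝ → Set E} {T : ℝ} {w : ℝ → E}
    (h : IsSolOn f K T w) : ContinuousOn w (Icc 0 T) :=
  fun t ht => (h.deriv t ht).continuousWithinAt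

/-- A family of sets on which `f` is Lipschitz and bounded, each member having a uniform
neighbourhood contained in another member. -/
structure IsLipschitzExhaustion (f : E → E) (K : ℝ → Set E) : Prop where
  lip : ∀ R, ∃ C : ℝ≥0, LipschitzOnWith C f (K R)
  bdd : ∀ R, ∃ C : ℝ≥0, ∀ z ∈ K R, ‖f z‖ ≤ C
  nhd : ∀ R, ∃ ε > 0, ∃ R', ∀ z ∈ K R, closedBall z ε ⊆ K R'

lemma hasDerivWithinAt_Icc_iff_Ici {w : ℝ → E} {d : E} {a b t : ℝ} (ht : t ∈ Ico a b) :
    HasDerivWithinAt w d (Icc a b) t ↔ HasDerivWithinAt w d (Ici a) t := by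
  rw [← Ici_inter_Iic, hasDerivWithinAt_inter (Iic_mem_nhds ht.2)]

lemma hasDerivWithinAt_of_notMem_closure {w : ℝ → E} {d : E} {s : Set ℝ} {t : ℝ}
    (h : t ∉ closure s) : HasDerivWithinAt w d s t :=
  hasDerivWithinAt_iff_hasFDerivWithinAt.2 (HasFDerivWithinAt.of_notMem_closure h)

lemma hasDerivWithinAt_of_subsingleton {w : ℝ → E} {d : E} {s : Set ℝ} {t : ℝ}
    (h : s.Subsingleton) : HasDerivWithinAt w d s t :=
  hasDerivWithinAt_iff_hasFDerivWithinAt.2 (HasFDerivWithinAt.of_subsingleton h)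

variable {f : E → E} {K : ℝ → Set E}

/-- Agreement of a solution staying in the sets `K R` with an arbitrary solution. -/
theorem IsLipschitzExhaustion.eqOn (hK : IsLipschitzExhaustion f K) {T : ℝ} {w w' : ℝ → E}
    (hw : IsSolOn f K T w)
    (hw' : ContinuousOn w' (Icc 0 T))
    (hd : ∀ t ∈ Icc 0 T, (∃ R, w' t ∈ K R) → HasDerivWithinAt w' (f (w' t)) (Icc 0 T) t)
    (h0 : w' 0 = w 0) : EqOn w' w (Icc 0 T) := by
  rcases lt_or_ge T 0 with hT | hT
  · simp [Icc_eq_empty_of_lt hT]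
  have hcl : IsClosed ({t | w' t = w t} ∩ Icc 0 T) := by
    have : {t | w' t = w t} ∩ Icc 0 T = Icc 0 T ∩ (fun t => w' t - w t) ⁻¹' {0} := by
      ext t
      simp [sub_eq_zero, and_comm]
    rw [this]
    exact (hw'.sub hw.continuousOn).preimage_isClosed_of_isClosed isClosed_Icc isClosed_singleton
  -- Continuation in time: the set of agreement is closed, and at a point of agreement `w'` also
  -- lies in `K R`. By continuity both curves stay in `K R'` for a short time, where `f` is
  -- Lipschitz. This is why the equation for `w'` is needed only at points of the sets `K R`.
  refine hcl.Icc_subset_of_forall_exists_gt (a := 0) (b := T) h0 ?_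
  rintro t ⟨hte, ht⟩ y hy
  have hte : w' t = w t := hte
  obtain ⟨R, hR⟩ := hw.mem t ⟨ht.1, ht.2.le⟩
  obtain ⟨ε, hε, R', hR'⟩ := hK.nhd R
  obtain ⟨C, hC⟩ := hK.lip R'
  have e1 : ∀ᶠ r in 𝓝[Icc 0 T] t, w r ∈ closedBall (w t) ε :=
    (hw.continuousOn t ⟨ht.1, ht.2.le⟩).eventually (closedBall_mem_nhds _ hε)
  have e2 : ∀ᶠ r in 𝓝[Icc 0 T] t, w' r ∈ closedBall (w t) ε := by
    rw [← hte]
    exact (hw' t ⟨ht.1, ht.2.le⟩).eventually (closedBall_mem_nhds _ hε)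
  obtain ⟨δ, hδ, hball⟩ := Metric.mem_nhdsWithin_iff.1 (e1.and e2)
  set b := min (min y T) (t + δ / 2) with hb
  have htb : t < b := lt_min (lt_min hy ht.2) (by linarith)
  have hbT : b ≤ T := (min_le_left _ _).trans (min_le_right _ _)
  have hby : b ≤ y := (min_le_left _ _).trans (min_le_left _ _)
  have hin : ∀ r ∈ Icc t b, w r ∈ K R' ∧ w' r ∈ K R' := by
    intro r hr
    have h3 : b ≤ t + δ / 2 := min_le_right _ _
    have := hball (show r ∈ ball t δ ∩ Icc 0 T from
      ⟨by rw [mem_ball, Real.dist_eq, abs_of_nonneg (by linarith [hr.1])]; linarith [hr.2],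
        ht.1.trans hr.1, hr.2.trans hbT⟩)
    exact ⟨hR' _ hR this.1, hR' _ hR this.2⟩
  have hsub : Icc t b ⊆ Icc 0 T := Icc_subset_Icc ht.1 hbT
  have key := ODE_solution_unique_of_mem_Icc_right (v := fun _ => f) (s := fun _ => K R')
    (f := w') (g := w) (a := t) (b := b) (K := C) (fun _ _ => hC) (hw'.mono hsub)
    (fun r hr => by
      have hr' : r ∈ Ico 0 T := ⟨ht.1.trans hr.1, hr.2.trans_le hbT⟩
      exact (((hasDerivWithinAt_Icc_iff_Ici hr').1
        (hd r ⟨hr'.1, hr'.2.le⟩ ⟨_, (hin r ⟨hr.1, hr.2.le⟩).2⟩)).mono (Ici_subset_Ici.2 hr'.1)))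
    (fun r hr => (hin r ⟨hr.1, hr.2.le⟩).2) (hw.continuousOn.mono hsub)
    (fun r hr => by
      have hr' : r ∈ Ico 0 T := ⟨ht.1.trans hr.1, hr.2.trans_le hbT⟩
      exact (((hasDerivWithinAt_Icc_iff_Ici hr').1
        (hw.deriv r ⟨hr'.1, hr'.2.le⟩)).mono (Ici_subset_Ici.2 hr'.1)))
    (fun r hr => (hin r ⟨hr.1, hr.2.le⟩).1) hte
  exact ⟨b, key ⟨htb.le, le_rfl⟩, htb, hby⟩

/-- Local existence on a time interval whose length depends only on `R`. -/
theorem IsLipschitzExhaustion.exists_local [CompleteSpace E] (hK : IsLipschitzExhaustion f K)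
    (R : ℝ) : ∃ τ > 0, ∀ z ∈ K R, ∃ w : ℝ → E, w 0 = z ∧ IsSolOn f K τ w := by
  obtain ⟨ε, hε, R', hR'⟩ := hK.nhd R
  obtain ⟨C, hC⟩ := hK.lip R'
  obtain ⟨L, hL⟩ := hK.bdd R'
  -- At speed at most `L`, leaving the ball of radius `ε` takes longer than this; `L + 1` keeps the
  -- denominator positive. Since `ε`, `R'` and `L` come from `R`, the time does not depend on `z`.
  set τ : ℝ := ε / (L + 1) with hτ
  have hτ0 : 0 < τ := by positivity
  refine ⟨τ, hτ0, fun z hz => ?_⟩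
  let t₀ : Icc (0 : ℝ) τ := ⟨0, le_rfl, hτ0.le⟩
  have hP : IsPicardLindelof (fun _ => f) t₀ z ε.toNNReal 0 L C := by
    have hb : closedBall z (ε.toNNReal : ℝ) ⊆ K R' := by
      rw [Real.coe_toNNReal _ hε.le]
      exact hR' z hz
    refine IsPicardLindelof.of_time_independent (fun x hx => hL x (hb hx)) (hC.mono hb) ?_
    have : max (τ - (t₀ : ℝ)) ((t₀ : ℝ) - 0) = τ := by simp [t₀, hτ0.le]
    rw [this]
    rw [Real.coe_toNNReal _ hε.le, NNReal.coe_zero, sub_zero, hτ, mul_div_assoc',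
      div_le_iff₀ (by positivity)]
    nlinarith [L.2]
  obtain ⟨α, hα⟩ := ODE.FunSpace.exists_isFixedPt_next hP (mem_closedBall_self le_rfl)
  refine ⟨α.compProj, ?_, ⟨fun t ht => ?_, fun t _ =>
    ⟨R', hR' z hz ?_⟩⟩⟩
  · have : α.compProj ((t₀ : Icc (0 : ℝ) τ) : ℝ) = z := by
      rw [ODE.FunSpace.compProj_val, ← hα, ODE.FunSpace.next_apply₀]
    exact this
  · apply ODE.hasDerivWithinAt_picard_Icc t₀.2 hP.continuousOn_uncurry
      α.continuous_compProj.continuousOn (fun _ ht' ↦ α.compProj_mem_closedBall hP.mul_max_le)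
      z ht |>.congr_of_mem _ ht
    intro t' ht'
    nth_rw 1 [← hα]
    rw [ODE.FunSpace.compProj_of_mem ht', ODE.FunSpace.next_apply]
  · have := α.compProj_mem_closedBall hP.mul_max_le (t := t)
    rwa [Real.coe_toNNReal _ hε.le] at this

/-- Gluing of solutions. -/
lemma IsSolOn.glue {T τ : ℝ} (hT : 0 ≤ T) (hτ : 0 ≤ τ) {w w₁ : ℝ → E} (h : IsSolOn f K T w)
    (h₁ : IsSolOn f K τ w₁) (he : w₁ 0 = w T) :
    IsSolOn f K (T + τ) (fun t => if t ≤ T then w t else w₁ (t - T)) := by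
  set g : ℝ → E := fun t => if t ≤ T then w t else w₁ (t - T) with hg
  have g1 : ∀ t, t ≤ T → g t = w t := fun t ht => by simp [hg, ht]
  have g2 : ∀ t, T ≤ t → g t = w₁ (t - T) := by
    intro t ht
    rcases ht.eq_or_lt with rfl | ht
    · simp [hg, he]
    · simp [hg, not_le.2 ht]
  have d1 : ∀ t ∈ Icc 0 T, HasDerivWithinAt g (f (g t)) (Icc 0 T) t := fun t ht => by
    rw [g1 t ht.2]
    exact (h.deriv t ht).congr (fun r hr => g1 r hr.2) (g1 t ht.2)
  have d2 : ∀ t ∈ Icc T (T + τ), HasDerivWithinAt g (f (g t)) (Icc T (T + τ)) t := fun t ht => by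
    rw [g2 t ht.1]
    have := HasDerivWithinAt.scomp (h := fun r => r - T) t
      (h₁.deriv (t - T) ⟨by linarith [ht.1], by linarith [ht.2]⟩)
      ((hasDerivAt_id t).sub_const T).hasDerivWithinAt (s := Icc T (T + τ))
      (fun r hr => show r - T ∈ Icc 0 τ from ⟨by linarith [hr.1], by linarith [hr.2]⟩)
    rw [one_smul] at this
    exact this.congr (fun r hr => g2 r hr.1) (g2 t ht.1)
  refine ⟨fun t ht => ?_, fun t ht => ?_⟩
  · have hU : Icc 0 T ∪ Icc T (T + τ) = Icc 0 (T + τ) :=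
      Icc_union_Icc_eq_Icc hT (by linarith)
    rw [← hU]
    -- At `T` the one-sided derivatives of the two pieces agree. At any other time one piece stays
    -- away from `t`, and on it every vector is a derivative.
    rcases lt_trichotomy t T with h' | rfl | h'
    · refine (d1 t ⟨ht.1, h'.le⟩).union (hasDerivWithinAt_of_notMem_closure ?_)
      rw [closure_Icc]
      exact fun hh => absurd hh.1 (not_le.2 h')
    · exact (d1 t ⟨hT, le_rfl⟩).union (d2 t ⟨le_rfl, by linarith⟩)
    · refine (hasDerivWithinAt_of_notMem_closure ?_).union (d2 t ⟨h'.le, ht.2⟩)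
      rw [closure_Icc]
      exact fun hh => absurd hh.2 (not_le.2 h')
  · rcases le_total t T with h' | h'
    · rw [g1 t h']
      exact h.mem t ⟨ht.1, h'⟩
    · rw [g2 t h']
      exact h₁.mem _ ⟨by linarith, by linarith [ht.2]⟩

/-- Global existence from a priori bounds. -/
theorem IsLipschitzExhaustion.exists_global [CompleteSpace E] (hK : IsLipschitzExhaustion f K)
    (z₀ : E) (h₀ : ∃ R, z₀ ∈ K R)
    (hap : ∀ T₀ : ℝ, ∃ R, ∀ T, 0 ≤ T → T ≤ T₀ → ∀ w : ℝ → E, w 0 = z₀ → IsSolOn f K T w →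
      w T ∈ K R) :
    ∃ w : ℝ → E, w 0 = z₀ ∧ ∀ T, IsSolOn f K T w := by
  have fin : ∀ T₀ : ℝ, ∃ w : ℝ → E, w 0 = z₀ ∧ IsSolOn f K T₀ w := by
    intro T₀
    obtain ⟨R, hR⟩ := hap T₀
    obtain ⟨τ, hτ, hloc⟩ := hK.exists_local R
    -- The a priori bound puts every endpoint reached before `T₀` in the same `K R`, so each
    -- extension gains the same time `τ`.
    have step : ∀ n : ℕ, ∃ w : ℝ → E, w 0 = z₀ ∧ IsSolOn f K (min (n * τ) T₀) w := by
      intro n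
      induction n with
      | zero =>
        refine ⟨fun _ => z₀, rfl, ⟨fun t ht => ?_, fun _ _ => h₀⟩⟩
        have ht0 : t = 0 := by
          have := ht.2.trans (min_le_left _ _)
          simp only [Nat.cast_zero, zero_mul] at this
          exact le_antisymm this ht.1
        have : Icc 0 (min ((0 : ℕ) * τ) T₀) ⊆ {t} := by
          intro r hr
          have h := hr.2.trans (min_le_left _ _)
          simp only [Nat.cast_zero, zero_mul] at h
          rw [mem_singleton_iff, ht0]
          exact le_antisymm h hr.1
        exact (hasDerivWithinAt_of_subsingleton (subsingleton_singleton.anti this))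
      | succ n ih =>
        obtain ⟨w, hw0, hw⟩ := ih
        rcases le_or_gt T₀ (n * τ) with hn | hn
        · rw [min_eq_right hn] at hw
          exact ⟨w, hw0, hw.mono (min_le_right _ _)⟩
        · rw [min_eq_left hn.le] at hw
          have hnτ : 0 ≤ n * τ := by positivity
          obtain ⟨w₁, h10, hw₁⟩ := hloc _ (hR _ hnτ hn.le w hw0 hw)
          refine ⟨_, ?_, (hw.glue hnτ hτ.le hw₁ h10).mono ?_⟩
          · simp [hnτ, hw0]
          · refine (min_le_left _ _).trans (le_of_eq ?_)
            push_cast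
            ring
    obtain ⟨n, hn⟩ := exists_nat_gt (T₀ / τ)
    obtain ⟨w, hw0, hw⟩ := step n
    rw [min_eq_right ((div_lt_iff₀ hτ).1 hn).le] at hw
    exact ⟨w, hw0, hw⟩
  choose W hW0 hW using fin
  have agree : ∀ T T', T ≤ T' → EqOn (W T) (W T') (Icc 0 T) := fun T T' h =>
    hK.eqOn ((hW T').mono h) (hW T).continuousOn (fun t ht _ => (hW T).deriv t ht)
      ((hW0 T).trans (hW0 T').symm)
  -- The solutions on different intervals agree where both are defined, so the diagonal coincides on
  -- `[0, T]` with the single solution `W T`.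
  refine ⟨fun t => W t t, hW0 0, fun T => ?_⟩
  have e : EqOn (fun t => W t t) (W T) (Icc 0 T) := fun t ht => agree t T ht.2 ⟨ht.1, le_rfl⟩
  refine ⟨fun t ht => ?_, fun t ht => ?_⟩
  · have := ((hW T).deriv t ht).congr e (e ht)
    rwa [← e ht] at this
  · have := (hW T).mem t ht
    rwa [← e ht] at this

end ODE

/-! ### Absolutely continuous functions on the line and weak derivatives -/

/-- `F` is a primitive of the locally integrable function `f`. -/
structure IsPrim (F f : ℝ → ℝ) : Prop where
  locInt : LocallyIntegrable f
  eq : ∀ x, F x = F 0 + ∫ t in (0 : ℝ)..x, f t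

lemma locallyIntegrable_intervalIntegrable {f : ℝ → ℝ} (hf : LocallyIntegrable f) (a b : ℝ) :
    IntervalIntegrable f volume a b :=
  (hf.integrableOn_isCompact isCompact_uIcc).intervalIntegrable

lemma locallyIntegrable_of_intervalIntegrable {f : ℝ → ℝ}
    (hf : ∀ a b, IntervalIntegrable f volume a b) : LocallyIntegrable f := by
  intro x
  refine ⟨Icc (x - 1) (x + 1), Icc_mem_nhds (by linarith) (by linarith), ?_⟩
  exact (intervalIntegrable_iff_integrableOn_Icc_of_le (by linarith)).1 (hf (x - 1) (x + 1))

/-- `F` is bounded on the interval, `φ` is Lipschitz on a bounded set, and a Lipschitz map enlarges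
the sums of increments by a constant factor only. -/
lemma AbsolutelyContinuousOnInterval.comp_contDiff {φ F : ℝ → ℝ} {a b : ℝ} (hφ : ContDiff ℝ 1 φ)
    (hF : AbsolutelyContinuousOnInterval F a b) :
    AbsolutelyContinuousOnInterval (fun x => φ (F x)) a b := by
  obtain ⟨C, hC⟩ := hF.exists_bound
  obtain ⟨L, hL⟩ := hφ.contDiffOn.exists_lipschitzOnWith one_ne_zero (convex_Icc (-C) C)
    isCompact_Icc
  have hmem : ∀ x ∈ uIcc a b, F x ∈ Icc (-C) C := fun x hx => abs_le.1 (hC x hx)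
  rw [absolutelyContinuousOnInterval_iff] at hF ⊢
  intro ε hε
  obtain ⟨δ, hδ, h⟩ := hF (ε / (L + 1)) (by positivity)
  refine ⟨δ, hδ, fun E hE hlen => ?_⟩
  have h1 := h E hE hlen
  calc _ ≤ ∑ i ∈ Finset.range E.1, L * dist (F (E.2 i).1) (F (E.2 i).2) := by
        refine Finset.sum_le_sum fun i hi => ?_
        exact hL.dist_le_mul _ (hmem _ (hE.1 i hi).1) _ (hmem _ (hE.1 i hi).2)
    _ = L * ∑ i ∈ Finset.range E.1, dist (F (E.2 i).1) (F (E.2 i).2) := by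
        rw [Finset.mul_sum]
    _ ≤ L * (ε / (L + 1)) := by gcongr
    _ < (L + 1) * (ε / (L + 1)) := by gcongr; linarith
    _ = ε := by field_simp

namespace IsPrim

variable {F G f g : ℝ → ℝ}

lemma intervalIntegrable (h : IsPrim F f) (a b : ℝ) : IntervalIntegrable f volume a b :=
  locallyIntegrable_intervalIntegrable h.locInt a b

lemma sub_eq (h : IsPrim F f) (a b : ℝ) : F b - F a = ∫ t in a..b, f t := by
  rw [h.eq a, h.eq b, ← intervalIntegral.integral_add_adjacent_intervals
    (h.intervalIntegrable 0 a) (h.intervalIntegrable a b)]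
  ring

lemma ac (h : IsPrim F f) (a b : ℝ) : AbsolutelyContinuousOnInterval F a b := by
  have h1 := (h.intervalIntegrable a b).absolutelyContinuousOnInterval_intervalIntegral
    (c := a) left_mem_uIcc
  have h2 : AbsolutelyContinuousOnInterval (fun _ : ℝ => F a) a b :=
    (contDiff_const.contDiffOn (s := uIcc a b) (𝕜 := ℝ) (n := 1)).absolutelyContinuousOnInterval
  have : F = (fun _ => F a) + fun x => ∫ t in a..x, f t := by
    funext x
    simp only [Pi.add_apply]
    linarith [h.sub_eq a x]
  rw [this]
  exact h2.add h1

lemma continuous (h : IsPrim F f) : Continuous F := by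
  have : F = fun x => F 0 + ∫ t in (0 : ℝ)..x, f t := funext h.eq
  rw [this]
  exact continuous_const.add (intervalIntegral.continuous_primitive h.intervalIntegrable 0)

lemma ae_hasDerivAt (h : IsPrim F f) : ∀ᵐ x, HasDerivAt F (f x) x := by
  filter_upwards [LocallyIntegrable.ae_hasDerivAt_integral h.locInt] with x hx
  have : F = fun x => F 0 + ∫ t in (0 : ℝ)..x, f t := funext h.eq
  rw [this]
  exact (hx 0).const_add _

/-- The fundamental theorem of calculus for absolutely continuous functions. It lets the rules for
products, sums and compositions be checked by differentiating almost everywhere. -/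
lemma of_ac (hF : ∀ a b, AbsolutelyContinuousOnInterval F a b)
    (hd : ∀ᵐ x, HasDerivAt F (f x) x) : IsPrim F f := by
  have e : deriv F =ᵐ[volume] f := by
    filter_upwards [hd] with x hx using hx.deriv
  refine ⟨?_, fun x => ?_⟩
  · have : LocallyIntegrable (deriv F) :=
      locallyIntegrable_of_intervalIntegrable fun a b => (hF a b).intervalIntegrable_deriv
    exact this.congr e
  · have := (hF 0 x).integral_deriv_eq_sub
    rw [intervalIntegral.integral_congr_ae (e.mono fun y hy _ => hy)] at this
    linarith

lemma congr (h : IsPrim F f) (hfg : f =ᵐ[volume] g) : IsPrim F g :=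
  of_ac h.ac (by filter_upwards [h.ae_hasDerivAt, hfg] with x hx e; rwa [← e])

lemma mul (hF : IsPrim F f) (hG : IsPrim G g) :
    IsPrim (fun x => F x * G x) (fun x => f x * G x + F x * g x) :=
  of_ac (fun a b => (hF.ac a b).mul (hG.ac a b)) (by
    filter_upwards [hF.ae_hasDerivAt, hG.ae_hasDerivAt] with x h1 h2 using h1.mul h2)

lemma add (hF : IsPrim F f) (hG : IsPrim G g) :
    IsPrim (fun x => F x + G x) (fun x => f x + g x) :=
  of_ac (fun a b => (hF.ac a b).add (hG.ac a b)) (by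
    filter_upwards [hF.ae_hasDerivAt, hG.ae_hasDerivAt] with x h1 h2 using h1.add h2)

lemma const_mul (c : ℝ) (hF : IsPrim F f) : IsPrim (fun x => c * F x) (fun x => c * f x) :=
  of_ac (fun a b => (hF.ac a b).const_mul c) (by
    filter_upwards [hF.ae_hasDerivAt] with x h1 using h1.const_mul c)

lemma comp_contDiff {φ : ℝ → ℝ} (hφ : ContDiff ℝ 1 φ) (hF : IsPrim F f) :
    IsPrim (fun x => φ (F x)) (fun x => deriv φ (F x) * f x) :=
  of_ac (fun a b => AbsolutelyContinuousOnInterval.comp_contDiff hφ (hF.ac a b)) (by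
    filter_upwards [hF.ae_hasDerivAt] with x h1
    exact ((hφ.differentiable one_ne_zero).differentiableAt.hasDerivAt).comp x h1)

lemma of_integral (c : ℝ) (hf : LocallyIntegrable f) :
    IsPrim (fun x => c + ∫ t in (0 : ℝ)..x, f t) f :=
  ⟨hf, fun x => by simp⟩

lemma of_contDiff (hF : ContDiff ℝ 1 F) : IsPrim F (deriv F) :=
  of_ac (fun _ _ => hF.contDiffOn.absolutelyContinuousOnInterval)
    (ae_of_all _ fun _ => (hF.differentiable one_ne_zero).differentiableAt.hasDerivAt)

/-- Integrability of `f` gives a limit, and integrability of `F` rules out a nonzero one. -/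
lemma tendsto_atTop_zero (h : IsPrim F f) (hf : Integrable f) (hF : Integrable F) :
    Tendsto F atTop (𝓝 0) := by
  have t1 : Tendsto F atTop (𝓝 (F 0 + ∫ x in Ioi 0, f x)) := by
    have := intervalIntegral_tendsto_integral_Ioi 0 hf.integrableOn tendsto_id
    refine (this.const_add (F 0)).congr fun x => (h.eq x).symm
  have : F 0 + ∫ x in Ioi 0, f x = 0 := by
    refine IntegrableAtFilter.eq_zero_of_tendsto (hF.integrableAtFilter atTop) ?_ t1
    intro s hs
    rcases mem_atTop_sets.1 hs with ⟨b, hb⟩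
    rw [← top_le_iff, ← Real.volume_Ici (a := b)]
    exact measure_mono hb
  rwa [this] at t1

lemma tendsto_atBot_zero (h : IsPrim F f) (hf : Integrable f) (hF : Integrable F) :
    Tendsto F atBot (𝓝 0) := by
  have t1 : Tendsto F atBot (𝓝 (F 0 - ∫ x in Iic 0, f x)) := by
    have := intervalIntegral_tendsto_integral_Iic 0 hf.integrableOn tendsto_id
    refine (this.const_sub (F 0)).congr fun x => ?_
    rw [id, ← h.sub_eq x 0]
    ring
  have : F 0 - ∫ x in Iic 0, f x = 0 := by
    refine IntegrableAtFilter.eq_zero_of_tendsto (hF.integrableAtFilter atBot) ?_ t1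
    intro s hs
    rcases mem_atBot_sets.1 hs with ⟨b, hb⟩
    rw [← top_le_iff, ← Real.volume_Iic (a := b)]
    exact measure_mono hb
  rwa [this] at t1

lemma eq_integral_Iic (h : IsPrim F f) (hf : Integrable f) (hF : Integrable F) (x : ℝ) :
    F x = ∫ t in Iic x, f t := by
  have t1 := intervalIntegral_tendsto_integral_Iic x hf.integrableOn tendsto_id
  have t2 : Tendsto (fun y => F x - F y) atBot (𝓝 (F x - 0)) :=
    (h.tendsto_atBot_zero hf hF).const_sub _
  rw [sub_zero] at t2
  exact tendsto_nhds_unique t2 (t1.congr fun y => (h.sub_eq y x).symm)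

/-- `F` vanishes at both ends of the line. Integration by parts against test functions and the
vanishing of the total energy flux both rest on this. -/
lemma integral_eq_zero (h : IsPrim F f) (hf : Integrable f) (hF : Integrable F) :
    ∫ x, f x = 0 := by
  have t1 := intervalIntegral_tendsto_integral_Ioi 0 hf.integrableOn tendsto_id
  have t2 : Tendsto (fun y => F y - F 0) atTop (𝓝 (0 - F 0)) :=
    (h.tendsto_atTop_zero hf hF).sub_const _
  have e1 := tendsto_nhds_unique t2 (t1.congr fun y => (h.sub_eq 0 y).symm)
  have e2 := h.eq_integral_Iic hf hF 0
  rw [← intervalIntegral.integral_Iic_add_Ioi hf.integrableOn hf.integrableOn (b := 0)]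
  linarith

lemma abs_le_integral (h : IsPrim F f) (hf : Integrable f) (hF : Integrable F) (x : ℝ) :
    |F x| ≤ ∫ t, |f t| := by
  rw [h.eq_integral_Iic hf hF x]
  exact (abs_integral_le_integral_abs).trans
    (setIntegral_le_integral hf.abs (ae_of_all _ fun _ => abs_nonneg _))

lemma hasWeakDeriv (h : IsPrim F f) : HasWeakDeriv F f := by
  intro φ hφ hc
  have hp := h.mul (of_contDiff (hφ.of_le (by simp)))
  have hφc : Continuous (deriv φ) := hφ.continuous_deriv (by simp)
  have i1 : Integrable fun x => f x * φ x := by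
    simpa [mul_comm] using h.locInt.integrable_smul_left_of_hasCompactSupport hφ.continuous hc
  have i2 : Integrable fun x => F x * deriv φ x :=
    (h.continuous.mul hφc).integrable_of_hasCompactSupport hc.deriv.mul_left
  have := hp.integral_eq_zero (i1.add i2)
    ((h.continuous.mul hφ.continuous).integrable_of_hasCompactSupport hc.mul_left)
  rw [integral_add i1 i2] at this
  linarith

/-- An `H¹` function on the line is bounded by the sum of two `L²` norms. -/
lemma abs_le_of_sq (h : IsPrim F f) (hF : MemLp F 2) (hf : MemLp f 2) (x : ℝ) :
    |F x| ≤ (eLpNorm F 2 volume).toReal + (eLpNorm f 2 volume).toReal := by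
  have hsq : ∀ g : ℝ → ℝ, MemLp g 2 → ∫ y in Icc x (x + 1), |g y| ≤
      (eLpNorm g 2 volume).toReal := by
    intro g hg
    have h1 := eLpNorm_le_eLpNorm_mul_rpow_measure_univ (p := 1) (q := 2)
      (μ := volume.restrict (Icc x (x + 1))) (f := g) (by norm_num)
      (hg.1.mono_measure Measure.restrict_le_self)
    simp only [Measure.restrict_apply_univ, Real.volume_Icc, add_sub_cancel_left,
      ENNReal.ofReal_one, ENNReal.one_rpow, mul_one] at h1
    have h2 := h1.trans (eLpNorm_restrict_le g 2 volume (Icc x (x + 1)))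
    have h3 := ENNReal.toReal_mono hg.2.ne h2
    rwa [eLpNorm_one_eq_lintegral_enorm, ← integral_norm_eq_lintegral_enorm
      (hg.1.mono_measure Measure.restrict_le_self)] at h3
  -- The value at `x` is compared with the value at `y` and then averaged over `y`. The interval has
  -- length one, so its `L¹` norms are at most the `L²` norms.
  have key : ∀ y ∈ Icc x (x + 1), |F x| ≤ |F y| + (eLpNorm f 2 volume).toReal := by
    intro y hy
    have h1 : |F y - F x| ≤ ∫ t in Icc x (x + 1), |f t| := by
      rw [h.sub_eq x y, intervalIntegral.integral_of_le hy.1]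
      refine abs_integral_le_integral_abs.trans ?_
      refine setIntegral_mono_set ?_ (ae_of_all _ fun _ => abs_nonneg _) ?_
      · exact (h.locInt.integrableOn_isCompact isCompact_Icc).abs
      · exact LE.le.eventuallyLE (Ioc_subset_Icc_self.trans (Icc_subset_Icc_right hy.2))
    have h2 := hsq f hf
    have h3 := abs_sub_abs_le_abs_sub (F x) (F y)
    rw [abs_sub_comm] at h3
    linarith
  have hI : ∫ y in Icc x (x + 1), |F x| ≤
      ∫ y in Icc x (x + 1), (|F y| + (eLpNorm f 2 volume).toReal) := by
    refine setIntegral_mono_on ?_ ?_ measurableSet_Icc key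
    · exact integrableOn_const (by simp)
    · exact (h.continuous.abs.add continuous_const).continuousOn.integrableOn_Icc
  rw [integral_add h.continuous.abs.continuousOn.integrableOn_Icc
    (integrableOn_const (by simp))] at hI
  simp only [integral_const, MeasurableSet.univ, measureReal_restrict_apply, univ_inter,
    Real.volume_real_Icc, add_sub_cancel_left, smul_eq_mul] at hI
  have := hsq F hF
  norm_num at hI
  linarith

end IsPrim

lemma HasWeakDeriv.congr {F G f g : ℝ → ℝ} (h : HasWeakDeriv F f) (hF : F =ᵐ[volume] G)
    (hf : f =ᵐ[volume] g) : HasWeakDeriv G g := by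
  intro φ hφ hc
  have := h φ hφ hc
  have e1 : ∫ x, F x * deriv φ x = ∫ x, G x * deriv φ x :=
    integral_congr_ae (hF.mul (EventuallyEq.refl _ (deriv φ)))
  have e2 : ∫ x, f x * φ x = ∫ x, g x * φ x :=
    integral_congr_ae (hf.mul (EventuallyEq.refl _ φ))
  rwa [e1, e2] at this

lemma HasWeakDeriv.unique {F f g : ℝ → ℝ} (hf : HasWeakDeriv F f) (hg : HasWeakDeriv F g)
    (lf : LocallyIntegrable f) (lg : LocallyIntegrable g) : f =ᵐ[volume] g := by
  refine ae_eq_of_integral_contDiff_smul_eq lf lg fun φ hφ hc => ?_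
  have h1 := hf φ hφ hc
  have h2 := hg φ hφ hc
  simp only [smul_eq_mul, mul_comm (φ _)]
  linarith

/-- A locally integrable function with vanishing weak derivative is constant. -/
lemma HasWeakDeriv.ae_eq_const {h : ℝ → ℝ} (hh : LocallyIntegrable h)
    (h0 : HasWeakDeriv h (fun _ => 0)) : ∃ C, h =ᵐ[volume] fun _ => C := by
  let b : ContDiffBump (0 : ℝ) := default
  set η : ℝ → ℝ := b.normed volume with hη
  have ηs : ContDiff ℝ ∞ η := b.contDiff_normed
  have ηc : HasCompactSupport η := b.hasCompactSupport_normed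
  have η1 : ∫ x, η x = 1 := b.integral_normed
  have hint : ∀ φ : ℝ → ℝ, Continuous φ → HasCompactSupport φ →
      Integrable fun x => h x * φ x := fun φ hφ hc => by
    simpa [mul_comm] using hh.integrable_smul_left_of_hasCompactSupport hφ hc
  refine ⟨∫ x, h x * η x, ?_⟩
  refine ae_eq_of_integral_contDiff_smul_eq hh (locallyIntegrable_const _) fun ψ hψ hψc => ?_
  -- Du Bois-Reymond: removing the mean of `ψ` with the help of `η` leaves a function whose
  -- primitive `φ` has compact support, so that `φ` is a legitimate test function.
  set χ : ℝ → ℝ := fun x => ψ x - (∫ y, ψ y) * η x with hχ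
  have χs : ContDiff ℝ ∞ χ := hψ.sub (contDiff_const.mul ηs)
  have χc : HasCompactSupport χ := by
    have h2 : HasCompactSupport fun x => (∫ y, ψ y) * η x := ηc.mul_left (f := fun _ => ∫ y, ψ y)
    exact hψc.sub h2
  have ψi : Integrable ψ := hψ.continuous.integrable_of_hasCompactSupport hψc
  have ηi : Integrable η := ηs.continuous.integrable_of_hasCompactSupport ηc
  have χ0 : ∫ x, χ x = 0 := by
    rw [hχ, integral_sub ψi (ηi.const_mul _), integral_const_mul, η1]
    ring
  obtain ⟨N, hN0, hN⟩ : ∃ N : ℝ, 0 ≤ N ∧ ∀ x, N < |x| → χ x = 0 := by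
    obtain ⟨N, hN⟩ := χc.isCompact.isBounded.exists_norm_le
    refine ⟨max N 0, le_max_right _ _, fun x hx => ?_⟩
    by_contra hne
    have := hN x (subset_tsupport _ hne)
    rw [Real.norm_eq_abs] at this
    linarith [le_max_left N 0]
  have χsupp : Function.support χ ⊆ Ioc (-(N + 1)) (N + 1) := by
    intro x hx
    have : |x| ≤ N := by
      by_contra hne
      exact hx (hN x (not_le.1 hne))
    have := abs_le.1 this
    exact ⟨by linarith, by linarith⟩
  set φ : ℝ → ℝ := fun x => ∫ t in (-(N + 1))..x, χ t with hφ
  have φd : ∀ x, HasDerivAt φ (χ x) x := fun x =>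
    intervalIntegral.integral_hasDerivAt_right (χs.continuous.intervalIntegrable _ _)
      (χs.continuous.stronglyMeasurableAtFilter _ _) χs.continuous.continuousAt
  have dφ : deriv φ = χ := funext fun x => (φd x).deriv
  have φs : ContDiff ℝ ∞ φ := by
    rw [contDiff_infty_iff_deriv, dφ]
    exact ⟨fun x => (φd x).differentiableAt, χs⟩
  have φc : HasCompactSupport φ := by
    refine HasCompactSupport.of_support_subset_isCompact (isCompact_Icc (a := -(N + 1))
      (b := N + 1)) ?_
    intro x hx
    by_contra hne
    apply hx
    rw [mem_Icc, not_and_or, not_le, not_le] at hne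
    rcases hne with h1 | h1
    · refine intervalIntegral.integral_zero_ae (ae_of_all _ fun t ht => hN t ?_)
      rw [uIoc_of_ge h1.le] at ht
      rw [lt_abs]
      right
      linarith [ht.2]
    · have : φ x = ∫ t, χ t :=
        intervalIntegral.integral_eq_integral_of_support_subset
          (χsupp.trans (Ioc_subset_Ioc_right h1.le))
      rw [this, χ0]
  have := h0 φ φs φc
  rw [dφ] at this
  simp only [zero_mul, integral_zero, neg_zero] at this
  have e : ∀ x, h x * χ x = h x * ψ x - (∫ y, ψ y) * (h x * η x) := fun x => by
    rw [hχ]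
    ring
  simp only [e] at this
  rw [integral_sub (hint ψ hψ.continuous hψc) ((hint η ηs.continuous ηc).const_mul _),
    integral_const_mul] at this
  simp only [smul_eq_mul, mul_comm (ψ _)]
  rw [integral_const_mul]
  linarith

/-- A locally integrable function with locally integrable weak derivative has an absolutely
continuous representative. -/
lemma HasWeakDeriv.exists_isPrim {F f : ℝ → ℝ} (h : HasWeakDeriv F f) (hF : LocallyIntegrable F)
    (hf : LocallyIntegrable f) : ∃ G, IsPrim G f ∧ F =ᵐ[volume] G := by
  have hp := IsPrim.of_integral 0 hf
  set G₀ : ℝ → ℝ := fun x => 0 + ∫ t in (0 : ℝ)..x, f t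
  have hd : HasWeakDeriv (fun x => F x - G₀ x) (fun _ => 0) := by
    intro φ hφ hc
    have h1 := h φ hφ hc
    have h2 := hp.hasWeakDeriv φ hφ hc
    have hdc : Continuous (deriv φ) := hφ.continuous_deriv (by simp)
    simp only [sub_mul, zero_mul, integral_zero, neg_zero]
    rw [integral_sub, h1, h2, sub_self]
    · simpa [mul_comm] using hF.integrable_smul_left_of_hasCompactSupport hdc hc.deriv
    · exact (hp.continuous.mul hdc).integrable_of_hasCompactSupport hc.deriv.mul_left
  obtain ⟨C, hC⟩ := hd.ae_eq_const (hF.sub hp.continuous.locallyIntegrable)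
  refine ⟨fun x => C + ∫ t in (0 : ℝ)..x, f t, IsPrim.of_integral C hf, ?_⟩
  filter_upwards [hC] with x hx
  simp only [G₀, zero_add, Pi.sub_apply] at hx
  linarith

/-! ### The space `L² ∩ L^∞` -/

abbrev Linf : Type := Lp ℝ ∞ (volume : Measure ℝ)

/-- A representative of an element of `L² ∩ L^∞`. -/
def fn (p : L2Linf) : ℝ → ℝ := p.1.fst

lemma fn_ae_eq_snd (p : L2Linf) : fn p =ᵐ[volume] p.1.snd := p.2

lemma measurable_fn (p : L2Linf) : Measurable (fn p) := (Lp.stronglyMeasurable p.1.fst).measurable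

lemma aesm_fn (p : L2Linf) : AEStronglyMeasurable (fn p) volume := Lp.aestronglyMeasurable p.1.fst

lemma memLp_two_fn (p : L2Linf) : MemLp (fn p) 2 := Lp.memLp p.1.fst

lemma memLp_top_fn (p : L2Linf) : MemLp (fn p) ∞ := (Lp.memLp p.1.snd).ae_eq (fn_ae_eq_snd p).symm

lemma norm_L2Linf_eq (p : L2Linf) :
    ‖p‖ = (eLpNorm (fn p) 2 volume).toReal + (eLpNorm (fn p) ∞ volume).toReal := by
  change ‖p.1‖ = _
  rw [WithLp.prod_norm_eq_of_L1, Lp.norm_def, Lp.norm_def,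
    ← eLpNorm_congr_ae (p := ∞) (fn_ae_eq_snd p)]
  rfl

lemma fn_ext {p q : L2Linf} (h : fn p =ᵐ[volume] fn q) : p = q := by
  refine Subtype.ext (WithLp.ofLp_injective 1 (Prod.ext (Lp.ext h) (Lp.ext ?_)))
  exact (fn_ae_eq_snd p).symm.trans (h.trans (fn_ae_eq_snd q))

lemma fn_add (p q : L2Linf) : ∀ᵐ Y, fn (p + q) Y = fn p Y + fn q Y := Lp.coeFn_add _ _

lemma fn_sub (p q : L2Linf) : ∀ᵐ Y, fn (p - q) Y = fn p Y - fn q Y := Lp.coeFn_sub _ _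

lemma fn_smul (c : ℝ) (p : L2Linf) : ∀ᵐ Y, fn (c • p) Y = c * fn p Y := Lp.coeFn_smul _ _

lemma fn_zero : ∀ᵐ Y, fn 0 Y = 0 := Lp.coeFn_zero _ _ _

lemma Linf.ae_abs_le (p : Linf) : ∀ᵐ Y, |p Y| ≤ ‖p‖ := by
  filter_upwards [ae_le_eLpNormEssSup (f := (p : ℝ → ℝ)) (μ := volume)] with Y hY
  have := ENNReal.toReal_mono (by simpa using (Lp.memLp p).2.ne) hY
  rwa [toReal_enorm, Real.norm_eq_abs, ← eLpNorm_exponent_top, ← Lp.norm_def] at this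

lemma Linf.norm_le {p : Linf} {C : ℝ} (hC : 0 ≤ C) (h : ∀ᵐ Y, |p Y| ≤ C) : ‖p‖ ≤ C := by
  rw [Lp.norm_def]
  refine ENNReal.toReal_le_of_le_ofReal hC ?_
  rw [eLpNorm_exponent_top]
  exact eLpNormEssSup_le_of_ae_bound h

lemma ae_abs_fn_le (p : L2Linf) : ∀ᵐ Y, |fn p Y| ≤ ‖p‖ := by
  filter_upwards [Linf.ae_abs_le p.1.snd, fn_ae_eq_snd p] with Y h1 h2
  rw [h2]
  refine h1.trans ?_
  change _ ≤ ‖p.1‖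
  rw [WithLp.prod_norm_eq_of_L1]
  linarith [norm_nonneg p.1.fst]

/-- Both parts of the norm are monotone in the absolute value. This reduces norm estimates in
`L2Linf` to inequalities between functions. -/
lemma norm_le_of_ae_le {p q : L2Linf} (h : ∀ᵐ Y, |fn p Y| ≤ |fn q Y|) : ‖p‖ ≤ ‖q‖ := by
  rw [norm_L2Linf_eq, norm_L2Linf_eq]
  exact add_le_add (ENNReal.toReal_mono (memLp_two_fn q).2.ne (eLpNorm_mono_ae h))
    (ENNReal.toReal_mono (memLp_top_fn q).2.ne (eLpNorm_mono_ae h))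

/-- Membership of a function in `L² ∩ L^∞`. -/
structure IsA (f : ℝ → ℝ) : Prop where
  two : MemLp f 2
  top : MemLp f ∞

lemma isA_fn (p : L2Linf) : IsA (fn p) := ⟨memLp_two_fn p, memLp_top_fn p⟩

lemma IsA.of_le {f : ℝ → ℝ} (hf : AEStronglyMeasurable f volume) {q : L2Linf}
    (h : ∀ᵐ Y, |f Y| ≤ |fn q Y|) : IsA f :=
  ⟨(memLp_two_fn q).of_le hf h, (memLp_top_fn q).of_le hf h⟩

lemma IsA.mul_bdd {f b : ℝ → ℝ} (hf : IsA f) (hb : MemLp b ∞) : IsA (fun Y => b Y * f Y) :=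
  ⟨hf.two.mul hb, hf.top.mul hb⟩

open Classical in
/-- The class of a function in `L² ∩ L^∞`. -/
def mkA (f : ℝ → ℝ) : L2Linf :=
  if h : IsA f then
    ⟨WithLp.toLp 1 (h.two.toLp f, h.top.toLp f), h.two.coeFn_toLp.trans h.top.coeFn_toLp.symm⟩
  else 0

lemma fn_mkA {f : ℝ → ℝ} (h : IsA f) : fn (mkA f) =ᵐ[volume] f := by
  rw [mkA, dif_pos h]
  exact h.two.coeFn_toLp

lemma norm_mkA_le {f : ℝ → ℝ} {C₁ C₂ : ℝ} (hC₁ : 0 ≤ C₁) (hC₂ : 0 ≤ C₂) (h : IsA f)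
    (h₁ : eLpNorm f 2 volume ≤ ENNReal.ofReal C₁) (h₂ : ∀ᵐ Y, |f Y| ≤ C₂) :
    ‖mkA f‖ ≤ C₁ + C₂ := by
  rw [norm_L2Linf_eq, eLpNorm_congr_ae (fn_mkA h), eLpNorm_congr_ae (fn_mkA h)]
  refine add_le_add (ENNReal.toReal_le_of_le_ofReal hC₁ h₁)
    (ENNReal.toReal_le_of_le_ofReal hC₂ ?_)
  rw [eLpNorm_exponent_top]
  exact eLpNormEssSup_le_of_ae_bound h₂

/-- The inclusion into `L²`. -/
def toL2 : L2Linf →L[ℝ] Lp ℝ 2 (volume : Measure ℝ) :=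
  LinearMap.mkContinuous ⟨⟨fun p => p.1.fst, fun _ _ => rfl⟩, fun _ _ => rfl⟩ 1 fun p => by
    rw [one_mul]
    change _ ≤ ‖p.1‖
    rw [WithLp.prod_norm_eq_of_L1]
    exact le_add_of_nonneg_right (norm_nonneg _)

lemma coeFn_toL2 (p : L2Linf) : (toL2 p : ℝ → ℝ) = fn p := rfl

/-- The inclusion into `L^∞`. -/
def toLinf : L2Linf →L[ℝ] Linf :=
  LinearMap.mkContinuous ⟨⟨fun p => p.1.snd, fun _ _ => rfl⟩, fun _ _ => rfl⟩ 1 fun p => by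
    rw [one_mul]
    change _ ≤ ‖p.1‖
    rw [WithLp.prod_norm_eq_of_L1]
    exact le_add_of_nonneg_left (norm_nonneg _)

lemma coeFn_toLinf (p : L2Linf) : (toLinf p : ℝ → ℝ) =ᵐ[volume] fn p := (fn_ae_eq_snd p).symm

lemma isA_mul (ξ : Linf) (p : L2Linf) : IsA (fun Y => ξ Y * fn p Y) :=
  (isA_fn p).mul_bdd (Lp.memLp ξ)

lemma norm_mkA_mul_le (ξ : Linf) (p : L2Linf) : ‖mkA fun Y => ξ Y * fn p Y‖ ≤ 1 * ‖ξ‖ * ‖p‖ := by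
  have : ‖mkA fun Y => ξ Y * fn p Y‖ ≤ ‖‖ξ‖ • p‖ := by
    refine norm_le_of_ae_le ?_
    filter_upwards [fn_mkA (isA_mul ξ p), fn_smul ‖ξ‖ p, Linf.ae_abs_le ξ] with Y h1 h2 h3
    rw [h1, h2, abs_mul, abs_mul, abs_norm]
    gcongr
  rw [norm_smul, norm_norm] at this
  rwa [one_mul]

/-- Multiplication of `L² ∩ L^∞` by `L^∞`, as a bilinear map. -/
def smulAₗ : Linf →ₗ[ℝ] L2Linf →ₗ[ℝ] L2Linf :=
  LinearMap.mk₂ ℝ (fun ξ p => mkA fun Y => ξ Y * fn p Y)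
    (fun ξ η p => fn_ext (by
      filter_upwards [fn_mkA (isA_mul (ξ + η) p), fn_mkA (isA_mul ξ p), fn_mkA (isA_mul η p),
        fn_add (mkA fun Y => ξ Y * fn p Y) (mkA fun Y => η Y * fn p Y),
        Lp.coeFn_add ξ η] with Y h1 h2 h3 h4 h5
      rw [h1, h4, h2, h3, h5, Pi.add_apply, add_mul]))
    (fun c ξ p => fn_ext (by
      filter_upwards [fn_mkA (isA_mul (c • ξ) p), fn_mkA (isA_mul ξ p),
        fn_smul c (mkA fun Y => ξ Y * fn p Y), Lp.coeFn_smul c ξ] with Y h1 h2 h4 h5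
      rw [h1, h4, h2, h5, Pi.smul_apply, smul_eq_mul, mul_assoc]))
    (fun ξ p q => fn_ext (by
      filter_upwards [fn_mkA (isA_mul ξ (p + q)), fn_mkA (isA_mul ξ p), fn_mkA (isA_mul ξ q),
        fn_add (mkA fun Y => ξ Y * fn p Y) (mkA fun Y => ξ Y * fn q Y),
        fn_add p q] with Y h1 h2 h3 h4 h5
      rw [h1, h4, h2, h3, h5, mul_add]))
    (fun c ξ p => fn_ext (by
      filter_upwards [fn_mkA (isA_mul ξ (c • p)), fn_mkA (isA_mul ξ p),
        fn_smul c (mkA fun Y => ξ Y * fn p Y), fn_smul c p] with Y h1 h2 h4 h5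
      rw [h1, h4, h2, h5]
      ring))

lemma smulAₗ_apply (ξ : Linf) (p : L2Linf) : smulAₗ ξ p = mkA fun Y => ξ Y * fn p Y := rfl

/-- Multiplication of `L² ∩ L^∞` by `L^∞`. -/
def smulA : Linf →L[ℝ] L2Linf →L[ℝ] L2Linf :=
  smulAₗ.mkContinuous₂ 1 fun ξ p => by
    rw [smulAₗ_apply]
    exact norm_mkA_mul_le ξ p

lemma smulA_apply (ξ : Linf) (p : L2Linf) : smulA ξ p = mkA fun Y => ξ Y * fn p Y := by
  rw [smulA, LinearMap.mkContinuous₂_apply, smulAₗ_apply]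

lemma fn_smulA (ξ : Linf) (p : L2Linf) : ∀ᵐ Y, fn (smulA ξ p) Y = ξ Y * fn p Y := by
  rw [smulA_apply]
  exact fn_mkA (isA_mul ξ p)

lemma norm_smulA_le (ξ : Linf) (p : L2Linf) : ‖smulA ξ p‖ ≤ ‖ξ‖ * ‖p‖ := by
  rw [smulA_apply, ← one_mul ‖ξ‖]
  exact norm_mkA_mul_le ξ p

lemma integrable_mul_fn (p q : L2Linf) : Integrable fun Y => fn p Y * fn q Y :=
  (memLp_two_fn p).integrable_mul (memLp_two_fn q)

lemma inner_toL2 (p q : L2Linf) : inner ℝ (toL2 p) (toL2 q) = ∫ Y, fn p Y * fn q Y := by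
  rw [L2.inner_def]
  refine integral_congr_ae (ae_of_all _ fun Y => ?_)
  simp [coeFn_toL2, mul_comm]

/-! ### Superposition operators -/

/-- Triples of elements of `L² ∩ L^∞`. -/
abbrev Tri : Type := L2Linf × L2Linf × L2Linf

def fn3 (p : Tri) (Y : ℝ) : ℝ × ℝ × ℝ := (fn p.1 Y, fn p.2.1 Y, fn p.2.2 Y)

lemma measurable_fn3 (p : Tri) : Measurable (fn3 p) :=
  (measurable_fn _).prodMk ((measurable_fn _).prodMk (measurable_fn _))

lemma norm_fn3_le (p : Tri) : ∀ᵐ Y, ‖fn3 p Y‖ ≤ ‖p‖ := by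
  filter_upwards [ae_abs_fn_le p.1, ae_abs_fn_le p.2.1, ae_abs_fn_le p.2.2] with Y h1 h2 h3
  exact max_le_max h1 (max_le_max h2 h3)

lemma fn3_sub (p q : Tri) : ∀ᵐ Y, fn3 (p - q) Y = fn3 p Y - fn3 q Y := by
  filter_upwards [fn_sub p.1 q.1, fn_sub p.2.1 q.2.1, fn_sub p.2.2 q.2.2] with Y h1 h2 h3
  exact Prod.ext h1 (Prod.ext h2 h3)

lemma fn3_smul (c : ℝ) (p : Tri) : ∀ᵐ Y, fn3 (c • p) Y = c • fn3 p Y := by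
  filter_upwards [fn_smul c p.1, fn_smul c p.2.1, fn_smul c p.2.2] with Y h1 h2 h3
  exact Prod.ext h1 (Prod.ext h2 h3)

/-- The sum of the absolute values of the three components. -/
def absTri (p : Tri) : L2Linf :=
  (mkA fun Y => |fn p.1 Y|) + ((mkA fun Y => |fn p.2.1 Y|) + mkA fun Y => |fn p.2.2 Y|)

lemma isA_abs (p : L2Linf) : IsA fun Y => |fn p Y| :=
  IsA.of_le (q := p) (measurable_fn p).abs.aestronglyMeasurable (ae_of_all _ fun _ => by simp)

lemma norm_mkA_abs (p : L2Linf) : ‖mkA fun Y => |fn p Y|‖ ≤ ‖p‖ :=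
  norm_le_of_ae_le (by filter_upwards [fn_mkA (isA_abs p)] with Y h; rw [h, abs_abs])

lemma norm_fn3_le_absTri (p : Tri) : ∀ᵐ Y, ‖fn3 p Y‖ ≤ fn (absTri p) Y := by
  filter_upwards [fn_mkA (isA_abs p.1), fn_mkA (isA_abs p.2.1), fn_mkA (isA_abs p.2.2),
    fn_add (mkA fun Y => |fn p.1 Y|) ((mkA fun Y => |fn p.2.1 Y|) + mkA fun Y => |fn p.2.2 Y|),
    fn_add (mkA fun Y => |fn p.2.1 Y|) (mkA fun Y => |fn p.2.2 Y|)] with Y h1 h2 h3 h4 h5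
  rw [absTri, h4, h5, h1, h2, h3]
  have a1 := abs_nonneg (fn p.1 Y)
  have a2 := abs_nonneg (fn p.2.1 Y)
  have a3 := abs_nonneg (fn p.2.2 Y)
  exact max_le (by simp only [fn3, Real.norm_eq_abs]; linarith)
    (max_le (by simp only [fn3, Real.norm_eq_abs]; linarith)
      (by simp only [fn3, Real.norm_eq_abs]; linarith))

lemma norm_absTri_le (p : Tri) : ‖absTri p‖ ≤ 3 * ‖p‖ := by
  have h1 : ‖p.1‖ ≤ ‖p‖ := norm_fst_le p
  have h2 : ‖p.2.1‖ ≤ ‖p‖ := (norm_fst_le p.2).trans (norm_snd_le p)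
  have h3 : ‖p.2.2‖ ≤ ‖p‖ := (norm_snd_le p.2).trans (norm_snd_le p)
  refine (norm_add_le _ _).trans ?_
  refine (add_le_add_right (norm_add_le _ _) _).trans ?_
  linarith [norm_mkA_abs p.1, norm_mkA_abs p.2.1, norm_mkA_abs p.2.2]

/-- The factor 3 counts components: the sup norm of a triple is at most the sum of three absolute
values, each of norm at most that of the triple. -/
lemma norm_le_of_fn3 {r : L2Linf} {q₁ q₂ : Tri} {C₁ C₂ : ℝ} (hC₁ : 0 ≤ C₁) (hC₂ : 0 ≤ C₂)
    (h : ∀ᵐ Y, |fn r Y| ≤ C₁ * ‖fn3 q₁ Y‖ + C₂ * ‖fn3 q₂ Y‖) :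
    ‖r‖ ≤ 3 * C₁ * ‖q₁‖ + 3 * C₂ * ‖q₂‖ := by
  have : ‖r‖ ≤ ‖C₁ • absTri q₁ + C₂ • absTri q₂‖ := by
    refine norm_le_of_ae_le ?_
    filter_upwards [h, fn_add (C₁ • absTri q₁) (C₂ • absTri q₂), fn_smul C₁ (absTri q₁),
      fn_smul C₂ (absTri q₂), norm_fn3_le_absTri q₁, norm_fn3_le_absTri q₂] with Y h0 h1 h2 h3 h4 h5
    rw [h1, h2, h3]
    refine h0.trans (le_trans ?_ (le_abs_self _))
    gcongr
  refine this.trans ((norm_add_le _ _).trans ?_)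
  rw [norm_smul, norm_smul, Real.norm_of_nonneg hC₁, Real.norm_of_nonneg hC₂]
  nlinarith [norm_absTri_le q₁, norm_absTri_le q₂]

/-- The superposition operator `(p, q, r) ↦ F(p, q, r)`. -/
def nem (F : ℝ × ℝ × ℝ → ℝ) (p : Tri) : L2Linf := mkA fun Y => F (fn3 p Y)

variable {F : ℝ × ℝ × ℝ → ℝ}

lemma exists_lipschitz_ball {V W : Type*} [NormedAddCommGroup V] [NormedSpace ℝ V]
    [FiniteDimensional ℝ V] [NormedAddCommGroup W] [NormedSpace ℝ W] {G : V → W}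
    (hG : ContDiff ℝ 1 G) (R : ℝ) :
    ∃ C : ℝ, 0 ≤ C ∧ ∀ x y, ‖x‖ ≤ R → ‖y‖ ≤ R → ‖G x - G y‖ ≤ C * ‖x - y‖ := by
  obtain ⟨C, hC⟩ := hG.contDiffOn.exists_lipschitzOnWith one_ne_zero
    (convex_closedBall (0 : V) R) (isCompact_closedBall _ _)
  exact ⟨C, C.2, fun x y hx hy => by
    have := hC.dist_le_mul x (by simpa using hx) y (by simpa using hy)
    rwa [dist_eq_norm, dist_eq_norm] at this⟩

lemma isA_nem (hF : ContDiff ℝ 1 F) (h0 : F 0 = 0) (p : Tri) : IsA fun Y => F (fn3 p Y) := by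
  obtain ⟨C, hC0, hC⟩ := exists_lipschitz_ball hF ‖p‖
  refine IsA.of_le (q := C • absTri p)
    (hF.continuous.measurable.comp (measurable_fn3 p)).aestronglyMeasurable ?_
  filter_upwards [norm_fn3_le p, norm_fn3_le_absTri p, fn_smul C (absTri p)] with Y h1 h2 h3
  have := hC (fn3 p Y) 0 h1 (by simp)
  rw [h0, sub_zero, sub_zero] at this
  rw [h3]
  refine this.trans (le_trans ?_ (le_abs_self _))
  gcongr

lemma fn_nem (hF : ContDiff ℝ 1 F) (h0 : F 0 = 0) (p : Tri) :
    ∀ᵐ Y, fn (nem F p) Y = F (fn3 p Y) := fn_mkA (isA_nem hF h0 p)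

lemma nem_lipschitz (hF : ContDiff ℝ 1 F) (h0 : F 0 = 0) (R : ℝ) :
    ∃ C : ℝ, 0 ≤ C ∧ ∀ p q : Tri, ‖p‖ ≤ R → ‖q‖ ≤ R → ‖nem F p - nem F q‖ ≤ C * ‖p - q‖ := by
  obtain ⟨C, hC0, hC⟩ := exists_lipschitz_ball hF R
  refine ⟨3 * C, by positivity, fun p q hp hq => ?_⟩
  have := norm_le_of_fn3 (r := nem F p - nem F q) (q₁ := p - q) (q₂ := 0) hC0 le_rfl (by
    filter_upwards [fn_sub (nem F p) (nem F q), fn_nem hF h0 p, fn_nem hF h0 q, fn3_sub p q,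
      norm_fn3_le p, norm_fn3_le q] with Y h1 h2 h3 h4 h5 h6
    rw [h1, h2, h3, h4, zero_mul, add_zero]
    exact hC _ _ (h5.trans hp) (h6.trans hq))
  simpa using this

lemma nem_zero (h0 : F 0 = 0) : nem F 0 = 0 := by
  refine fn_ext ?_
  have e : (fun Y => F (fn3 0 Y)) =ᵐ[volume] fun _ => 0 := by
    filter_upwards [fn_zero] with Y h
    have : fn3 0 Y = 0 := Prod.ext h (Prod.ext h h)
    rw [this, h0]
  have hA : IsA fun Y => F (fn3 0 Y) :=
    ⟨(MemLp.zero (p := 2) (μ := volume) (α := ℝ) (ε := ℝ)).ae_eq e.symm,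
      (MemLp.zero (p := ∞) (μ := volume) (α := ℝ) (ε := ℝ)).ae_eq e.symm⟩
  filter_upwards [fn_mkA hA, e, fn_zero] with Y h1 h2 h3
  rw [nem, h1, h2, h3]

lemma nem_norm_le (hF : ContDiff ℝ 1 F) (h0 : F 0 = 0) (R : ℝ) :
    ∃ C : ℝ, 0 ≤ C ∧ ∀ p : Tri, ‖p‖ ≤ R → ‖nem F p‖ ≤ C * ‖p‖ := by
  obtain ⟨C, hC0, hC⟩ := nem_lipschitz hF h0 R
  refine ⟨C, hC0, fun p hp => ?_⟩
  have := hC p 0 hp (by simpa using (norm_nonneg p).trans hp)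
  rwa [nem_zero h0, sub_zero, sub_zero] at this

lemma taylor_ball (hF : ContDiff ℝ 2 F) (R : ℝ) :
    ∃ C : ℝ, 0 ≤ C ∧ ∀ x y, ‖x‖ ≤ R → ‖y‖ ≤ R →
      |F y - F x - fderiv ℝ F x (y - x)| ≤ C * ‖y - x‖ ^ 2 := by
  have h1 : ContDiff ℝ 1 (fderiv ℝ F) := hF.fderiv_right (by norm_num)
  obtain ⟨C, hC0, hC⟩ := exists_lipschitz_ball h1 R
  refine ⟨C, hC0, fun x y hx hy => ?_⟩
  -- On this convex set, which contains `x` and `y`, the derivative differs from its value at `x` by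
  -- at most `C * ‖y - x‖`. The mean value inequality then supplies the second factor.
  have hs : Convex ℝ (Metric.closedBall (0 : ℝ × ℝ × ℝ) R ∩ Metric.closedBall x ‖y - x‖) :=
    (convex_closedBall _ _).inter (convex_closedBall _ _)
  have := hs.norm_image_sub_le_of_norm_hasFDerivWithin_le' (f := F) (f' := fderiv ℝ F)
    (φ := fderiv ℝ F x) (C := C * ‖y - x‖) (x := x) (y := y)
    (fun z _ => ((hF.differentiable (by norm_num)).differentiableAt.hasFDerivAt).hasFDerivWithinAt)
    (fun z hz => by
      refine (hC z x (by simpa using hz.1) hx).trans ?_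
      have := hz.2
      rw [Metric.mem_closedBall, dist_eq_norm] at this
      gcongr)
    ⟨by simpa using hx, by simp⟩ ⟨by simpa using hy, by simp [dist_eq_norm]⟩
  rw [Real.norm_eq_abs] at this
  rw [sq, ← mul_assoc]
  exact this

/-- Chain rule for superposition operators along a curve. -/
lemma nem_hasDerivWithinAt (hF : ContDiff ℝ 2 F) (h0 : F 0 = 0) {p : ℝ → Tri} {p' : Tri}
    {d : L2Linf} {s : Set ℝ} {t : ℝ} (hp : HasDerivWithinAt p p' s t)
    (hd : ∀ᵐ Y, fn d Y = fderiv ℝ F (fn3 (p t) Y) (fn3 p' Y)) :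
    HasDerivWithinAt (fun τ => nem F (p τ)) d s t := by
  have hF1 : ContDiff ℝ 1 F := hF.of_le (by norm_num)
  set R := ‖p t‖ + 1 with hR
  obtain ⟨C₂, hC₂0, hC₂⟩ := taylor_ball hF R
  obtain ⟨C₁, hC₁0, hC₁⟩ : ∃ C : ℝ, 0 ≤ C ∧ ∀ x, ‖x‖ ≤ R → ‖fderiv ℝ F x‖ ≤ C := by
    have hc : Continuous fun x => ‖fderiv ℝ F x‖ := (hF.continuous_fderiv (by norm_num)).norm
    obtain ⟨C, hC⟩ := (isCompact_closedBall (0 : ℝ × ℝ × ℝ) R).bddAbove_image hc.continuousOn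
    refine ⟨max C 0, le_max_right _ _, fun x hx => le_max_of_le_left ?_⟩
    exact hC ⟨x, by simpa using hx, rfl⟩
  rw [hasDerivWithinAt_iff_isLittleO]
  have hlo := hasDerivWithinAt_iff_isLittleO.1 hp
  have hO : (fun τ => p τ - p t) =O[𝓝[s] t] fun τ => τ - t := hp.hasFDerivWithinAt.isBigO_sub
  have ho1 : (fun τ => p τ - p t) =o[𝓝[s] t] fun _ => (1 : ℝ) := by
    rw [Asymptotics.isLittleO_one_iff]
    have := hp.continuousWithinAt.tendsto.sub_const (p t)
    rwa [sub_self] at this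
  have hquad : (fun τ => ‖p τ - p t‖ * ‖p τ - p t‖) =o[𝓝[s] t] fun τ => τ - t := by
    simpa using ho1.norm_left.mul_isBigO hO.norm_left
  -- The pointwise error is a quadratic Taylor remainder plus the derivative applied to the
  -- remainder of `p`. In the quadratic term one factor is taken in the sup norm and the other keeps
  -- the full norm. This is where `L^∞` is needed besides `L²`.
  have hsum : (fun τ => 3 * (C₂ * ‖p τ - p t‖) * ‖p τ - p t‖ +
      3 * C₁ * ‖p τ - p t - (τ - t) • p'‖) =o[𝓝[s] t] fun τ => τ - t := by
    have e1 := hquad.const_mul_left (3 * C₂)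
    have e2 := (hlo.norm_left).const_mul_left (3 * C₁)
    refine (e1.add e2).congr_left fun τ => by ring
  refine Asymptotics.IsBigO.trans_isLittleO (Asymptotics.IsBigO.of_bound 1 ?_) hsum
  have hev : ∀ᶠ τ in 𝓝[s] t, ‖p τ‖ ≤ R := by
    have := hp.continuousWithinAt.norm.eventually (gt_mem_nhds (show ‖p t‖ < R by linarith))
    exact this.mono fun _ h => le_of_lt h
  filter_upwards [hev] with τ hτ
  rw [one_mul]
  refine le_trans (norm_le_of_fn3 (q₁ := p τ - p t) (q₂ := p τ - p t - (τ - t) • p')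
    (C₁ := C₂ * ‖p τ - p t‖) (C₂ := C₁) (by positivity) hC₁0 ?_) (le_abs_self _)
  filter_upwards [fn_sub (nem F (p τ) - nem F (p t)) ((τ - t) • d),
    fn_sub (nem F (p τ)) (nem F (p t)), fn_nem hF1 h0 (p τ), fn_nem hF1 h0 (p t),
    fn_smul (τ - t) d, hd, fn3_sub (p τ - p t) ((τ - t) • p'), fn3_sub (p τ) (p t),
    fn3_smul (τ - t) p', norm_fn3_le (p τ), norm_fn3_le (p t), norm_fn3_le (p τ - p t)]
    with Y h1 h2 h3 h4 h5 h6 h7 h8 h9 h10 h11 h12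
  have hpt : ‖fn3 (p t) Y‖ ≤ R := h11.trans (by linarith)
  have t1 := hC₂ (fn3 (p t) Y) (fn3 (p τ) Y) hpt (h10.trans hτ)
  have t2 := (fderiv ℝ F (fn3 (p t) Y)).le_of_opNorm_le (hC₁ _ hpt)
    (fn3 (p τ - p t - (τ - t) • p') Y)
  rw [h1, h2, h3, h4, h5, h6]
  have e : F (fn3 (p τ) Y) - F (fn3 (p t) Y) - (τ - t) * (fderiv ℝ F (fn3 (p t) Y)) (fn3 p' Y)
      = (F (fn3 (p τ) Y) - F (fn3 (p t) Y) -
        fderiv ℝ F (fn3 (p t) Y) (fn3 (p τ) Y - fn3 (p t) Y)) +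
        fderiv ℝ F (fn3 (p t) Y) (fn3 (p τ - p t - (τ - t) • p') Y) := by
    rw [h7, h8, h9, map_sub (fderiv ℝ F (fn3 (p t) Y)) (_ - _), map_smul, smul_eq_mul]
    ring
  rw [e]
  refine (abs_add_le _ _).trans (add_le_add (t1.trans ?_) t2)
  rw [← h8, sq, ← mul_assoc]
  gcongr

/-! ### Integral operators with exponentially decaying kernels -/

def expKer (c x : ℝ) : ℝ := Real.exp (-(c * |x|))

lemma continuous_expKer (c : ℝ) : Continuous (expKer c) := by
  unfold expKer
  fun_prop

lemma expKer_nonneg (c x : ℝ) : 0 ≤ expKer c x := (Real.exp_pos _).le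

lemma integrable_expKer {c : ℝ} (hc : 0 < c) : Integrable (expKer c) := by
  rw [← integrableOn_univ, ← Iic_union_Ioi (a := (0 : ℝ))]
  refine IntegrableOn.union ?_ ?_
  · refine (integrableOn_exp_mul_Iic hc 0).congr_fun (fun x hx => ?_) measurableSet_Iic
    rw [expKer, abs_of_nonpos hx]
    ring_nf
  · refine (integrableOn_exp_mul_Ioi (a := -c) (by linarith) 0).congr_fun (fun x hx => ?_)
      measurableSet_Ioi
    rw [expKer, abs_of_pos hx]
    ring_nf

def expMass (c : ℝ) : ℝ := ∫ x, expKer c x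

lemma expMass_pos {c : ℝ} (hc : 0 < c) : 0 < expMass c := by
  refine (integral_pos_iff_support_of_nonneg (expKer_nonneg c) (integrable_expKer hc)).2 ?_
  have : Function.support (expKer c) = univ := by
    ext x
    simp [expKer, Real.exp_ne_zero]
  simp [this]

/-- Kernels dominated by `M e^{-c|Y - Z|}`. -/
structure IsExpKernel (h : ℝ → ℝ → ℝ) (M c : ℝ) : Prop where
  meas : Measurable (Function.uncurry h)
  pos : 0 < c
  nonneg : 0 ≤ M
  le : ∀ Y Z, |h Y Z| ≤ M * expKer c (Y - Z)

namespace IsExpKernel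

variable {h : ℝ → ℝ → ℝ} {M c : ℝ}

lemma integrable_dom (hh : IsExpKernel h M c) (Y : ℝ) :
    Integrable fun Z => M * expKer c (Y - Z) :=
  ((integrable_expKer hh.pos).comp_sub_left Y).const_mul M

lemma integral_dom (_ : IsExpKernel h M c) (Y : ℝ) :
    ∫ Z, M * expKer c (Y - Z) = M * expMass c := by
  rw [integral_const_mul, integral_sub_left_eq_self (expKer c) volume Y, expMass]

lemma integrable (hh : IsExpKernel h M c) (Y : ℝ) : Integrable (h Y) :=
  (hh.integrable_dom Y).mono'
    (hh.meas.comp measurable_prodMk_left).aestronglyMeasurable (ae_of_all _ fun Z => hh.le Y Z)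

lemma integrable_mul (hh : IsExpKernel h M c) (g : L2Linf) (Y : ℝ) :
    Integrable fun Z => h Y Z * fn g Z :=
  (hh.integrable Y).mul_bdd (aesm_fn g) (ae_abs_fn_le g)

lemma integrable_dom_mul (hh : IsExpKernel h M c) (g : L2Linf) (Y : ℝ) :
    Integrable fun Z => M * expKer c (Y - Z) * |fn g Z| :=
  (hh.integrable_dom Y).mul_bdd (measurable_fn g).abs.aestronglyMeasurable
    ((ae_abs_fn_le g).mono fun Z hZ => by simpa using hZ)

lemma abs_integral_le_dom (hh : IsExpKernel h M c) (g : L2Linf) (Y : ℝ) :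
    |∫ Z, h Y Z * fn g Z| ≤ ∫ Z, M * expKer c (Y - Z) * |fn g Z| := by
  refine abs_integral_le_integral_abs.trans
    (integral_mono (hh.integrable_mul g Y).abs (hh.integrable_dom_mul g Y) fun Z => ?_)
  simp only [abs_mul]
  exact mul_le_mul_of_nonneg_right (hh.le Y Z) (abs_nonneg _)

lemma abs_integral_le (hh : IsExpKernel h M c) (g : L2Linf) (Y : ℝ) :
    |∫ Z, h Y Z * fn g Z| ≤ M * expMass c * ‖g‖ := by
  refine (hh.abs_integral_le_dom g Y).trans ?_
  rw [← hh.integral_dom Y, ← integral_mul_const]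
  refine integral_mono_ae (hh.integrable_dom_mul g Y) ((hh.integrable_dom Y).mul_const _) ?_
  filter_upwards [ae_abs_fn_le g] with Z hZ
  exact mul_le_mul_of_nonneg_left hZ (mul_nonneg hh.nonneg (expKer_nonneg _ _))

lemma measurable_integral (hh : IsExpKernel h M c) (g : L2Linf) :
    Measurable fun Y => ∫ Z, h Y Z * fn g Z := by
  have : StronglyMeasurable (Function.uncurry fun Y Z => h Y Z * fn g Z) :=
    (hh.meas.mul ((measurable_fn g).comp measurable_snd)).stronglyMeasurable
  exact this.integral_prod_right.measurable

/-- The inner integral is the convolution of `g²` with the dominating kernel, so its total mass is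
the product of the two masses. -/
lemma conv_facts (hh : IsExpKernel h M c) (g : L2Linf) :
    Integrable (fun Y => ∫ Z, fn g Z ^ 2 * (M * expKer c (Y - Z))) ∧
      ∫ Y, ∫ Z, fn g Z ^ 2 * (M * expKer c (Y - Z)) =
        (∫ Z, fn g Z ^ 2) * (M * expMass c) := by
  have i1 : Integrable fun Z => fn g Z ^ 2 := (memLp_two_fn g).integrable_sq
  have i2 : Integrable fun x => M * expKer c x := (integrable_expKer hh.pos).const_mul M
  refine ⟨i1.integrable_convolution (ContinuousLinearMap.mul ℝ ℝ) i2, ?_⟩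
  have := integral_convolution (ContinuousLinearMap.mul ℝ ℝ) i1 i2
  rw [ContinuousLinearMap.mul_apply', integral_const_mul] at this
  exact this

/-- Cauchy–Schwarz with weight `M * expKer c (Y - Z)`, obtained from the discriminant of the
nonnegative quadratic `t ↦ ∫ weight * (|g| - t)²`. -/
lemma sq_integral_le (hh : IsExpKernel h M c) (g : L2Linf) (Y : ℝ) :
    (∫ Z, h Y Z * fn g Z) ^ 2 ≤
      (M * expMass c) * ∫ Z, fn g Z ^ 2 * (M * expKer c (Y - Z)) := by
  set A := M * expMass c with hA
  set B := ∫ Z, M * expKer c (Y - Z) * |fn g Z| with hB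
  set D := ∫ Z, fn g Z ^ 2 * (M * expKer c (Y - Z)) with hD
  have iD : Integrable fun Z => fn g Z ^ 2 * (M * expKer c (Y - Z)) := by
    refine (memLp_two_fn g).integrable_sq.mul_bdd (c := M)
      (continuous_const.mul ((continuous_expKer c).comp
        (continuous_const.sub continuous_id))).aestronglyMeasurable (ae_of_all _ fun Z => ?_)
    rw [Real.norm_eq_abs, abs_of_nonneg (mul_nonneg hh.nonneg (expKer_nonneg _ _))]
    refine mul_le_of_le_one_right hh.nonneg (Real.exp_le_one_iff.2 ?_)
    have := mul_nonneg hh.pos.le (abs_nonneg (Y - Z))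
    simpa using this
  have key : ∀ t : ℝ, 0 ≤ D - 2 * t * B + t ^ 2 * A := by
    intro t
    have e : D - 2 * t * B + t ^ 2 * A =
        ∫ Z, (M * expKer c (Y - Z)) * (|fn g Z| - t) ^ 2 := by
      rw [hD, hB, hA, ← hh.integral_dom Y, ← integral_const_mul, ← integral_const_mul,
        ← integral_sub iD ((hh.integrable_dom_mul g Y).const_mul _)]
      have i2 : Integrable fun Z => fn g Z ^ 2 * (M * expKer c (Y - Z)) -
        2 * t * (M * expKer c (Y - Z) * |fn g Z|) := iD.sub ((hh.integrable_dom_mul g Y).const_mul _)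
      rw [← integral_add i2 ((hh.integrable_dom Y).const_mul _)]
      refine integral_congr_ae (ae_of_all _ fun Z => ?_)
      have : fn g Z ^ 2 = |fn g Z| ^ 2 := (sq_abs _).symm
      simp only [this]
      ring
    rw [e]
    exact integral_nonneg fun Z =>
      mul_nonneg (mul_nonneg hh.nonneg (expKer_nonneg _ _)) (sq_nonneg _)
  have hA0 : 0 ≤ A := mul_nonneg hh.nonneg (expMass_pos hh.pos).le
  have hBD : B ^ 2 ≤ A * D := by
    have := discrim_le_zero (a := A) (b := -2 * B) (c := D) fun t => by nlinarith [key t]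
    rw [discrim] at this
    nlinarith
  have h1 := hh.abs_integral_le_dom g Y
  calc _ = |∫ Z, h Y Z * fn g Z| ^ 2 := (sq_abs _).symm
    _ ≤ B ^ 2 := by gcongr
    _ ≤ A * D := hBD

lemma integrable_sq (hh : IsExpKernel h M c) (g : L2Linf) :
    Integrable fun Y => (∫ Z, h Y Z * fn g Z) ^ 2 := by
  refine ((hh.conv_facts g).1.const_mul (M * expMass c)).mono'
    ((hh.measurable_integral g).pow_const 2).aestronglyMeasurable (ae_of_all _ fun Y => ?_)
  rw [Real.norm_eq_abs, abs_of_nonneg (sq_nonneg _)]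
  exact hh.sq_integral_le g Y

lemma isA (hh : IsExpKernel h M c) (g : L2Linf) : IsA fun Y => ∫ Z, h Y Z * fn g Z :=
  ⟨(memLp_two_iff_integrable_sq (hh.measurable_integral g).aestronglyMeasurable).2
    (hh.integrable_sq g),
    memLp_top_of_bound (hh.measurable_integral g).aestronglyMeasurable _
      (ae_of_all _ fun Y => hh.abs_integral_le g Y)⟩

end IsExpKernel

lemma eLpNorm_two_eq {f : ℝ → ℝ} (hf : MemLp f 2) :
    eLpNorm f 2 volume = ENNReal.ofReal (Real.sqrt (∫ x, f x ^ 2)) := by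
  rw [hf.eLpNorm_eq_integral_rpow_norm (by norm_num) (by norm_num), Real.sqrt_eq_rpow]
  norm_num

/-- The integral operator with kernel `h` on `L² ∩ L^∞`. -/
def opA (h : ℝ → ℝ → ℝ) (g : L2Linf) : L2Linf := mkA fun Y => ∫ Z, h Y Z * fn g Z

namespace IsExpKernel

variable {h h' : ℝ → ℝ → ℝ} {M M' c c' : ℝ}

lemma fn_opA (hh : IsExpKernel h M c) (g : L2Linf) :
    ∀ᵐ Y, fn (opA h g) Y = ∫ Z, h Y Z * fn g Z := fn_mkA (hh.isA g)

/-- Young's inequality in `L²` and the trivial bound in `L^∞` both cost the mass of the dominating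
kernel, hence the factor 2. -/
lemma norm_opA_le (hh : IsExpKernel h M c) (g : L2Linf) :
    ‖opA h g‖ ≤ 2 * (M * expMass c) * ‖g‖ := by
  have hA0 : 0 ≤ M * expMass c := mul_nonneg hh.nonneg (expMass_pos hh.pos).le
  have hC : 0 ≤ M * expMass c * ‖g‖ := mul_nonneg hA0 (norm_nonneg _)
  refine (norm_mkA_le hC hC (hh.isA g) ?_ (ae_of_all _ (hh.abs_integral_le g))).trans
    (le_of_eq (by ring))
  rw [eLpNorm_two_eq (hh.isA g).two]
  refine ENNReal.ofReal_le_ofReal ?_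
  have h1 : ∫ Y, (∫ Z, h Y Z * fn g Z) ^ 2 ≤ (M * expMass c) ^ 2 * ∫ Z, fn g Z ^ 2 := by
    refine (integral_mono (hh.integrable_sq g) ((hh.conv_facts g).1.const_mul (M * expMass c))
      (hh.sq_integral_le g)).trans (le_of_eq ?_)
    rw [integral_const_mul, (hh.conv_facts g).2]
    ring
  have h2 : Real.sqrt (∫ Z, fn g Z ^ 2) ≤ ‖g‖ := by
    have : (eLpNorm (fn g) 2 volume).toReal ≤ ‖g‖ := by
      rw [norm_L2Linf_eq]
      exact le_add_of_nonneg_right ENNReal.toReal_nonneg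
    rwa [eLpNorm_two_eq (memLp_two_fn g), ENNReal.toReal_ofReal (Real.sqrt_nonneg _)] at this
  calc _ ≤ Real.sqrt ((M * expMass c) ^ 2 * ∫ Z, fn g Z ^ 2) := Real.sqrt_le_sqrt h1
    _ = (M * expMass c) * Real.sqrt (∫ Z, fn g Z ^ 2) := by
      rw [Real.sqrt_mul (sq_nonneg _), Real.sqrt_sq hA0]
    _ ≤ _ := mul_le_mul_of_nonneg_left h2 hA0

lemma opA_sub (hh : IsExpKernel h M c) (g g' : L2Linf) :
    opA h (g - g') = opA h g - opA h g' := by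
  refine fn_ext ?_
  filter_upwards [hh.fn_opA (g - g'), hh.fn_opA g, hh.fn_opA g', fn_sub (opA h g) (opA h g')]
    with Y h1 h2 h3 h4
  rw [h1, h4, h2, h3, ← integral_sub (hh.integrable_mul g Y) (hh.integrable_mul g' Y)]
  refine integral_congr_ae ?_
  filter_upwards [fn_sub g g'] with Z hZ
  rw [hZ, mul_sub]

lemma opA_kernel_sub (hh : IsExpKernel h M c) (hh' : IsExpKernel h' M' c') {M'' c'' : ℝ}
    (hd : IsExpKernel (fun Y Z => h Y Z - h' Y Z) M'' c'') (g : L2Linf) :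
    opA (fun Y Z => h Y Z - h' Y Z) g = opA h g - opA h' g := by
  refine fn_ext ?_
  filter_upwards [hh.fn_opA g, hh'.fn_opA g, hd.fn_opA g, fn_sub (opA h g) (opA h' g)]
    with Y h1 h2 h3 h4
  rw [h3, h4, h1, h2, ← integral_sub (hh.integrable_mul g Y) (hh'.integrable_mul g Y)]
  simp only [sub_mul]

end IsExpKernel

/-! ### The kernels `exp (-|∫ a|)` -/

/-- `exp(-|∫_Z^Y a|)`. -/
def ker (a : ℝ → ℝ) (Y Z : ℝ) : ℝ := Real.exp (-|∫ s in Z..Y, a s|)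

/-- Sums and differences of the left and right operators give `Pᵢ` and `∂ₓPᵢ`. For a nonnegative
density each one-sided operator satisfies a first-order linear equation in `Y`. -/
def kerL (a : ℝ → ℝ) (Y Z : ℝ) : ℝ := if Z < Y then ker a Y Z else 0

def kerR (a : ℝ → ℝ) (Y Z : ℝ) : ℝ := if Y < Z then ker a Y Z else 0

lemma Linf.locallyIntegrable (a : Linf) : LocallyIntegrable (a : ℝ → ℝ) :=
  (Lp.memLp a).locallyIntegrable le_top

lemma Linf.intervalIntegrable (a : Linf) (x y : ℝ) : IntervalIntegrable (a : ℝ → ℝ) volume x y :=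
  locallyIntegrable_intervalIntegrable a.locallyIntegrable x y

lemma continuous_uncurry_ker (a : Linf) : Continuous (Function.uncurry (ker a)) := by
  have hc : Continuous fun x => ∫ s in (0 : ℝ)..x, a s :=
    intervalIntegral.continuous_primitive a.intervalIntegrable 0
  have e : Function.uncurry (ker a) = fun p : ℝ × ℝ =>
      Real.exp (-|(∫ s in (0 : ℝ)..p.1, a s) - ∫ s in (0 : ℝ)..p.2, a s|) := by
    funext p
    simp only [Function.uncurry, ker]
    rw [intervalIntegral.integral_interval_sub_left (a.intervalIntegrable _ _)
      (a.intervalIntegrable _ _)]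
  rw [e]
  exact Real.continuous_exp.comp (((hc.comp continuous_fst).sub (hc.comp continuous_snd)).abs.neg)

/-- The density `a` has linearly growing integrals. -/
structure Decays (a : Linf) (c m : ℝ) : Prop where
  pos : 0 < c
  le : ∀ Y Z, c * |Y - Z| - m ≤ |∫ s in Z..Y, a s|

namespace Decays

variable {a b : Linf} {c m : ℝ}

lemma ker_le (h : Decays a c m) (Y Z : ℝ) : ker a Y Z ≤ Real.exp m * expKer c (Y - Z) := by
  rw [ker, expKer, ← Real.exp_add]
  exact Real.exp_le_exp.2 (by linarith [h.le Y Z])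

lemma isExpKernel (h : Decays a c m) : IsExpKernel (ker a) (Real.exp m) c :=
  ⟨(continuous_uncurry_ker a).measurable, h.pos, (Real.exp_pos _).le, fun Y Z => by
    rw [abs_of_pos (show 0 < ker a Y Z from Real.exp_pos _)]
    exact h.ker_le Y Z⟩

lemma _root_.Novikov.IsExpKernel.kerL {M : ℝ} {a : ℝ → ℝ} (h : IsExpKernel (ker a) M c) :
    IsExpKernel (kerL a) M c := by
  refine ⟨?_, h.pos, h.nonneg, fun Y Z => ?_⟩
  · exact Measurable.ite (measurableSet_lt measurable_snd measurable_fst) h.meas measurable_const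
  · rw [Novikov.kerL]
    split_ifs
    · exact h.le Y Z
    · rw [abs_zero]
      exact mul_nonneg h.nonneg (expKer_nonneg _ _)

lemma _root_.Novikov.IsExpKernel.kerR {M : ℝ} {a : ℝ → ℝ} (h : IsExpKernel (ker a) M c) :
    IsExpKernel (kerR a) M c := by
  refine ⟨?_, h.pos, h.nonneg, fun Y Z => ?_⟩
  · exact Measurable.ite (measurableSet_lt measurable_fst measurable_snd) h.meas measurable_const
  · rw [Novikov.kerR]
    split_ifs
    · exact h.le Y Z
    · rw [abs_zero]
      exact mul_nonneg h.nonneg (expKer_nonneg _ _)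

lemma abs_integral_sub_le (a b : Linf) (Y Z : ℝ) :
    |(∫ s in Z..Y, a s) - ∫ s in Z..Y, b s| ≤ ‖a - b‖ * |Y - Z| := by
  rw [← intervalIntegral.integral_sub (a.intervalIntegrable _ _) (b.intervalIntegrable _ _)]
  rw [← Real.norm_eq_abs]
  refine intervalIntegral.norm_integral_le_of_norm_le_const_ae ?_
  filter_upwards [Linf.ae_abs_le (a - b), Lp.coeFn_sub a b] with s h1 h2 _
  rwa [h2] at h1

lemma abs_exp_sub_exp_le (x y : ℝ) : |Real.exp x - Real.exp y| ≤
    |x - y| * max (Real.exp x) (Real.exp y) := by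
  wlog h : y ≤ x generalizing x y
  · rw [abs_sub_comm, abs_sub_comm x, max_comm]
    exact this y x (le_of_not_ge h)
  rw [abs_of_nonneg (sub_nonneg.2 (Real.exp_le_exp.2 h)), abs_of_nonneg (sub_nonneg.2 h),
    max_eq_left (Real.exp_le_exp.2 h)]
  have h1 := Real.add_one_le_exp (y - x)
  have h2 : Real.exp y = Real.exp (y - x) * Real.exp x := by rw [← Real.exp_add]; ring_nf
  rw [h2]
  nlinarith [Real.exp_pos x]

/-- The difference of the exponents grows like `‖a - b‖ * |Y - Z|`. Half of the decay rate absorbs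
the linear factor, through `s e^{-cs} ≤ (2/c) e^{-cs/2}`. -/
lemma abs_ker_sub_le (ha : Decays a c m) (hb : Decays b c m) (Y Z : ℝ) :
    |ker a Y Z - ker b Y Z| ≤ (‖a - b‖ * (2 / c) * Real.exp m) * expKer (c / 2) (Y - Z) := by
  have h1 := abs_exp_sub_exp_le (-|∫ s in Z..Y, a s|) (-|∫ s in Z..Y, b s|)
  have h2 : |(-|∫ s in Z..Y, a s|) - (-|(∫ s in Z..Y, b s)|)| ≤ ‖a - b‖ * |Y - Z| := by
    rw [neg_sub_neg, abs_sub_comm]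
    exact (abs_abs_sub_abs_le_abs_sub _ _).trans (abs_integral_sub_le a b Y Z)
  have h3 : max (ker a Y Z) (ker b Y Z) ≤ Real.exp m * expKer c (Y - Z) :=
    max_le (ha.ker_le Y Z) (hb.ker_le Y Z)
  have h4 : |Y - Z| * expKer c (Y - Z) ≤ 2 / c * expKer (c / 2) (Y - Z) := by
    have hc := ha.pos
    have e : expKer c (Y - Z) = expKer (c / 2) (Y - Z) * expKer (c / 2) (Y - Z) := by
      rw [expKer, expKer, ← Real.exp_add]
      ring_nf
    have h5 : c / 2 * |Y - Z| * expKer (c / 2) (Y - Z) ≤ 1 := by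
      rw [expKer, Real.exp_neg, ← div_eq_mul_inv, div_le_one (Real.exp_pos _)]
      linarith [Real.add_one_le_exp (c / 2 * |Y - Z|)]
    have h6 : |Y - Z| * expKer (c / 2) (Y - Z) ≤ 2 / c := by
      rw [le_div_iff₀ hc]
      linarith
    rw [e, ← mul_assoc]
    exact mul_le_mul_of_nonneg_right h6 (expKer_nonneg _ _)
  calc _ ≤ (‖a - b‖ * |Y - Z|) * (Real.exp m * expKer c (Y - Z)) := by
        refine h1.trans (mul_le_mul h2 h3 ?_ (by positivity))
        exact (Real.exp_pos _).le.trans (le_max_left _ _)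
    _ = ‖a - b‖ * Real.exp m * (|Y - Z| * expKer c (Y - Z)) := by ring
    _ ≤ ‖a - b‖ * Real.exp m * (2 / c * expKer (c / 2) (Y - Z)) := by gcongr
    _ = _ := by ring

lemma isExpKernel_sub (ha : Decays a c m) (hb : Decays b c m) :
    IsExpKernel (fun Y Z => ker a Y Z - ker b Y Z) (‖a - b‖ * (2 / c) * Real.exp m) (c / 2) :=
  ⟨(continuous_uncurry_ker a).measurable.sub (continuous_uncurry_ker b).measurable,
    half_pos ha.pos, by have := ha.pos; positivity, ha.abs_ker_sub_le hb⟩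

lemma isExpKernel_subL (ha : Decays a c m) (hb : Decays b c m) :
    IsExpKernel (fun Y Z => kerL a Y Z - kerL b Y Z) (‖a - b‖ * (2 / c) * Real.exp m) (c / 2) := by
  have h := ha.isExpKernel_sub hb
  refine ⟨ha.isExpKernel.kerL.meas.sub hb.isExpKernel.kerL.meas, h.pos, h.nonneg, fun Y Z => ?_⟩
  simp only [Novikov.kerL]
  split_ifs
  · exact h.le Y Z
  · rw [sub_zero, abs_zero]
    exact mul_nonneg h.nonneg (expKer_nonneg _ _)

lemma isExpKernel_subR (ha : Decays a c m) (hb : Decays b c m) :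
    IsExpKernel (fun Y Z => kerR a Y Z - kerR b Y Z) (‖a - b‖ * (2 / c) * Real.exp m) (c / 2) := by
  have h := ha.isExpKernel_sub hb
  refine ⟨ha.isExpKernel.kerR.meas.sub hb.isExpKernel.kerR.meas, h.pos, h.nonneg, fun Y Z => ?_⟩
  simp only [Novikov.kerR]
  split_ifs
  · exact h.le Y Z
  · rw [sub_zero, abs_zero]
    exact mul_nonneg h.nonneg (expKer_nonneg _ _)

lemma norm_op_sub_le {h h' : ℝ → ℝ → ℝ} {M M₁ c₁ : ℝ} (hh : IsExpKernel h M c)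
    (hh' : IsExpKernel h' M c)
    (hd : IsExpKernel (fun Y Z => h Y Z - h' Y Z) M₁ c₁) (g g' : L2Linf) :
    ‖opA h g - opA h' g'‖ ≤
      2 * (M * expMass c) * ‖g - g'‖ + 2 * (M₁ * expMass c₁) * ‖g'‖ := by
  have e : opA h g - opA h' g' = opA h (g - g') + opA (fun Y Z => h Y Z - h' Y Z) g' := by
    rw [hh.opA_sub, hh.opA_kernel_sub hh' hd]
    abel
  rw [e]
  exact (norm_add_le _ _).trans (add_le_add (hh.norm_opA_le _) (hd.norm_opA_le _))

/-- The one-sided operators are absolutely continuous. -/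
lemma isPrim_opL (h : Decays a c m) (ha : ∀ᵐ Y, 0 ≤ a Y) (g : L2Linf) :
    IsPrim (fun Y => ∫ Z, kerL a Y Z * fn g Z)
      (fun Y => -(a Y) * (∫ Z, kerL a Y Z * fn g Z) + fn g Y) := by
  have hA : IsPrim (fun x => 0 + ∫ s in (0 : ℝ)..x, a s) a := IsPrim.of_integral 0 a.locallyIntegrable
  set A : ℝ → ℝ := fun x => 0 + ∫ s in (0 : ℝ)..x, a s with hAdef
  have hE : IsPrim (fun x => Real.exp (-A x)) (fun x => Real.exp (-A x) * -(a x)) := by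
    have := (hA.const_mul (-1)).comp_contDiff Real.contDiff_exp
    simpa using this
  have hsub : ∀ Y Z, ∫ s in Z..Y, a s = A Y - A Z := fun Y Z => (hA.sub_eq Z Y).symm
  -- Nonnegativity of `a` removes the absolute value, and the kernel factorises. The operator
  -- becomes a product of two absolutely continuous functions.
  have hker : ∀ Y Z, Z ≤ Y → ker a Y Z = Real.exp (-A Y) * Real.exp (A Z) := by
    intro Y Z hZ
    have h0 : 0 ≤ ∫ s in Z..Y, a s :=
      intervalIntegral.integral_nonneg_of_ae hZ ha
    rw [ker, abs_of_nonneg h0, hsub, ← Real.exp_add]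
    ring_nf
  have hL : ∀ Y, ∫ Z, kerL a Y Z * fn g Z =
      Real.exp (-A Y) * ∫ Z in Iio Y, Real.exp (A Z) * fn g Z := by
    intro Y
    rw [← integral_const_mul, ← integral_indicator measurableSet_Iio]
    refine integral_congr_ae (ae_of_all _ fun Z => ?_)
    by_cases hZ : Z < Y
    · simp only [kerL, hZ, if_true, indicator_of_mem (show Z ∈ Iio Y from hZ)]
      rw [hker Y Z hZ.le, mul_assoc]
    · simp only [kerL, hZ, if_false, zero_mul, indicator_of_notMem (show Z ∉ Iio Y from hZ)]
  have hint : ∀ Y, IntegrableOn (fun Z => Real.exp (A Z) * fn g Z) (Iio Y) := by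
    intro Y
    have h1 := ((h.isExpKernel.integrable_mul g Y).const_mul (Real.exp (A Y))).integrableOn (s := Iio Y)
    refine h1.congr_fun (fun Z hZ => ?_) measurableSet_Iio
    simp only
    rw [hker Y Z (le_of_lt hZ), Real.exp_neg]
    field_simp
  have hloc : LocallyIntegrable fun Z => Real.exp (A Z) * fn g Z :=
    locallyIntegrable_of_intervalIntegrable fun x y => by
      have h1 : IntegrableOn (fun Z => Real.exp (A Z) * fn g Z) (uIcc x y) :=
        -- The half-line is open, so its endpoint is moved beyond the interval.
        (hint (max x y + 1)).mono_set fun Z hZ => by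
          have := hZ.2
          exact lt_of_le_of_lt this (by simp)
      exact h1.intervalIntegrable
  have hG : IsPrim (fun Y => ∫ Z in Iio Y, Real.exp (A Z) * fn g Z)
      (fun Z => Real.exp (A Z) * fn g Z) := by
    refine ⟨hloc, fun x => ?_⟩
    rw [← intervalIntegral.integral_Iio_sub_Iio' (hint x) (hint 0)]
    ring
  have hP := hE.mul hG
  simp only [← hL] at hP
  refine hP.congr (ae_of_all _ fun Y => ?_)
  simp only
  rw [hL, Real.exp_neg]
  field_simp

lemma isPrim_opR (h : Decays a c m) (ha : ∀ᵐ Y, 0 ≤ a Y) (g : L2Linf) :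
    IsPrim (fun Y => ∫ Z, kerR a Y Z * fn g Z)
      (fun Y => a Y * (∫ Z, kerR a Y Z * fn g Z) - fn g Y) := by
  have hA : IsPrim (fun x => 0 + ∫ s in (0 : ℝ)..x, a s) a := IsPrim.of_integral 0 a.locallyIntegrable
  set A : ℝ → ℝ := fun x => 0 + ∫ s in (0 : ℝ)..x, a s with hAdef
  have hE : IsPrim (fun x => Real.exp (A x)) (fun x => Real.exp (A x) * a x) := by
    have := hA.comp_contDiff Real.contDiff_exp
    simpa using this
  have hsub : ∀ Y Z, ∫ s in Z..Y, a s = A Y - A Z := fun Y Z => (hA.sub_eq Z Y).symm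
  have hker : ∀ Y Z, Y ≤ Z → ker a Y Z = Real.exp (A Y) * Real.exp (-A Z) := by
    intro Y Z hZ
    have h0 : 0 ≤ ∫ s in Y..Z, a s :=
      intervalIntegral.integral_nonneg_of_ae hZ ha
    rw [ker, intervalIntegral.integral_symm, abs_neg, abs_of_nonneg h0, hsub, ← Real.exp_add]
    ring_nf
  have hR : ∀ Y, ∫ Z, kerR a Y Z * fn g Z =
      Real.exp (A Y) * ∫ Z in Ioi Y, Real.exp (-A Z) * fn g Z := by
    intro Y
    rw [← integral_const_mul, ← integral_indicator measurableSet_Ioi]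
    refine integral_congr_ae (ae_of_all _ fun Z => ?_)
    by_cases hZ : Y < Z
    · simp only [kerR, hZ, if_true, indicator_of_mem (show Z ∈ Ioi Y from hZ)]
      rw [hker Y Z hZ.le, mul_assoc]
    · simp only [kerR, hZ, if_false, zero_mul, indicator_of_notMem (show Z ∉ Ioi Y from hZ)]
  have hint : ∀ Y, IntegrableOn (fun Z => Real.exp (-A Z) * fn g Z) (Ioi Y) := by
    intro Y
    have h1 := ((h.isExpKernel.integrable_mul g Y).const_mul
      (Real.exp (-A Y))).integrableOn (s := Ioi Y)
    refine h1.congr_fun (fun Z hZ => ?_) measurableSet_Ioi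
    simp only
    rw [hker Y Z (le_of_lt hZ), Real.exp_neg (A Y)]
    field_simp
  have hloc : LocallyIntegrable fun Z => Real.exp (-A Z) * fn g Z :=
    locallyIntegrable_of_intervalIntegrable fun x y => by
      have h1 : IntegrableOn (fun Z => Real.exp (-A Z) * fn g Z) (uIcc x y) :=
        (hint (min x y - 1)).mono_set fun Z hZ => by
          have := hZ.1
          exact lt_of_lt_of_le (sub_one_lt _) this
      exact h1.intervalIntegrable
  have hG : IsPrim (fun Y => ∫ Z in Ioi Y, Real.exp (-A Z) * fn g Z)
      (fun Z => -(Real.exp (-A Z) * fn g Z)) := by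
    refine ⟨hloc.neg, fun x => ?_⟩
    rw [intervalIntegral.integral_neg, ← intervalIntegral.integral_Ioi_sub_Ioi' (hint 0) (hint x)]
    ring
  have hP := hE.mul hG
  simp only [← hR] at hP
  refine hP.congr (ae_of_all _ fun Y => ?_)
  simp only
  rw [hR, Real.exp_neg]
  field_simp
  ring

end Decays

/-! ### The vector field on `(L² ∩ L^∞) × (L² ∩ L^∞) × L^∞` -/

/-- The state space in which the function `u` is only required to lie in `L² ∩ L^∞`. -/
abbrev St : Type := L2Linf × L2Linf × Linf

def fg₁ (p : ℝ × ℝ × ℝ) : ℝ :=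
  3 / 8 * p.1 * Real.sin p.2.1 ^ 2 + p.1 ^ 3 * Real.cos (p.2.1 / 2) ^ 4

def fg₂ (p : ℝ × ℝ × ℝ) : ℝ := Real.sin p.2.1 * Real.sin (p.2.1 / 2) ^ 2

/-- Subtracting 1 makes the function vanish at the origin, as superposition in `L² ∩ L^∞` requires;
`den` adds the missing `ξ` back in `L^∞`. -/
def fa (p : ℝ × ℝ × ℝ) : ℝ := Real.cos (p.2.1 / 2) ^ 4 - 1

/-- The third coordinate stands for `P₁ + ∂ₓP₂`, the only combination of nonlocal terms in the
equations for `v` and `ξ`. -/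
def fv (p : ℝ × ℝ × ℝ) : ℝ :=
  - p.1 * Real.sin (p.2.1 / 2) ^ 2 + 2 * p.1 ^ 3 * Real.cos (p.2.1 / 2) ^ 2
    - 2 * Real.cos (p.2.1 / 2) ^ 2 * p.2.2

def fξ (p : ℝ × ℝ × ℝ) : ℝ := ((2 * p.1 ^ 3 + p.1) - 2 * p.2.2) * Real.sin p.2.1

lemma contDiff_fg₁ {n : ℕ∞ω} : ContDiff ℝ n fg₁ := by unfold fg₁; fun_prop
lemma contDiff_fg₂ {n : ℕ∞ω} : ContDiff ℝ n fg₂ := by unfold fg₂; fun_prop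
lemma contDiff_fa {n : ℕ∞ω} : ContDiff ℝ n fa := by unfold fa; fun_prop
lemma contDiff_fv {n : ℕ∞ω} : ContDiff ℝ n fv := by unfold fv; fun_prop
lemma contDiff_fξ {n : ℕ∞ω} : ContDiff ℝ n fξ := by unfold fξ; fun_prop

lemma fg₁_zero : fg₁ 0 = 0 := by simp [fg₁]
lemma fg₂_zero : fg₂ 0 = 0 := by simp [fg₂]
lemma fa_zero : fa 0 = 0 := by simp [fa]
lemma fv_zero : fv 0 = 0 := by simp [fv]
lemma fξ_zero : fξ 0 = 0 := by simp [fξ]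

/-- The triple `(u, v, q)`. -/
def tri (z : St) (q : L2Linf) : Tri := (z.1, z.2.1, q)

def srcG₁ (z : St) : L2Linf := smulA z.2.2 (nem fg₁ (tri z 0))

def srcG₂ (z : St) : L2Linf := smulA z.2.2 (nem fg₂ (tri z 0))

/-- The density `ξ cos⁴(v/2)`. -/
def den (z : St) : Linf := z.2.2 + toLinf (smulA z.2.2 (nem fa (tri z 0)))

def opLSt (z : St) (g : L2Linf) : L2Linf := opA (kerL (den z)) g

def opRSt (z : St) (g : L2Linf) : L2Linf := opA (kerR (den z)) g

/-- `-∂ₓP₁ - P₂`. -/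
def vfU (z : St) : L2Linf :=
  (-(1 / 2) : ℝ) • (opRSt z (srcG₁ z) - opLSt z (srcG₁ z)) -
    (1 / 8 : ℝ) • (opLSt z (srcG₂ z) + opRSt z (srcG₂ z))

/-- `P₁ + ∂ₓP₂`. -/
def vfQ (z : St) : L2Linf :=
  (1 / 2 : ℝ) • (opLSt z (srcG₁ z) + opRSt z (srcG₁ z)) +
    (1 / 8 : ℝ) • (opRSt z (srcG₂ z) - opLSt z (srcG₂ z))

def vfield (z : St) : St :=
  (vfU z, nem fv (tri z (vfQ z)), toLinf (smulA z.2.2 (nem fξ (tri z (vfQ z)))))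

/-- Bounded states with `ξ` bounded below. -/
structure MemK (R : ℝ) (z : St) : Prop where
  pos : 0 < R
  u_le : ‖z.1‖ ≤ R
  v_le : ‖z.2.1‖ ≤ R
  ξ_le : ‖z.2.2‖ ≤ R
  le_ξ : ∀ᵐ Y, R⁻¹ ≤ z.2.2 Y

def setK (R : ℝ) : Set St := {z | MemK R z}

lemma smulA_sub_smulA (ξ η : Linf) (p q : L2Linf) :
    smulA ξ p - smulA η q = smulA ξ (p - q) + smulA (ξ - η) q := by
  refine fn_ext ?_
  filter_upwards [fn_sub (smulA ξ p) (smulA η q), fn_add (smulA ξ (p - q)) (smulA (ξ - η) q),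
    fn_smulA ξ p, fn_smulA η q, fn_smulA ξ (p - q), fn_smulA (ξ - η) q, fn_sub p q,
    Lp.coeFn_sub ξ η] with Y h1 h2 h3 h4 h5 h6 h7 h8
  rw [h1, h2, h3, h4, h5, h6, h7, h8, Pi.sub_apply]
  ring

/-- Maps that are bounded and Lipschitz on each of the sets `setK R`. -/
def LipK {E : Type*} [SeminormedAddCommGroup E] (Φ : St → E) : Prop :=
  ∀ R, ∃ C : ℝ, 0 ≤ C ∧ (∀ z, MemK R z → ‖Φ z‖ ≤ C) ∧
    ∀ z z', MemK R z → MemK R z' → ‖Φ z - Φ z'‖ ≤ C * ‖z - z'‖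

namespace LipK

variable {E E' : Type*} [SeminormedAddCommGroup E] [SeminormedAddCommGroup E']

lemma u : LipK fun z => z.1 := fun R =>
  ⟨max R 1, le_max_of_le_right zero_le_one, fun _ h => le_max_of_le_left h.u_le,
    fun z z' _ _ => (norm_fst_le (z - z')).trans
      (le_mul_of_one_le_left (norm_nonneg _) (le_max_right _ _))⟩

lemma v : LipK fun z => z.2.1 := fun R =>
  ⟨max R 1, le_max_of_le_right zero_le_one, fun _ h => le_max_of_le_left h.v_le,
    fun z z' _ _ => ((norm_fst_le (z - z').2).trans (norm_snd_le (z - z'))).trans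
      (le_mul_of_one_le_left (norm_nonneg _) (le_max_right _ _))⟩

lemma ξ : LipK fun z => z.2.2 := fun R =>
  ⟨max R 1, le_max_of_le_right zero_le_one, fun _ h => le_max_of_le_left h.ξ_le,
    fun z z' _ _ => ((norm_snd_le (z - z').2).trans (norm_snd_le (z - z'))).trans
      (le_mul_of_one_le_left (norm_nonneg _) (le_max_right _ _))⟩

lemma const (e : E) : LipK fun _ => e := fun _ =>
  ⟨‖e‖, norm_nonneg _, fun _ _ => le_rfl, fun z z' _ _ => by
    rw [sub_self, norm_zero]
    positivity⟩

lemma prodMk {Φ : St → E} {Ψ : St → E'} (h : LipK Φ) (h' : LipK Ψ) :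
    LipK fun z => (Φ z, Ψ z) := fun R => by
  obtain ⟨C, hC, h1, h2⟩ := h R
  obtain ⟨C', hC', h1', h2'⟩ := h' R
  refine ⟨max C C', le_max_of_le_left hC, fun z hz => max_le_max (h1 z hz) (h1' z hz),
    fun z z' hz hz' => ?_⟩
  refine max_le ((h2 z z' hz hz').trans ?_) ((h2' z z' hz hz').trans ?_)
  · exact mul_le_mul_of_nonneg_right (le_max_left _ _) (norm_nonneg _)
  · exact mul_le_mul_of_nonneg_right (le_max_right _ _) (norm_nonneg _)

lemma add {Φ Ψ : St → E} (h : LipK Φ) (h' : LipK Ψ) : LipK fun z => Φ z + Ψ z := fun R => by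
  obtain ⟨C, hC, h1, h2⟩ := h R
  obtain ⟨C', hC', h1', h2'⟩ := h' R
  refine ⟨C + C', add_nonneg hC hC',
    fun z hz => (norm_add_le _ _).trans (add_le_add (h1 z hz) (h1' z hz)),
    fun z z' hz hz' => ?_⟩
  rw [add_sub_add_comm, add_mul]
  exact (norm_add_le _ _).trans (add_le_add (h2 z z' hz hz') (h2' z z' hz hz'))

lemma comp_lipschitz {Φ : St → E} {g : E → E'} (h : LipK Φ)
    (hg : ∀ R, ∃ C : ℝ, 0 ≤ C ∧ (∀ x, ‖x‖ ≤ R → ‖g x‖ ≤ C) ∧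
      ∀ x y, ‖x‖ ≤ R → ‖y‖ ≤ R → ‖g x - g y‖ ≤ C * ‖x - y‖) : LipK fun z => g (Φ z) := fun R => by
  obtain ⟨C, hC, h1, h2⟩ := h R
  obtain ⟨C', hC', h1', h2'⟩ := hg C
  refine ⟨max C' (C' * C), le_max_of_le_left hC', fun z hz => le_max_of_le_left (h1' _ (h1 z hz)),
    fun z z' hz hz' => ?_⟩
  refine (h2' _ _ (h1 z hz) (h1 z' hz')).trans ?_
  refine (mul_le_mul_of_nonneg_left (h2 z z' hz hz') hC').trans ?_
  rw [← mul_assoc]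
  exact mul_le_mul_of_nonneg_right (le_max_right _ _) (norm_nonneg _)

lemma clm [NormedSpace ℝ E] [NormedSpace ℝ E'] {Φ : St → E} (h : LipK Φ) (g : E →L[ℝ] E') :
    LipK fun z => g (Φ z) := by
  refine h.comp_lipschitz fun R => ⟨max (‖g‖ * R) ‖g‖, le_max_of_le_right (norm_nonneg _),
    fun x hx => le_max_of_le_left ((g.le_opNorm x).trans (by gcongr)), fun x y _ _ => ?_⟩
  rw [← map_sub]
  exact (g.le_opNorm _).trans (mul_le_mul_of_nonneg_right (le_max_right _ _) (norm_nonneg _))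

lemma const_smul [NormedSpace ℝ E] {Φ : St → E} (c : ℝ) (h : LipK Φ) : LipK fun z => c • Φ z :=
  h.clm (c • ContinuousLinearMap.id ℝ E)

lemma sub [NormedSpace ℝ E] {Φ Ψ : St → E} (h : LipK Φ) (h' : LipK Ψ) :
    LipK fun z => Φ z - Ψ z := by
  simpa [sub_eq_add_neg] using h.add (h'.const_smul (-1))

lemma nem {Φ : St → Tri} (h : LipK Φ) {F : ℝ × ℝ × ℝ → ℝ} (hF : ContDiff ℝ 1 F) (h0 : F 0 = 0) :
    LipK fun z => nem F (Φ z) := by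
  refine h.comp_lipschitz fun R => ?_
  obtain ⟨C, hC, h1⟩ := nem_lipschitz hF h0 R
  obtain ⟨C', hC', h2⟩ := nem_norm_le hF h0 R
  refine ⟨max C (C' * R), le_max_of_le_left hC, fun x hx => le_max_of_le_right ?_,
    fun x y hx hy => (h1 x y hx hy).trans
      (mul_le_mul_of_nonneg_right (le_max_left _ _) (norm_nonneg _))⟩
  exact (h2 x hx).trans (by gcongr)

lemma smulA {Φ : St → Linf} {Ψ : St → L2Linf} (h : LipK Φ) (h' : LipK Ψ) :
    LipK fun z => smulA (Φ z) (Ψ z) := fun R => by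
  obtain ⟨C, hC, h1, h2⟩ := h R
  obtain ⟨C', hC', h1', h2'⟩ := h' R
  refine ⟨2 * (C * C'), by positivity, fun z hz => ?_, fun z z' hz hz' => ?_⟩
  · refine (norm_smulA_le _ _).trans ?_
    have : ‖Φ z‖ * ‖Ψ z‖ ≤ C * C' := mul_le_mul (h1 z hz) (h1' z hz) (norm_nonneg _) hC
    linarith [mul_nonneg hC hC']
  · have e : Novikov.smulA (Φ z) (Ψ z) - Novikov.smulA (Φ z') (Ψ z') =
        Novikov.smulA (Φ z) (Ψ z - Ψ z') + Novikov.smulA (Φ z - Φ z') (Ψ z') :=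
      smulA_sub_smulA _ _ _ _
    rw [e]
    refine (norm_add_le _ _).trans ((add_le_add (norm_smulA_le _ _) (norm_smulA_le _ _)).trans ?_)
    have a1 : ‖Φ z‖ * ‖Ψ z - Ψ z'‖ ≤ C * (C' * ‖z - z'‖) :=
      mul_le_mul (h1 z hz) (h2' z z' hz hz') (norm_nonneg _) hC
    have a2 : ‖Φ z - Φ z'‖ * ‖Ψ z'‖ ≤ (C * ‖z - z'‖) * C' :=
      mul_le_mul (h2 z z' hz hz') (h1' z' hz') (norm_nonneg _) (by positivity)
    linarith

/-- Operators with kernels `kerL` and `kerR`. -/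
lemma op {a : St → Linf} {g : St → L2Linf} (ha : LipK a) (hg : LipK g)
    (hdec : ∀ R, ∃ c m, ∀ z, MemK R z → Decays (a z) c m) :
    LipK (fun z => opA (kerL (a z)) (g z)) ∧ LipK (fun z => opA (kerR (a z)) (g z)) := by
  suffices H : ∀ k : (ℝ → ℝ) → ℝ → ℝ → ℝ,
      (∀ (a : Linf) c m, Decays a c m → IsExpKernel (k a) (Real.exp m) c) →
      (∀ (a b : Linf) c m, Decays a c m → Decays b c m →
        IsExpKernel (fun Y Z => k a Y Z - k b Y Z) (‖a - b‖ * (2 / c) * Real.exp m) (c / 2)) →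
      LipK (fun z => opA (k (a z)) (g z)) from
    ⟨H kerL (fun _ _ _ h => h.isExpKernel.kerL) (fun _ _ _ _ h h' => h.isExpKernel_subL h'),
      H kerR (fun _ _ _ h => h.isExpKernel.kerR) (fun _ _ _ _ h h' => h.isExpKernel_subR h')⟩
  intro k hk1 hk2 R
  obtain ⟨C, hC, h1, h2⟩ := ha R
  obtain ⟨C', hC', h1', h2'⟩ := hg R
  obtain ⟨c, m, hd⟩ := hdec R
  -- `Decays` contains `0 < c`, so if `c ≤ 0` no state satisfies `MemK R` and the claim is vacuous.
  rcases le_or_gt c 0 with hc | hc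
  · exact ⟨0, le_rfl, fun z hz => absurd (hd z hz).pos (not_lt.2 hc),
      fun z _ hz _ => absurd (hd z hz).pos (not_lt.2 hc)⟩
  have m1 : 0 ≤ expMass c := (expMass_pos hc).le
  have m2 : 0 ≤ expMass (c / 2) := (expMass_pos (half_pos hc)).le
  set A := 2 * (Real.exp m * expMass c) with hA
  have hA0 : 0 ≤ A := by positivity
  set B := 2 * ((2 / c) * Real.exp m * expMass (c / 2)) with hB
  have hB0 : 0 ≤ B := by positivity
  refine ⟨A * C' + B * (C * C'), by positivity, fun z hz => ?_, fun z z' hz hz' => ?_⟩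
  · refine ((hk1 _ _ _ (hd z hz)).norm_opA_le _).trans ?_
    have : A * ‖g z‖ ≤ A * C' := mul_le_mul_of_nonneg_left (h1' z hz) hA0
    have h3 : 0 ≤ B * (C * C') := by positivity
    linarith
  · have := Decays.norm_op_sub_le (hk1 _ _ _ (hd z hz)) (hk1 _ _ _ (hd z' hz'))
      (hk2 _ _ _ _ (hd z hz) (hd z' hz')) (g z) (g z')
    refine this.trans ?_
    have e : 2 * (‖a z - a z'‖ * (2 / c) * Real.exp m * expMass (c / 2)) * ‖g z'‖ =
        B * (‖a z - a z'‖ * ‖g z'‖) := by rw [hB]; ring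
    rw [e]
    have a1 : ‖a z - a z'‖ * ‖g z'‖ ≤ (C * ‖z - z'‖) * C' :=
      mul_le_mul (h2 z z' hz hz') (h1' z' hz') (norm_nonneg _) (by positivity)
    have a2 := mul_le_mul_of_nonneg_left a1 hB0
    have a3 := mul_le_mul_of_nonneg_left (h2' z z' hz hz') hA0
    linarith

end LipK

lemma fn3_tri_zero (z : St) : ∀ᵐ Y, fn3 (tri z 0) Y = (fn z.1 Y, fn z.2.1 Y, 0) := by
  filter_upwards [fn_zero] with Y hY
  exact Prod.ext rfl (Prod.ext rfl hY)

lemma coeFn_den (z : St) : ∀ᵐ Y, den z Y = z.2.2 Y * Real.cos (fn z.2.1 Y / 2) ^ 4 := by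
  filter_upwards [Lp.coeFn_add z.2.2 (toLinf (smulA z.2.2 (nem fa (tri z 0)))),
    coeFn_toLinf (smulA z.2.2 (nem fa (tri z 0))), fn_smulA z.2.2 (nem fa (tri z 0)),
    fn_nem contDiff_fa fa_zero (tri z 0), fn3_tri_zero z] with Y h1 h2 h3 h4 h5
  rw [den, h1, Pi.add_apply, h2, h3, h4, h5, fa]
  ring

lemma isA_half_sin (v : L2Linf) : IsA fun Y => Real.sin (fn v Y / 2) :=
  IsA.of_le (q := v) (Real.measurable_sin.comp ((measurable_fn v).div_const 2)).aestronglyMeasurable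
    (ae_of_all _ fun Y => by
      refine Real.abs_sin_le_abs.trans ?_
      rw [abs_div, abs_two]
      linarith [abs_nonneg (fn v Y)])

lemma integrable_half_sin_sq (v : L2Linf) : Integrable fun Y => Real.sin (fn v Y / 2) ^ 2 :=
  (isA_half_sin v).two.integrable_sq

/-- Since `cos⁴ ≥ 1 - 2 sin²`, the density is at least `r - 2 r sin²(v/2)`, and the total loss over
the whole line is at most `2 r S`. -/
lemma decays_den {z : St} {r S : ℝ} (hr : 0 < r) (hξ : ∀ᵐ Y, r ≤ z.2.2 Y)
    (hS : ∫ Y, Real.sin (fn z.2.1 Y / 2) ^ 2 ≤ S) : Decays (den z) r (2 * r * S) := by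
  have hi := integrable_half_sin_sq z.2.1
  have key : ∀ Y Z, Z ≤ Y → r * (Y - Z) - 2 * r * S ≤ ∫ s in Z..Y, den z s := by
    intro Y Z hZ
    have h1 : ∫ s in Z..Y, (r - 2 * r * Real.sin (fn z.2.1 s / 2) ^ 2) ≤ ∫ s in Z..Y, den z s := by
      refine intervalIntegral.integral_mono_ae hZ
        (intervalIntegrable_const.sub (hi.const_mul _).intervalIntegrable)
        ((den z).intervalIntegrable _ _) ?_
      filter_upwards [coeFn_den z, hξ] with s h1 h2
      rw [h1]
      have h3 := Real.sin_sq_add_cos_sq (fn z.2.1 s / 2)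
      have h4 : 1 - 2 * Real.sin (fn z.2.1 s / 2) ^ 2 ≤ Real.cos (fn z.2.1 s / 2) ^ 4 := by
        nlinarith [sq_nonneg (Real.sin (fn z.2.1 s / 2) ^ 2)]
      have h5 : 0 ≤ Real.cos (fn z.2.1 s / 2) ^ 4 := by positivity
      nlinarith
    have h2 : ∫ s in Z..Y, 2 * r * Real.sin (fn z.2.1 s / 2) ^ 2 ≤ 2 * r * S := by
      rw [intervalIntegral.integral_const_mul, intervalIntegral.integral_of_le hZ]
      refine mul_le_mul_of_nonneg_left (le_trans ?_ hS) (by positivity)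
      exact setIntegral_le_integral hi (ae_of_all _ fun _ => sq_nonneg _)
    rw [intervalIntegral.integral_sub intervalIntegrable_const
      (hi.const_mul _).intervalIntegrable, intervalIntegral.integral_const, smul_eq_mul] at h1
    linarith
  refine ⟨hr, fun Y Z => ?_⟩
  rcases le_total Z Y with h | h
  · rw [abs_of_nonneg (sub_nonneg.2 h)]
    exact (key Y Z h).trans (le_abs_self _)
  · rw [abs_sub_comm, abs_of_nonneg (sub_nonneg.2 h), intervalIntegral.integral_symm, abs_neg]
    exact (key Z Y h).trans (le_abs_self _)

lemma integral_half_sin_sq_le (v : L2Linf) :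
    ∫ Y, Real.sin (fn v Y / 2) ^ 2 ≤ ‖v‖ ^ 2 := by
  have h1 : ∫ Y, Real.sin (fn v Y / 2) ^ 2 ≤ ∫ Y, fn v Y ^ 2 := by
    refine integral_mono (integrable_half_sin_sq v) (memLp_two_fn v).integrable_sq fun Y => ?_
    refine sq_le_sq.2 (Real.abs_sin_le_abs.trans ?_)
    rw [abs_div, abs_two]
    linarith [abs_nonneg (fn v Y)]
  have h2 : (eLpNorm (fn v) 2 volume).toReal ≤ ‖v‖ := by
    rw [norm_L2Linf_eq]
    exact le_add_of_nonneg_right ENNReal.toReal_nonneg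
  rw [eLpNorm_two_eq (memLp_two_fn v), ENNReal.toReal_ofReal (Real.sqrt_nonneg _)] at h2
  exact h1.trans (Real.sqrt_le_iff.1 h2).2

lemma MemK.decays {R : ℝ} {z : St} (hz : MemK R z) : Decays (den z) R⁻¹ (2 * R⁻¹ * R ^ 2) :=
  decays_den (inv_pos.2 hz.pos) hz.le_ξ ((integral_half_sin_sq_le _).trans
    (pow_le_pow_left₀ (norm_nonneg _) hz.v_le 2))

lemma LipK.tri {q : St → L2Linf} (hq : LipK q) : LipK fun z => tri z (q z) :=
  LipK.u.prodMk (LipK.v.prodMk hq)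

lemma lipK_vfield : LipK vfield := by
  have t0 : LipK fun z => tri z 0 := LipK.tri (LipK.const 0)
  have g1 : LipK srcG₁ := LipK.ξ.smulA (t0.nem contDiff_fg₁ fg₁_zero)
  have g2 : LipK srcG₂ := LipK.ξ.smulA (t0.nem contDiff_fg₂ fg₂_zero)
  have hden : LipK den := LipK.ξ.add ((LipK.ξ.smulA (t0.nem contDiff_fa fa_zero)).clm toLinf)
  have hdec : ∀ R, ∃ c m, ∀ z, MemK R z → Decays (den z) c m :=
    fun R => ⟨_, _, fun z hz => hz.decays⟩
  have o1 := LipK.op hden g1 hdec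
  have o2 := LipK.op hden g2 hdec
  have hU : LipK vfU := ((o1.2.sub o1.1).const_smul _).sub ((o2.1.add o2.2).const_smul _)
  have hQ : LipK vfQ := ((o1.1.add o1.2).const_smul _).add ((o2.2.sub o2.1).const_smul _)
  exact hU.prodMk ((hQ.tri.nem contDiff_fv fv_zero).prodMk
    ((LipK.ξ.smulA (hQ.tri.nem contDiff_fξ fξ_zero)).clm toLinf))

lemma isLipschitzExhaustion_vfield : IsLipschitzExhaustion vfield setK := by
  refine ⟨fun R => ?_, fun R => ?_, fun R => ?_⟩
  · obtain ⟨C, hC, _, h⟩ := lipK_vfield R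
    refine ⟨C.toNNReal, LipschitzOnWith.of_dist_le_mul fun z hz z' hz' => ?_⟩
    rw [Real.coe_toNNReal _ hC, dist_eq_norm, dist_eq_norm]
    exact h z z' hz hz'
  · obtain ⟨C, hC, h, _⟩ := lipK_vfield R
    refine ⟨C.toNNReal, fun z hz => ?_⟩
    rw [Real.coe_toNNReal _ hC]
    exact h z hz
  · rcases le_or_gt R 0 with hR | hR
    · exact ⟨1, one_pos, R, fun z hz => absurd hz.pos (not_lt.2 hR)⟩
    -- Moving by half of `R⁻¹` leaves the lower bound `(2R)⁻¹` for `ξ`. The new index exceeds both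
    -- `R + (2R)⁻¹` and `2R`, so all conditions hold.
    refine ⟨(2 * R)⁻¹, by positivity, 2 * R + (2 * R)⁻¹, fun z hz z' hz' => ?_⟩
    rw [Metric.mem_closedBall, dist_eq_norm] at hz'
    have hp : 0 < (2 * R)⁻¹ := by positivity
    have n1 := (norm_fst_le (z' - z)).trans hz'
    have n2 := ((norm_fst_le (z' - z).2).trans (norm_snd_le (z' - z))).trans hz'
    have n3 := ((norm_snd_le (z' - z).2).trans (norm_snd_le (z' - z))).trans hz'
    refine ⟨by positivity, ?_, ?_, ?_, ?_⟩
    · have := norm_le_norm_add_norm_sub' z'.1 z.1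
      have h := hz.u_le
      have : ‖z'.1 - z.1‖ ≤ (2 * R)⁻¹ := n1
      linarith
    · have := norm_le_norm_add_norm_sub' z'.2.1 z.2.1
      have h := hz.v_le
      have : ‖z'.2.1 - z.2.1‖ ≤ (2 * R)⁻¹ := n2
      linarith
    · have := norm_le_norm_add_norm_sub' z'.2.2 z.2.2
      have h := hz.ξ_le
      have : ‖z'.2.2 - z.2.2‖ ≤ (2 * R)⁻¹ := n3
      linarith
    · filter_upwards [hz.le_ξ, Linf.ae_abs_le (z'.2.2 - z.2.2), Lp.coeFn_sub z'.2.2 z.2.2]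
        with Y h1 h2 h3
      rw [h3, Pi.sub_apply] at h2
      have h4 := (abs_le.1 (h2.trans n3)).1
      have h5 : R⁻¹ = (2 * R)⁻¹ + (2 * R)⁻¹ := by field_simp; norm_num
      have h6 : (2 * R + (2 * R)⁻¹)⁻¹ ≤ (2 * R)⁻¹ :=
        inv_anti₀ (by positivity) (by linarith)
      linarith

/-! ### The nonlocal terms of a state -/

def intL (z : St) (g : L2Linf) (Y : ℝ) : ℝ := ∫ Z, kerL (den z) Y Z * fn g Z

def intR (z : St) (g : L2Linf) (Y : ℝ) : ℝ := ∫ Z, kerR (den z) Y Z * fn g Z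

def stP₁ (z : St) (Y : ℝ) : ℝ := 1 / 2 * (intL z (srcG₁ z) Y + intR z (srcG₁ z) Y)

def stdP₁ (z : St) (Y : ℝ) : ℝ := 1 / 2 * (intR z (srcG₁ z) Y - intL z (srcG₁ z) Y)

def stP₂ (z : St) (Y : ℝ) : ℝ := 1 / 8 * (intL z (srcG₂ z) Y + intR z (srcG₂ z) Y)

def stdP₂ (z : St) (Y : ℝ) : ℝ := 1 / 8 * (intR z (srcG₂ z) Y - intL z (srcG₂ z) Y)

/-- States for which the nonlocal integrals converge. -/
structure Good (z : St) : Prop where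
  decays : ∃ c m, Decays (den z) c m
  nonneg : ∀ᵐ Y, 0 ≤ z.2.2 Y

lemma MemK.good {R : ℝ} {z : St} (hz : MemK R z) : Good z :=
  ⟨⟨_, _, hz.decays⟩, hz.le_ξ.mono fun _ h => (inv_pos.2 hz.pos).le.trans h⟩

lemma fn_srcG₁ (z : St) : ∀ᵐ Y, fn (srcG₁ z) Y =
    (3 / 8 * fn z.1 Y * Real.sin (fn z.2.1 Y) ^ 2 + fn z.1 Y ^ 3 * Real.cos (fn z.2.1 Y / 2) ^ 4)
      * z.2.2 Y := by
  filter_upwards [fn_smulA z.2.2 (nem fg₁ (tri z 0)), fn_nem contDiff_fg₁ fg₁_zero (tri z 0),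
    fn3_tri_zero z] with Y h1 h2 h3
  rw [srcG₁, h1, h2, h3, fg₁]
  ring

lemma fn_srcG₂ (z : St) : ∀ᵐ Y, fn (srcG₂ z) Y =
    z.2.2 Y * Real.sin (fn z.2.1 Y) * Real.sin (fn z.2.1 Y / 2) ^ 2 := by
  filter_upwards [fn_smulA z.2.2 (nem fg₂ (tri z 0)), fn_nem contDiff_fg₂ fg₂_zero (tri z 0),
    fn3_tri_zero z] with Y h1 h2 h3
  rw [srcG₂, h1, h2, h3, fg₂]
  ring

lemma den_nonneg {z : St} (h : ∀ᵐ Y, 0 ≤ z.2.2 Y) : ∀ᵐ Y, 0 ≤ den z Y := by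
  filter_upwards [h, coeFn_den z] with Y h1 h2
  rw [h2]
  positivity

namespace Good

variable {z : St}

lemma isPrim_intL (hz : Good z) (g : L2Linf) :
    IsPrim (intL z g) (fun Y => -(den z Y) * intL z g Y + fn g Y) := by
  obtain ⟨c, m, h⟩ := hz.decays
  exact h.isPrim_opL (den_nonneg hz.nonneg) g

lemma isPrim_intR (hz : Good z) (g : L2Linf) :
    IsPrim (intR z g) (fun Y => den z Y * intR z g Y - fn g Y) := by
  obtain ⟨c, m, h⟩ := hz.decays
  exact h.isPrim_opR (den_nonneg hz.nonneg) g

/-- In the sum of the two one-sided operators the local source terms cancel, while in the difference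
they add up. Together the two identities are `P_xx = P - source`, written in `Y`. -/
lemma isPrim_stP₁ (hz : Good z) : IsPrim (stP₁ z) (fun Y => den z Y * stdP₁ z Y) :=
  (((hz.isPrim_intL (srcG₁ z)).add (hz.isPrim_intR (srcG₁ z))).const_mul (1 / 2)).congr
    (ae_of_all _ fun Y => by simp only [stdP₁]; ring)

lemma isPrim_stdP₁ (hz : Good z) :
    IsPrim (stdP₁ z) (fun Y => den z Y * stP₁ z Y - fn (srcG₁ z) Y) := by
  have h := ((hz.isPrim_intR (srcG₁ z)).add ((hz.isPrim_intL (srcG₁ z)).const_mul (-1))).const_mul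
    (1 / 2)
  have e : (fun Y => 1 / 2 * (intR z (srcG₁ z) Y + -1 * intL z (srcG₁ z) Y)) = stdP₁ z := by
    funext Y
    rw [stdP₁]
    ring
  rw [e] at h
  exact h.congr (ae_of_all _ fun Y => by simp only [stP₁]; ring)

lemma isPrim_stP₂ (hz : Good z) : IsPrim (stP₂ z) (fun Y => den z Y * stdP₂ z Y) :=
  (((hz.isPrim_intL (srcG₂ z)).add (hz.isPrim_intR (srcG₂ z))).const_mul (1 / 8)).congr
    (ae_of_all _ fun Y => by simp only [stdP₂]; ring)

lemma isPrim_stdP₂ (hz : Good z) :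
    IsPrim (stdP₂ z) (fun Y => den z Y * stP₂ z Y - 1 / 4 * fn (srcG₂ z) Y) := by
  have h := ((hz.isPrim_intR (srcG₂ z)).add ((hz.isPrim_intL (srcG₂ z)).const_mul (-1))).const_mul
    (1 / 8)
  have e : (fun Y => 1 / 8 * (intR z (srcG₂ z) Y + -1 * intL z (srcG₂ z) Y)) = stdP₂ z := by
    funext Y
    rw [stdP₂]
    ring
  rw [e] at h
  exact h.congr (ae_of_all _ fun Y => by simp only [stP₂]; ring)

lemma fn_opLSt (hz : Good z) (g : L2Linf) : ∀ᵐ Y, fn (opLSt z g) Y = intL z g Y := by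
  obtain ⟨c, m, h⟩ := hz.decays
  exact h.isExpKernel.kerL.fn_opA g

lemma fn_opRSt (hz : Good z) (g : L2Linf) : ∀ᵐ Y, fn (opRSt z g) Y = intR z g Y := by
  obtain ⟨c, m, h⟩ := hz.decays
  exact h.isExpKernel.kerR.fn_opA g

lemma fn_vfU (hz : Good z) : ∀ᵐ Y, fn (vfU z) Y = -stdP₁ z Y - stP₂ z Y := by
  filter_upwards [hz.fn_opLSt (srcG₁ z), hz.fn_opRSt (srcG₁ z), hz.fn_opLSt (srcG₂ z),
    hz.fn_opRSt (srcG₂ z), fn_sub (opRSt z (srcG₁ z)) (opLSt z (srcG₁ z)),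
    fn_add (opLSt z (srcG₂ z)) (opRSt z (srcG₂ z)),
    fn_smul (-(1 / 2)) (opRSt z (srcG₁ z) - opLSt z (srcG₁ z)),
    fn_smul (1 / 8) (opLSt z (srcG₂ z) + opRSt z (srcG₂ z)),
    fn_sub ((-(1 / 2) : ℝ) • (opRSt z (srcG₁ z) - opLSt z (srcG₁ z)))
      ((1 / 8 : ℝ) • (opLSt z (srcG₂ z) + opRSt z (srcG₂ z)))] with Y h1 h2 h3 h4 h5 h6 h7 h8 h9
  rw [vfU, h9, h7, h8, h5, h6, h1, h2, h3, h4, stdP₁, stP₂]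
  ring

lemma fn_vfQ (hz : Good z) : ∀ᵐ Y, fn (vfQ z) Y = stP₁ z Y + stdP₂ z Y := by
  filter_upwards [hz.fn_opLSt (srcG₁ z), hz.fn_opRSt (srcG₁ z), hz.fn_opLSt (srcG₂ z),
    hz.fn_opRSt (srcG₂ z), fn_add (opLSt z (srcG₁ z)) (opRSt z (srcG₁ z)),
    fn_sub (opRSt z (srcG₂ z)) (opLSt z (srcG₂ z)),
    fn_smul (1 / 2) (opLSt z (srcG₁ z) + opRSt z (srcG₁ z)),
    fn_smul (1 / 8) (opRSt z (srcG₂ z) - opLSt z (srcG₂ z)),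
    fn_add ((1 / 2 : ℝ) • (opLSt z (srcG₁ z) + opRSt z (srcG₁ z)))
      ((1 / 8 : ℝ) • (opRSt z (srcG₂ z) - opLSt z (srcG₂ z)))] with Y h1 h2 h3 h4 h5 h6 h7 h8 h9
  rw [vfQ, h9, h7, h8, h5, h6, h1, h2, h3, h4, stP₁, stdP₂]

lemma integrable_ker_mul (hz : Good z) (g : L2Linf) (Y : ℝ) :
    Integrable fun Z => ker (den z) Y Z * fn g Z := by
  obtain ⟨c, m, h⟩ := hz.decays
  exact h.isExpKernel.integrable_mul g Y

lemma integral_Ioi_eq (_ : Good z) (g : L2Linf) (Y : ℝ) :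
    ∫ Z in Ioi Y, ker (den z) Y Z * fn g Z = intR z g Y := by
  rw [intR, ← integral_indicator measurableSet_Ioi]
  refine integral_congr_ae (ae_of_all _ fun Z => ?_)
  by_cases hZ : Y < Z
  · simp only [kerR, hZ, if_true, indicator_of_mem (show Z ∈ Ioi Y from hZ)]
  · simp only [kerR, hZ, if_false, zero_mul, indicator_of_notMem (show Z ∉ Ioi Y from hZ)]

lemma integral_Iio_eq (_ : Good z) (g : L2Linf) (Y : ℝ) :
    ∫ Z in Iio Y, ker (den z) Y Z * fn g Z = intL z g Y := by
  rw [intL, ← integral_indicator measurableSet_Iio]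
  refine integral_congr_ae (ae_of_all _ fun Z => ?_)
  by_cases hZ : Z < Y
  · simp only [kerL, hZ, if_true, indicator_of_mem (show Z ∈ Iio Y from hZ)]
  · simp only [kerL, hZ, if_false, zero_mul, indicator_of_notMem (show Z ∉ Iio Y from hZ)]

lemma integral_eq (hz : Good z) (g : L2Linf) (Y : ℝ) :
    ∫ Z, ker (den z) Y Z * fn g Z = intL z g Y + intR z g Y := by
  rw [← hz.integral_Iio_eq, ← hz.integral_Ioi_eq, ← integral_Ici_eq_integral_Ioi]
  exact (intervalIntegral.integral_Iio_add_Ici (hz.integrable_ker_mul g Y).integrableOn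
    (hz.integrable_ker_mul g Y).integrableOn).symm

end Good

/-- Functions `u`, `v`, `ξ` representing a state. -/
structure Reps (z : St) (u v ξ : ℝ → ℝ) : Prop where
  u : fn z.1 =ᵐ[volume] u
  v : fn z.2.1 =ᵐ[volume] v
  ξ : z.2.2 =ᵐ[volume] ξ

namespace Reps

variable {z : St} {u v ξ : ℝ → ℝ}

lemma kernel_eq (h : Reps z u v ξ) (Y Z : ℝ) : kernel v ξ Y Z = ker (den z) Y Z := by
  rw [kernel, ker, intervalIntegral.integral_congr_ae]
  filter_upwards [coeFn_den z, h.v, h.ξ] with s h1 h2 h3 _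
  rw [h1, ← h2, ← h3]

lemma integrand₁_ae (h : Reps z u v ξ) (Y : ℝ) :
    ∀ᵐ Z, integrand₁ u v ξ Y Z = ker (den z) Y Z * fn (srcG₁ z) Z := by
  filter_upwards [fn_srcG₁ z, h.u, h.v, h.ξ] with Z h1 h2 h3 h4
  rw [integrand₁, h.kernel_eq, h1, ← h2, ← h3, ← h4]

lemma integrand₂_ae (h : Reps z u v ξ) (Y : ℝ) :
    ∀ᵐ Z, integrand₂ v ξ Y Z = ker (den z) Y Z * fn (srcG₂ z) Z := by
  filter_upwards [fn_srcG₂ z, h.v, h.ξ] with Z h1 h3 h4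
  rw [integrand₂, h.kernel_eq, h1, ← h3, ← h4]

lemma converges (h : Reps z u v ξ) (hz : Good z) : NonlocalConverges u v ξ := fun Y =>
  ⟨(hz.integrable_ker_mul _ Y).congr ((h.integrand₁_ae Y).mono fun _ h => h.symm),
    (hz.integrable_ker_mul _ Y).congr ((h.integrand₂_ae Y).mono fun _ h => h.symm)⟩

lemma P₁_eq (h : Reps z u v ξ) (hz : Good z) (Y : ℝ) : P₁ u v ξ Y = stP₁ z Y := by
  rw [P₁, integral_congr_ae (h.integrand₁_ae Y), hz.integral_eq, stP₁]

lemma P₂_eq (h : Reps z u v ξ) (hz : Good z) (Y : ℝ) : P₂ v ξ Y = stP₂ z Y := by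
  rw [P₂, integral_congr_ae (h.integrand₂_ae Y), hz.integral_eq, stP₂]

lemma dxP₁_eq (h : Reps z u v ξ) (hz : Good z) (Y : ℝ) : dxP₁ u v ξ Y = stdP₁ z Y := by
  rw [dxP₁, integral_congr_ae (ae_restrict_of_ae (h.integrand₁_ae Y)),
    integral_congr_ae (ae_restrict_of_ae (h.integrand₁_ae Y)), hz.integral_Ioi_eq,
    hz.integral_Iio_eq, stdP₁]

lemma dxP₂_eq (h : Reps z u v ξ) (hz : Good z) (Y : ℝ) : dxP₂ v ξ Y = stdP₂ z Y := by
  rw [dxP₂, integral_congr_ae (ae_restrict_of_ae (h.integrand₂_ae Y)),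
    integral_congr_ae (ae_restrict_of_ae (h.integrand₂_ae Y)), hz.integral_Ioi_eq,
    hz.integral_Iio_eq, stdP₂]

end Reps

namespace Good

variable {z : St}

lemma fn_vfield_v (hz : Good z) : ∀ᵐ Y, fn (vfield z).2.1 Y =
    fv (fn z.1 Y, fn z.2.1 Y, stP₁ z Y + stdP₂ z Y) := by
  filter_upwards [fn_nem contDiff_fv fv_zero (tri z (vfQ z)), hz.fn_vfQ] with Y h1 h2
  change fn (nem fv (tri z (vfQ z))) Y = _
  rw [h1, ← h2]
  rfl

lemma coeFn_vfield_ξ (hz : Good z) : ∀ᵐ Y, (vfield z).2.2 Y =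
    z.2.2 Y * fξ (fn z.1 Y, fn z.2.1 Y, stP₁ z Y + stdP₂ z Y) := by
  filter_upwards [fn_nem contDiff_fξ fξ_zero (tri z (vfQ z)), hz.fn_vfQ,
    fn_smulA z.2.2 (nem fξ (tri z (vfQ z))), coeFn_toLinf (smulA z.2.2 (nem fξ (tri z (vfQ z))))]
    with Y h1 h2 h3 h4
  change toLinf (smulA z.2.2 (nem fξ (tri z (vfQ z)))) Y = _
  rw [h4, h3, h1, ← h2]
  rfl

end Good

/-! ### Evolution of functionals along solutions -/

/-- `F'` is the directional derivative of `F` in the first two variables. -/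
def IsDir (F : ℝ × ℝ × ℝ → ℝ) (F' : ℝ → ℝ → ℝ → ℝ → ℝ) : Prop :=
  ∀ x y x' y', HasDerivAt (fun ε : ℝ => F (x + ε * x', y + ε * y', 0)) (F' x y x' y') 0

/-- Replaces the abstract Fréchet derivative by a formula obtained from one-variable differentiation
along a line. -/
lemma IsDir.fderiv_eq {F : ℝ × ℝ × ℝ → ℝ} {F' : ℝ → ℝ → ℝ → ℝ → ℝ} (h : IsDir F F')
    (hF : ContDiff ℝ 1 F) (x y x' y' : ℝ) : fderiv ℝ F (x, y, 0) (x', y', 0) = F' x y x' y' := by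
  have h1 : HasDerivAt (fun ε : ℝ => (x + ε * x', y + ε * y', (0 : ℝ))) (x', y', 0) 0 := by
    have a : ∀ p q : ℝ, HasDerivAt (fun ε : ℝ => p + ε * q) q 0 := fun p q => by
      simpa using ((hasDerivAt_id (0 : ℝ)).mul_const q).const_add p
    exact (a x x').prodMk ((a y y').prodMk (hasDerivAt_const _ _))
  have h2 : HasFDerivAt F (fderiv ℝ F (x, y, 0)) (x + 0 * x', y + 0 * y', (0 : ℝ)) := by
    simpa using (hF.differentiable one_ne_zero (x, y, 0)).hasFDerivAt
  exact (h2.comp_hasDerivAt (0 : ℝ) h1).unique (h x y x' y')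

section Curve

variable {w : ℝ → St} {s : Set ℝ} {t : ℝ} {d : St}

lemma hasDerivWithinAt_u (h : HasDerivWithinAt w d s t) :
    HasDerivWithinAt (fun τ => (w τ).1) d.1 s t :=
  (ContinuousLinearMap.fst ℝ L2Linf (L2Linf × Linf)).hasFDerivAt.comp_hasDerivWithinAt t h

lemma hasDerivWithinAt_vξ (h : HasDerivWithinAt w d s t) :
    HasDerivWithinAt (fun τ => (w τ).2) d.2 s t :=
  (ContinuousLinearMap.snd ℝ L2Linf (L2Linf × Linf)).hasFDerivAt.comp_hasDerivWithinAt t h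

lemma hasDerivWithinAt_v (h : HasDerivWithinAt w d s t) :
    HasDerivWithinAt (fun τ => (w τ).2.1) d.2.1 s t :=
  (ContinuousLinearMap.fst ℝ L2Linf Linf).hasFDerivAt.comp_hasDerivWithinAt t (hasDerivWithinAt_vξ h)

lemma hasDerivWithinAt_ξ (h : HasDerivWithinAt w d s t) :
    HasDerivWithinAt (fun τ => (w τ).2.2) d.2.2 s t :=
  (ContinuousLinearMap.snd ℝ L2Linf Linf).hasFDerivAt.comp_hasDerivWithinAt t (hasDerivWithinAt_vξ h)

lemma hasDerivWithinAt_nem {F : ℝ × ℝ × ℝ → ℝ} {F' : ℝ → ℝ → ℝ → ℝ → ℝ} (hF : ContDiff ℝ 2 F)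
    (h0 : F 0 = 0) (hF' : IsDir F F') (h : HasDerivWithinAt w d s t) :
    ∃ e : L2Linf, HasDerivWithinAt (fun τ => nem F (tri (w τ) 0)) e s t ∧
      ∀ᵐ Y, fn e Y = F' (fn (w t).1 Y) (fn (w t).2.1 Y) (fn d.1 Y) (fn d.2.1 Y) := by
  have hF1 : ContDiff ℝ 1 F := hF.of_le (by norm_num)
  have hp : HasDerivWithinAt (fun τ => tri (w τ) 0) (d.1, d.2.1, 0) s t :=
    (hasDerivWithinAt_u h).prodMk ((hasDerivWithinAt_v h).prodMk (hasDerivWithinAt_const _ _ _))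
  set p' : Tri := (d.1, d.2.1, 0)
  set f : ℝ → ℝ := fun Y => fderiv ℝ F (fn3 (tri (w t) 0) Y) (fn3 p' Y)
  have hfA : IsA f := by
    have hc : Continuous (fderiv ℝ F) := hF1.continuous_fderiv one_ne_zero
    obtain ⟨C, hC⟩ := (isCompact_closedBall (0 : ℝ × ℝ × ℝ) ‖tri (w t) 0‖).bddAbove_image
      hc.norm.continuousOn
    refine IsA.of_le (q := (max C 0) • absTri p') ?_ ?_
    · have : Continuous fun q : (ℝ × ℝ × ℝ) × ℝ × ℝ × ℝ => fderiv ℝ F q.1 q.2 :=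
        (hc.comp continuous_fst).clm_apply continuous_snd
      exact (this.measurable.comp
        ((measurable_fn3 (tri (w t) 0)).prodMk (measurable_fn3 p'))).aestronglyMeasurable
    · filter_upwards [norm_fn3_le (tri (w t) 0), norm_fn3_le_absTri p',
        fn_smul (max C 0) (absTri p')] with Y h1 h2 h3
      rw [h3]
      refine le_trans ?_ (le_abs_self _)
      refine ((fderiv ℝ F (fn3 (tri (w t) 0) Y)).le_opNorm (fn3 p' Y)).trans (mul_le_mul ?_ h2 (norm_nonneg _)
        (le_max_right _ _))
      exact le_max_of_le_left (hC ⟨_, by simpa using h1, rfl⟩)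
  refine ⟨mkA f, nem_hasDerivWithinAt hF h0 hp (fn_mkA hfA), ?_⟩
  filter_upwards [fn_mkA hfA, fn3_tri_zero (w t), fn_zero] with Y h1 h2 h3
  have h4 : fn3 p' Y = (fn d.1 Y, fn d.2.1 Y, 0) := Prod.ext rfl (Prod.ext rfl h3)
  rw [h1, ← hF'.fderiv_eq hF1, ← h2, ← h4]

lemma hasDerivWithinAt_smul_nem {F : ℝ × ℝ × ℝ → ℝ} {F' : ℝ → ℝ → ℝ → ℝ → ℝ}
    (hF : ContDiff ℝ 2 F) (h0 : F 0 = 0) (hF' : IsDir F F') (h : HasDerivWithinAt w d s t) :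
    ∃ e : L2Linf, HasDerivWithinAt (fun τ => smulA (w τ).2.2 (nem F (tri (w τ) 0))) e s t ∧
      ∀ᵐ Y, fn e Y =
        (w t).2.2 Y * F' (fn (w t).1 Y) (fn (w t).2.1 Y) (fn d.1 Y) (fn d.2.1 Y) +
          d.2.2 Y * F (fn (w t).1 Y, fn (w t).2.1 Y, 0) := by
  obtain ⟨e, he, hfe⟩ := hasDerivWithinAt_nem hF h0 hF' h
  refine ⟨_, ContinuousLinearMap.hasDerivWithinAt_of_bilinear (B := smulA)
    (hasDerivWithinAt_ξ h) he, ?_⟩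
  filter_upwards [hfe, fn_add (smulA (w t).2.2 e) (smulA d.2.2 (nem F (tri (w t) 0))),
    fn_smulA (w t).2.2 e, fn_smulA d.2.2 (nem F (tri (w t) 0)),
    fn_nem (hF.of_le (by norm_num)) h0 (tri (w t) 0), fn3_tri_zero (w t)] with Y h1 h2 h3 h4 h5 h6
  rw [h2, h3, h4, h5, h6, h1]

/-- Derivative of the functional `∫ F(u, v) G(u, v) ξ`. -/
lemma hasDerivWithinAt_functional {F G : ℝ × ℝ × ℝ → ℝ} {F' G' : ℝ → ℝ → ℝ → ℝ → ℝ}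
    (hF : ContDiff ℝ 2 F) (hF0 : F 0 = 0) (hF' : IsDir F F')
    (hG : ContDiff ℝ 2 G) (hG0 : G 0 = 0) (hG' : IsDir G G') (h : HasDerivWithinAt w d s t)
    {f : ℝ → ℝ}
    (hf : ∀ᵐ Y, f Y =
      (w t).2.2 Y * (F' (fn (w t).1 Y) (fn (w t).2.1 Y) (fn d.1 Y) (fn d.2.1 Y) *
          G (fn (w t).1 Y, fn (w t).2.1 Y, 0) +
        F (fn (w t).1 Y, fn (w t).2.1 Y, 0) *
          G' (fn (w t).1 Y) (fn (w t).2.1 Y) (fn d.1 Y) (fn d.2.1 Y)) +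
        d.2.2 Y * (F (fn (w t).1 Y, fn (w t).2.1 Y, 0) * G (fn (w t).1 Y, fn (w t).2.1 Y, 0))) :
    Integrable f ∧
      HasDerivWithinAt (fun τ => ∫ Y, F (fn (w τ).1 Y, fn (w τ).2.1 Y, 0) *
        (G (fn (w τ).1 Y, fn (w τ).2.1 Y, 0) * (w τ).2.2 Y)) (∫ Y, f Y) s t := by
  obtain ⟨e₁, he₁, hfe₁⟩ := hasDerivWithinAt_nem hF hF0 hF' h
  obtain ⟨e₂, he₂, hfe₂⟩ := hasDerivWithinAt_smul_nem hG hG0 hG' h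
  have hF1 : ContDiff ℝ 1 F := hF.of_le (by norm_num)
  have hG1 : ContDiff ℝ 1 G := hG.of_le (by norm_num)
  -- The functional is the `L²` inner product of `F(u, v)` and `ξ G(u, v)`, so the product rule
  -- applies. This is why the density is split into two factors that both vanish at the origin.
  have d1 : HasDerivWithinAt (fun τ => toL2 (nem F (tri (w τ) 0))) (toL2 e₁) s t :=
    toL2.hasFDerivAt.comp_hasDerivWithinAt t he₁
  have d2 : HasDerivWithinAt (fun τ => toL2 (smulA (w τ).2.2 (nem G (tri (w τ) 0)))) (toL2 e₂) s t :=
    toL2.hasFDerivAt.comp_hasDerivWithinAt t he₂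
  have d3 := d1.inner ℝ d2
  simp only [inner_toL2] at d3
  have i1 := integrable_mul_fn (nem F (tri (w t) 0)) e₂
  have i2 := integrable_mul_fn e₁ (smulA (w t).2.2 (nem G (tri (w t) 0)))
  have hff : ∀ᵐ Y, fn (nem F (tri (w t) 0)) Y * fn e₂ Y +
      fn e₁ Y * fn (smulA (w t).2.2 (nem G (tri (w t) 0))) Y = f Y := by
    filter_upwards [hf, hfe₁, hfe₂, fn_nem hF1 hF0 (tri (w t) 0), fn_nem hG1 hG0 (tri (w t) 0),
      fn3_tri_zero (w t), fn_smulA (w t).2.2 (nem G (tri (w t) 0))] with Y h0 h1 h2 h3 h4 h5 h6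
    rw [h0, h1, h2, h3, h6, h4, h5]
    ring
  refine ⟨(i1.add i2).congr hff, ?_⟩
  rw [← integral_add i1 i2, integral_congr_ae hff] at d3
  have e : (fun τ => ∫ Y, F (fn (w τ).1 Y, fn (w τ).2.1 Y, 0) *
        (G (fn (w τ).1 Y, fn (w τ).2.1 Y, 0) * (w τ).2.2 Y)) = fun τ =>
      ∫ Y, fn (nem F (tri (w τ) 0)) Y * fn (smulA (w τ).2.2 (nem G (tri (w τ) 0))) Y := by
    funext τ
    refine integral_congr_ae ?_
    filter_upwards [fn_nem hF1 hF0 (tri (w τ) 0), fn_nem hG1 hG0 (tri (w τ) 0),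
      fn3_tri_zero (w τ), fn_smulA (w τ).2.2 (nem G (tri (w τ) 0))] with Y h3 h4 h5 h6
    rw [h3, h6, h4, h5]
    ring
  rw [e]
  exact d3

lemma integrable_functional {F G : ℝ × ℝ × ℝ → ℝ}
    (hF : ContDiff ℝ 1 F) (hF0 : F 0 = 0) (hG : ContDiff ℝ 1 G) (hG0 : G 0 = 0) (z : St) :
    Integrable fun Y => F (fn z.1 Y, fn z.2.1 Y, 0) * (G (fn z.1 Y, fn z.2.1 Y, 0) * z.2.2 Y) := by
  refine (integrable_mul_fn (nem F (tri z 0)) (smulA z.2.2 (nem G (tri z 0)))).congr ?_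
  filter_upwards [fn_nem hF hF0 (tri z 0), fn_nem hG hG0 (tri z 0),
      fn3_tri_zero z, fn_smulA z.2.2 (nem G (tri z 0))] with Y h3 h4 h5 h6
  rw [h3, h6, h4, h5]
  ring

end Curve

/-! ### The invariant relation `u_Y = ξ sin(v/2) cos³(v/2)` -/

/-- Factors of the densities used below: `fX * fUc` and `fS * fSc` for the two parts of the energy,
`fS * fS3` for `sin⁴(v/2)`, `fS * fS2c` for `sin³(v/2) cos(v/2)`. The function `fN` gives the
density of `u_Y`. -/
def fX (p : ℝ × ℝ × ℝ) : ℝ := p.1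
def fN (p : ℝ × ℝ × ℝ) : ℝ := Real.sin (p.2.1 / 2) * Real.cos (p.2.1 / 2) ^ 3
def fUc (p : ℝ × ℝ × ℝ) : ℝ := p.1 * Real.cos (p.2.1 / 2) ^ 4
def fS (p : ℝ × ℝ × ℝ) : ℝ := Real.sin (p.2.1 / 2)
def fSc (p : ℝ × ℝ × ℝ) : ℝ := Real.sin (p.2.1 / 2) * Real.cos (p.2.1 / 2) ^ 2
def fS3 (p : ℝ × ℝ × ℝ) : ℝ := Real.sin (p.2.1 / 2) ^ 3
def fS2c (p : ℝ × ℝ × ℝ) : ℝ := Real.sin (p.2.1 / 2) ^ 2 * Real.cos (p.2.1 / 2)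

lemma contDiff_fX {n : ℕ∞ω} : ContDiff ℝ n fX := by unfold fX; fun_prop
lemma contDiff_fN {n : ℕ∞ω} : ContDiff ℝ n fN := by unfold fN; fun_prop
lemma contDiff_fUc {n : ℕ∞ω} : ContDiff ℝ n fUc := by unfold fUc; fun_prop
lemma contDiff_fS {n : ℕ∞ω} : ContDiff ℝ n fS := by unfold fS; fun_prop
lemma contDiff_fSc {n : ℕ∞ω} : ContDiff ℝ n fSc := by unfold fSc; fun_prop
lemma contDiff_fS3 {n : ℕ∞ω} : ContDiff ℝ n fS3 := by unfold fS3; fun_prop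
lemma contDiff_fS2c {n : ℕ∞ω} : ContDiff ℝ n fS2c := by unfold fS2c; fun_prop

lemma fX_zero : fX 0 = 0 := by simp [fX]
lemma fN_zero : fN 0 = 0 := by simp [fN]
lemma fUc_zero : fUc 0 = 0 := by simp [fUc]
lemma fS_zero : fS 0 = 0 := by simp [fS]
lemma fSc_zero : fSc 0 = 0 := by simp [fSc]
lemma fS3_zero : fS3 0 = 0 := by simp [fS3]
lemma fS2c_zero : fS2c 0 = 0 := by simp [fS2c]

lemma hasDerivAt_line (y y' : ℝ) : HasDerivAt (fun ε : ℝ => y + ε * y') y' 0 := by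
  simpa using ((hasDerivAt_id (0 : ℝ)).mul_const y').const_add y

lemma hasDerivAt_sin_line (y y' : ℝ) :
    HasDerivAt (fun ε : ℝ => Real.sin ((y + ε * y') / 2)) (Real.cos (y / 2) * (y' / 2)) 0 := by
  have := ((hasDerivAt_line y y').div_const 2).sin
  simpa using this

lemma hasDerivAt_cos_line (y y' : ℝ) :
    HasDerivAt (fun ε : ℝ => Real.cos ((y + ε * y') / 2)) (-Real.sin (y / 2) * (y' / 2)) 0 := by
  have := ((hasDerivAt_line y y').div_const 2).cos
  simpa using this

lemma isDir_fX : IsDir fX fun _ _ x' _ => x' := fun x _ x' _ => hasDerivAt_line x x'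

lemma isDir_fN : IsDir fN fun _ y _ y' =>
    1 / 2 * (Real.cos (y / 2) ^ 4 - 3 * Real.sin (y / 2) ^ 2 * Real.cos (y / 2) ^ 2) * y' := by
  intro x y x' y'
  have := (hasDerivAt_sin_line y y').mul ((hasDerivAt_cos_line y y').pow 3)
  refine this.congr_deriv ?_
  simp
  ring

lemma isDir_fUc : IsDir fUc fun x y x' y' =>
    x' * Real.cos (y / 2) ^ 4 - 2 * x * Real.cos (y / 2) ^ 3 * Real.sin (y / 2) * y' := by
  intro x y x' y'
  have := (hasDerivAt_line x x').mul ((hasDerivAt_cos_line y y').pow 4)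
  refine this.congr_deriv ?_
  simp
  ring

lemma isDir_fS : IsDir fS fun _ y _ y' => 1 / 2 * Real.cos (y / 2) * y' := by
  intro x y x' y'
  refine (hasDerivAt_sin_line y y').congr_deriv ?_
  ring

lemma isDir_fSc : IsDir fSc fun _ y _ y' =>
    1 / 2 * (Real.cos (y / 2) ^ 3 - 2 * Real.sin (y / 2) ^ 2 * Real.cos (y / 2)) * y' := by
  intro x y x' y'
  have := (hasDerivAt_sin_line y y').mul ((hasDerivAt_cos_line y y').pow 2)
  refine this.congr_deriv ?_
  simp
  ring

lemma isDir_fS3 : IsDir fS3 fun _ y _ y' =>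
    3 / 2 * Real.sin (y / 2) ^ 2 * Real.cos (y / 2) * y' := by
  intro x y x' y'
  refine ((hasDerivAt_sin_line y y').pow 3).congr_deriv ?_
  simp
  ring

/-- `ξ sin(v/2) cos³(v/2)`. -/
def stN (z : St) : L2Linf := smulA z.2.2 (nem fN (tri z 0))

lemma fn_stN (z : St) : ∀ᵐ Y, fn (stN z) Y =
    z.2.2 Y * (Real.sin (fn z.2.1 Y / 2) * Real.cos (fn z.2.1 Y / 2) ^ 3) := by
  filter_upwards [fn_smulA z.2.2 (nem fN (tri z 0)), fn_nem contDiff_fN fN_zero (tri z 0),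
    fn3_tri_zero z] with Y h1 h2 h3
  rw [stN, h1, h2, h3, fN]

lemma locallyIntegrable_fn (p : L2Linf) : LocallyIntegrable (fn p) :=
  (memLp_two_fn p).locallyIntegrable (by norm_num)

/-- Weak derivative of the `u` component of the vector field. -/
lemma Good.hasWeakDeriv_vfU {z : St} (hz : Good z) : HasWeakDeriv (fn (vfU z))
    (fun Y => fn (srcG₁ z) Y - den z Y * (stP₁ z Y + stdP₂ z Y)) := by
  have h := (hz.isPrim_stdP₁.add hz.isPrim_stP₂).const_mul (-1)
  refine h.hasWeakDeriv.congr ?_ (ae_of_all _ fun Y => by ring)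
  filter_upwards [hz.fn_vfU] with Y h1
  rw [h1]
  ring

/-- The functional `p ↦ ∫ p ψ`. -/
def pairing {ψ : ℝ → ℝ} (hψ : MemLp ψ 2) : L2Linf →L[ℝ] ℝ :=
  (innerSL ℝ (hψ.toLp ψ)).comp toL2

lemma pairing_apply {ψ : ℝ → ℝ} (hψ : MemLp ψ 2) (p : L2Linf) :
    pairing hψ p = ∫ Y, fn p Y * ψ Y := by
  rw [pairing, ContinuousLinearMap.comp_apply, innerSL_apply_apply, L2.inner_def]
  refine integral_congr_ae ?_
  filter_upwards [hψ.coeFn_toLp] with Y h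
  rw [h, coeFn_toL2]
  simp

/-- The time derivative of `ξ sin(v/2) cos³(v/2)` is exactly the weak `Y`-derivative of `u_T` found
in `Good.hasWeakDeriv_vfU`. After the double-angle formula the check is algebra modulo `sin² + cos²
= 1`. -/
lemma deriv_stN {w : ℝ → St} {s : Set ℝ} {t : ℝ} (hz : Good (w t))
    (h : HasDerivWithinAt w (vfield (w t)) s t) :
    ∃ e : L2Linf, HasDerivWithinAt (fun τ => stN (w τ)) e s t ∧
      ∀ᵐ Y, fn e Y = fn (srcG₁ (w t)) Y - den (w t) Y * (stP₁ (w t) Y + stdP₂ (w t) Y) := by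
  obtain ⟨e, he, hfe⟩ := hasDerivWithinAt_smul_nem contDiff_fN fN_zero isDir_fN h
  refine ⟨e, he, ?_⟩
  filter_upwards [hfe, hz.fn_vfield_v, hz.coeFn_vfield_ξ, fn_srcG₁ (w t), coeFn_den (w t)]
    with Y h1 h2 h3 h4 h5
  rw [h1, h2, h3, h4, h5]
  simp only [fN, fv, fξ]
  have hs : Real.sin (fn (w t).2.1 Y) =
      2 * Real.sin (fn (w t).2.1 Y / 2) * Real.cos (fn (w t).2.1 Y / 2) := by
    rw [← Real.sin_two_mul]; ring_nf
  have hsc := Real.sin_sq_add_cos_sq (fn (w t).2.1 Y / 2)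
  rw [hs]
  generalize Real.sin (fn (w t).2.1 Y / 2) = S at *
  generalize Real.cos (fn (w t).2.1 Y / 2) = C at *
  generalize stP₁ (w t) Y + stdP₂ (w t) Y = q
  generalize fn (w t).1 Y = u
  generalize (w t).2.2 Y = x
  grind

lemma IsSolOn.good {T : ℝ} {w : ℝ → St} (h : IsSolOn vfield setK T w) {t : ℝ} (ht : t ∈ Icc 0 T) :
    Good (w t) := by
  obtain ⟨R, hR⟩ := h.mem t ht
  exact MemK.good hR

lemma eq_of_hasDerivWithinAt_zero {f : ℝ → ℝ} {T : ℝ}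
    (h : ∀ t ∈ Icc 0 T, HasDerivWithinAt f 0 (Icc 0 T) t) : ∀ t ∈ Icc 0 T, f t = f 0 :=
  constant_of_has_deriv_right_zero (fun t ht => (h t ht).continuousWithinAt) fun t ht =>
    (((hasDerivWithinAt_Icc_iff_Ici ht).1 (h t ⟨ht.1, ht.2.le⟩)).mono (Ici_subset_Ici.2 ht.1))

/-- For each test function `φ`, the quantity `∫ u φ' + ∫ ξ sin(v/2) cos³(v/2) φ` has zero time
derivative and starts at zero. -/
theorem IsSolOn.hasWeakDeriv {T : ℝ} {w : ℝ → St} (h : IsSolOn vfield setK T w)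
    (h0 : HasWeakDeriv (fn (w 0).1) (fn (stN (w 0)))) {t : ℝ} (ht : t ∈ Icc 0 T) :
    HasWeakDeriv (fn (w t).1) (fn (stN (w t))) := by
  intro φ hφ hc
  have m1 : MemLp φ 2 := hφ.continuous.memLp_of_hasCompactSupport hc
  have m2 : MemLp (_root_.deriv φ) 2 :=
    (hφ.continuous_deriv (by simp)).memLp_of_hasCompactSupport hc.deriv
  have key : ∀ τ ∈ Icc 0 T, HasDerivWithinAt
      (fun τ => pairing m2 (w τ).1 + pairing m1 (stN (w τ))) 0 (Icc 0 T) τ := by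
    intro τ hτ
    have hz := h.good hτ
    obtain ⟨e, he, hfe⟩ := deriv_stN hz (h.deriv τ hτ)
    have a1 := (pairing m2).hasFDerivAt.comp_hasDerivWithinAt τ
      (hasDerivWithinAt_u (h.deriv τ hτ))
    have a2 := (pairing m1).hasFDerivAt.comp_hasDerivWithinAt τ he
    refine (a1.add a2).congr_deriv ?_
    have h1 : (vfield (w τ)).1 = vfU (w τ) := rfl
    have h2 := hz.hasWeakDeriv_vfU φ hφ hc
    have h3 : ∫ Y, fn e Y * φ Y = ∫ Y, (fn (srcG₁ (w τ)) Y -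
        den (w τ) Y * (stP₁ (w τ) Y + stdP₂ (w τ) Y)) * φ Y :=
      integral_congr_ae (by filter_upwards [hfe] with Y hY; rw [hY])
    rw [h1, pairing_apply, pairing_apply, h3, h2, neg_add_cancel]
  have := eq_of_hasDerivWithinAt_zero key t ht
  simp only [pairing_apply] at this
  rw [h0 φ hφ hc, neg_add_cancel] at this
  linarith

/-! ### Conservation of energy -/

/-- In the original variable this is `∫ u² dx`, and `energy₂` is `∫ u_x² dx`. -/
def energy₁ (z : St) : ℝ :=
  ∫ Y, fX (fn z.1 Y, fn z.2.1 Y, 0) * (fUc (fn z.1 Y, fn z.2.1 Y, 0) * z.2.2 Y)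

def energy₂ (z : St) : ℝ :=
  ∫ Y, fS (fn z.1 Y, fn z.2.1 Y, 0) * (fSc (fn z.1 Y, fn z.2.1 Y, 0) * z.2.2 Y)

/-- `∫ (u² cos⁴(v/2) + sin²(v/2) cos²(v/2)) ξ`. -/
def energy (z : St) : ℝ := energy₁ z + energy₂ z

/-- With `u_Y` equal to `stN`, the prescribed `f` is the `Y`-derivative of `u⁴ - 2u(P₁ + ∂ₓP₂)`.
That function is integrable, so its derivative has zero integral. -/
lemma integral_flux_eq_zero {z : St} (hz : Good z) (hu : HasWeakDeriv (fn z.1) (fn (stN z)))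
    {f : ℝ → ℝ} (hf : Integrable f)
    (he : ∀ᵐ Y, f Y = 4 * fn z.1 Y ^ 3 * fn (stN z) Y
      - 2 * fn (stN z) Y * (stP₁ z Y + stdP₂ z Y)
      - 2 * fn z.1 Y * (den z Y * (stdP₁ z Y + stP₂ z Y) - 1 / 4 * fn (srcG₂ z) Y)) :
    ∫ Y, f Y = 0 := by
  obtain ⟨G, hG, hGu⟩ := hu.exists_isPrim (locallyIntegrable_fn _) (locallyIntegrable_fn _)
  have hG2 := hG.mul hG
  have hP := (hG2.mul hG2).add ((hG.mul (hz.isPrim_stP₁.add hz.isPrim_stdP₂)).const_mul (-2))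
  have e : (fun Y => (fn (stN z) Y * G Y + G Y * fn (stN z) Y) * (G Y * G Y) +
      G Y * G Y * (fn (stN z) Y * G Y + G Y * fn (stN z) Y) +
      -2 * (fn (stN z) Y * (stP₁ z Y + stdP₂ z Y) + G Y * (den z Y * stdP₁ z Y +
        (den z Y * stP₂ z Y - 1 / 4 * fn (srcG₂ z) Y)))) =ᵐ[volume] f := by
    filter_upwards [he, hGu] with Y h1 h2
    rw [h1, h2]
    ring
  have hP' := hP.congr e
  refine hP'.integral_eq_zero hf ?_
  have i1 : Integrable fun Y => fn z.1 Y * fn z.1 Y := integrable_mul_fn _ _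
  have i2 : Integrable fun Y => (fn z.1 Y * fn z.1 Y) * (fn z.1 Y * fn z.1 Y) := by
    refine i1.mul_bdd (c := ‖z.1‖ * ‖z.1‖) ((aesm_fn _).mul (aesm_fn _)) ?_
    filter_upwards [ae_abs_fn_le z.1] with Y hY
    rw [norm_mul]
    exact mul_le_mul hY hY (abs_nonneg _) (norm_nonneg _)
  have i3 := (integrable_mul_fn z.1 (vfQ z)).const_mul (-2)
  refine (i2.add i3).congr ?_
  filter_upwards [hGu, hz.fn_vfQ] with Y h1 h2
  simp only [Pi.add_apply]
  rw [h1, h2]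

/-- The letters `x`, `p`, `q`, `r`, `l` stand for `ξ`, `P₁`, `∂ₓP₂`, `P₂`, `∂ₓP₁` at a point. The
left side is the time derivative of the energy density, the right side the flux derivative of
`integral_flux_eq_zero`. -/
lemma energy_flux_identity (u v x p q r l : ℝ) :
    x * ((-l - r) * fUc (u, v, 0) + fX (u, v, 0) *
        ((-l - r) * Real.cos (v / 2) ^ 4 -
          2 * u * Real.cos (v / 2) ^ 3 * Real.sin (v / 2) * fv (u, v, p + q))) +
      x * fξ (u, v, p + q) * (fX (u, v, 0) * fUc (u, v, 0)) +
    (x * (1 / 2 * Real.cos (v / 2) * fv (u, v, p + q) * fSc (u, v, 0) + fS (u, v, 0) *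
        (1 / 2 * (Real.cos (v / 2) ^ 3 - 2 * Real.sin (v / 2) ^ 2 * Real.cos (v / 2)) *
          fv (u, v, p + q))) +
      x * fξ (u, v, p + q) * (fS (u, v, 0) * fSc (u, v, 0))) =
    4 * u ^ 3 * (x * (Real.sin (v / 2) * Real.cos (v / 2) ^ 3))
      - 2 * (x * (Real.sin (v / 2) * Real.cos (v / 2) ^ 3)) * (p + q)
      - 2 * u * (x * Real.cos (v / 2) ^ 4 * (l + r) -
        1 / 4 * (x * Real.sin v * Real.sin (v / 2) ^ 2)) := by
  have hs : Real.sin v = 2 * Real.sin (v / 2) * Real.cos (v / 2) := by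
    rw [← Real.sin_two_mul]; ring_nf
  have hsc := Real.sin_sq_add_cos_sq (v / 2)
  simp only [fX, fUc, fS, fSc, fv, fξ]
  rw [hs]
  generalize Real.sin (v / 2) = S at *
  generalize Real.cos (v / 2) = C at *
  linear_combination ((x * S * C) * ((2 * u ^ 3 - 2 * (p + q)) * C ^ 2 +
    u * S ^ 2 + 2 * u ^ 3 * C ^ 2)) * hsc

lemma IsSolOn.energy_deriv {T : ℝ} {w : ℝ → St} (h : IsSolOn vfield setK T w)
    (h0 : HasWeakDeriv (fn (w 0).1) (fn (stN (w 0)))) {τ : ℝ} (hτ : τ ∈ Icc 0 T) :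
    HasDerivWithinAt (fun τ => energy (w τ)) 0 (Icc 0 T) τ := by
  have hz := h.good hτ
  obtain ⟨i1, d1⟩ := hasDerivWithinAt_functional contDiff_fX fX_zero isDir_fX contDiff_fUc fUc_zero
    isDir_fUc (h.deriv τ hτ) (ae_of_all _ fun _ => rfl)
  obtain ⟨i2, d2⟩ := hasDerivWithinAt_functional contDiff_fS fS_zero isDir_fS contDiff_fSc fSc_zero
    isDir_fSc (h.deriv τ hτ) (ae_of_all _ fun _ => rfl)
  have d := d1.add d2
  rw [← integral_add i1 i2] at d
  refine d.congr_deriv ?_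
  clear d d1 d2
  refine integral_flux_eq_zero hz (h.hasWeakDeriv h0 hτ) (i1.add i2) ?_
  clear i1 i2
  filter_upwards [hz.fn_vfield_v, hz.coeFn_vfield_ξ, hz.fn_vfU, fn_stN (w τ), coeFn_den (w τ),
    fn_srcG₂ (w τ)] with Y h2 h3 h1 h4 h5 h6
  have hU : fn (vfield (w τ)).1 Y = -stdP₁ (w τ) Y - stP₂ (w τ) Y := h1
  rw [h2, h3, hU, h4, h5, h6]
  exact energy_flux_identity _ _ _ _ _ _ _

theorem IsSolOn.energy_eq {T : ℝ} {w : ℝ → St} (h : IsSolOn vfield setK T w)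
    (h0 : HasWeakDeriv (fn (w 0).1) (fn (stN (w 0)))) {t : ℝ} (ht : t ∈ Icc 0 T) :
    energy (w t) = energy (w 0) :=
  eq_of_hasDerivWithinAt_zero (f := fun τ => energy (w τ)) (fun _ hτ => h.energy_deriv h0 hτ) t ht

/-- `∫ sin⁴(v/2) ξ`. -/
def quartic (z : St) : ℝ :=
  ∫ Y, fS (fn z.1 Y, fn z.2.1 Y, 0) * (fS3 (fn z.1 Y, fn z.2.1 Y, 0) * z.2.2 Y)

/-- In the original variable, the derivative of `∫ u_x⁴ dx` is `4 ∫ u_x³ (u³ - P₁ - ∂ₓP₂) dx`: no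
power of `u_x` above the third remains in the local factor. -/
lemma IsSolOn.quartic_deriv {T : ℝ} {w : ℝ → St} (h : IsSolOn vfield setK T w) {τ : ℝ}
    (hτ : τ ∈ Icc 0 T) : HasDerivWithinAt (fun τ => quartic (w τ))
      (∫ Y, 4 * (Real.sin (fn (w τ).2.1 Y / 2) ^ 3 * Real.cos (fn (w τ).2.1 Y / 2) * (w τ).2.2 Y) *
        (fn (w τ).1 Y ^ 3 - (stP₁ (w τ) Y + stdP₂ (w τ) Y))) (Icc 0 T) τ := by
  have hz := h.good hτ
  refine (hasDerivWithinAt_functional contDiff_fS fS_zero isDir_fS contDiff_fS3 fS3_zero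
    isDir_fS3 (h.deriv τ hτ) ?_).2
  filter_upwards [hz.fn_vfield_v, hz.coeFn_vfield_ξ] with Y h2 h3
  rw [h2, h3]
  simp only [fS, fS3, fv, fξ]
  have hs : Real.sin (fn (w τ).2.1 Y) =
      2 * Real.sin (fn (w τ).2.1 Y / 2) * Real.cos (fn (w τ).2.1 Y / 2) := by
    rw [← Real.sin_two_mul]; ring_nf
  have hsc := Real.sin_sq_add_cos_sq (fn (w τ).2.1 Y / 2)
  rw [hs]
  generalize Real.sin (fn (w τ).2.1 Y / 2) = S at *
  generalize Real.cos (fn (w τ).2.1 Y / 2) = C at *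
  generalize stP₁ (w τ) Y + stdP₂ (w τ) Y = q
  linear_combination (-2 * (w τ).2.2 Y * S ^ 3 * C * (2 * fn (w τ).1 Y ^ 3 - 2 * q)) * hsc

/-! ### A priori bounds -/

/-! ### Bounds at a single state by the energy and the quartic integral. -/

section SingleState

variable {z : St}

/-- The integrand of the energy. -/
def energyDens (z : St) (Y : ℝ) : ℝ :=
  (fn z.1 Y ^ 2 * Real.cos (fn z.2.1 Y / 2) ^ 4 +
    Real.sin (fn z.2.1 Y / 2) ^ 2 * Real.cos (fn z.2.1 Y / 2) ^ 2) * z.2.2 Y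

lemma integrable_energy₁ (z : St) : Integrable fun Y =>
    fX (fn z.1 Y, fn z.2.1 Y, 0) * (fUc (fn z.1 Y, fn z.2.1 Y, 0) * z.2.2 Y) :=
  integrable_functional contDiff_fX fX_zero contDiff_fUc fUc_zero z

lemma integrable_energy₂ (z : St) : Integrable fun Y =>
    fS (fn z.1 Y, fn z.2.1 Y, 0) * (fSc (fn z.1 Y, fn z.2.1 Y, 0) * z.2.2 Y) :=
  integrable_functional contDiff_fS fS_zero contDiff_fSc fSc_zero z

lemma integrable_quartic (z : St) : Integrable fun Y =>
    fS (fn z.1 Y, fn z.2.1 Y, 0) * (fS3 (fn z.1 Y, fn z.2.1 Y, 0) * z.2.2 Y) :=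
  integrable_functional contDiff_fS fS_zero contDiff_fS3 fS3_zero z

lemma integrable_energyDens (z : St) : Integrable (energyDens z) := by
  refine ((integrable_energy₁ z).add (integrable_energy₂ z)).congr (ae_of_all _ fun Y => ?_)
  simp only [Pi.add_apply, fX, fUc, fS, fSc, energyDens]
  ring

lemma energy_eq_integral (z : St) : energy z = ∫ Y, energyDens z Y := by
  rw [energy, energy₁, energy₂, ← integral_add (integrable_energy₁ z) (integrable_energy₂ z)]
  refine integral_congr_ae (ae_of_all _ fun Y => ?_)
  simp only [fX, fUc, fS, fSc, energyDens]
  ring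

lemma Good.energyDens_nonneg (hz : Good z) : ∀ᵐ Y, 0 ≤ energyDens z Y := by
  filter_upwards [hz.nonneg] with Y h
  unfold energyDens
  positivity

lemma Good.energy_nonneg (hz : Good z) : 0 ≤ energy z := by
  rw [energy_eq_integral]
  exact integral_nonneg_of_ae hz.energyDens_nonneg

lemma Good.energy₂_le (hz : Good z) : energy₂ z ≤ energy z := by
  have : 0 ≤ energy₁ z := by
    refine integral_nonneg_of_ae ?_
    filter_upwards [hz.nonneg] with Y h
    simp only [fX, fUc, Pi.zero_apply]
    have : 0 ≤ fn z.1 Y * fn z.1 Y * Real.cos (fn z.2.1 Y / 2) ^ 4 * z.2.2 Y :=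
      mul_nonneg (mul_nonneg (mul_self_nonneg _) (by positivity)) h
    linarith
  rw [energy]
  linarith

lemma Good.quartic_nonneg (hz : Good z) : 0 ≤ quartic z := by
  refine integral_nonneg_of_ae ?_
  filter_upwards [hz.nonneg] with Y h
  simp only [fS, fS3, Pi.zero_apply]
  have : 0 ≤ Real.sin (fn z.2.1 Y / 2) ^ 4 * z.2.2 Y := by positivity
  linarith

/-- `u²` is at most `∫ 2 |u u_Y|`, and `2 |u sin(v/2) cos³(v/2)| ≤ u² cos⁴(v/2) + sin²(v/2)
cos²(v/2)` makes the integrand at most the energy density. -/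
lemma Good.sq_fn_le (hz : Good z) (hu : HasWeakDeriv (fn z.1) (fn (stN z))) :
    ∀ᵐ Y, fn z.1 Y ^ 2 ≤ energy z := by
  obtain ⟨G, hG, hGu⟩ := hu.exists_isPrim (locallyIntegrable_fn _) (locallyIntegrable_fn _)
  have hG2 := hG.mul hG
  have i1 : Integrable fun Y => G Y * G Y := (integrable_mul_fn z.1 z.1).congr (by
    filter_upwards [hGu] with Y h
    rw [h])
  have i2 : Integrable fun Y => fn (stN z) Y * G Y + G Y * fn (stN z) Y :=
    ((integrable_mul_fn (stN z) z.1).add (integrable_mul_fn z.1 (stN z))).congr (by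
      filter_upwards [hGu] with Y h
      simp only [Pi.add_apply]
      rw [h])
  have key : ∫ Y, |fn (stN z) Y * G Y + G Y * fn (stN z) Y| ≤ energy z := by
    rw [energy_eq_integral]
    refine integral_mono_ae i2.abs (integrable_energyDens z) ?_
    filter_upwards [hGu, fn_stN z, hz.nonneg] with Y h1 h2 h3
    rw [← h1, h2, energyDens]
    generalize Real.sin (fn z.2.1 Y / 2) = S
    generalize Real.cos (fn z.2.1 Y / 2) = C
    generalize fn z.1 Y = u
    refine abs_le.2 ⟨?_, ?_⟩
    · nlinarith [mul_nonneg h3 (sq_nonneg (u * C ^ 2 + S * C))]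
    · nlinarith [mul_nonneg h3 (sq_nonneg (u * C ^ 2 - S * C))]
  filter_upwards [hGu] with Y h
  have := hG2.abs_le_integral i2 i1 Y
  rw [h, sq]
  exact (le_abs_self _).trans (this.trans key)

lemma Good.abs_fn_le (hz : Good z) (hu : HasWeakDeriv (fn z.1) (fn (stN z))) :
    ∀ᵐ Y, |fn z.1 Y| ≤ √(energy z) := by
  filter_upwards [hz.sq_fn_le hu] with Y h
  exact Real.abs_le_sqrt h

lemma ker_nonneg (a : ℝ → ℝ) (Y Z : ℝ) : 0 ≤ ker a Y Z := (Real.exp_pos _).le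

lemma ker_le_one (a : ℝ → ℝ) (Y Z : ℝ) : ker a Y Z ≤ 1 := by
  rw [ker, Real.exp_le_one_iff]
  exact neg_nonpos.2 (abs_nonneg _)

/-- The kernel is at most 1 and the two operators see disjoint half-lines, so together they cost one
`L¹` norm. The bound does not involve the decay constants, which are not yet controlled along a
solution. -/
lemma Good.abs_intL_add_abs_intR_le (hz : Good z) {g : L2Linf} (hg : Integrable (fn g)) (Y : ℝ) :
    |intL z g Y| + |intR z g Y| ≤ ∫ Z, |fn g Z| := by
  obtain ⟨c, m, h⟩ := hz.decays
  have iL := h.isExpKernel.kerL.integrable_mul g Y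
  have iR := h.isExpKernel.kerR.integrable_mul g Y
  calc |intL z g Y| + |intR z g Y|
      ≤ (∫ Z, |kerL (den z) Y Z * fn g Z|) + ∫ Z, |kerR (den z) Y Z * fn g Z| :=
        add_le_add (abs_integral_le_integral_abs) (abs_integral_le_integral_abs)
    _ = ∫ Z, (|kerL (den z) Y Z * fn g Z| + |kerR (den z) Y Z * fn g Z|) :=
        (integral_add iL.abs iR.abs).symm
    _ ≤ ∫ Z, |fn g Z| := by
        refine integral_mono (iL.abs.add iR.abs) hg.abs fun Z => ?_
        have h0 := ker_nonneg (den z) Y Z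
        have h1 := mul_le_mul_of_nonneg_right (ker_le_one (den z) Y Z) (abs_nonneg (fn g Z))
        simp only [kerL, kerR]
        rcases lt_trichotomy Z Y with hZ | hZ | hZ
        · simp only [hZ, if_true, hZ.not_gt, if_false, zero_mul, abs_zero, add_zero, abs_mul,
            abs_of_nonneg h0]
          linarith
        · simp [hZ]
        · simp only [hZ, if_true, hZ.not_gt, if_false, zero_mul, abs_zero, zero_add, abs_mul,
            abs_of_nonneg h0]
          linarith

/-- Since `(3/8) sin² v = (3/2) sin²(v/2) cos²(v/2)`, the source is at most `(3/2) sup|u|` times the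
energy density; the prefactor `1/2` of `P₁` gives `3/4`. -/
lemma Good.abs_stP₁_le (hz : Good z) (hu : HasWeakDeriv (fn z.1) (fn (stN z))) (Y : ℝ) :
    |stP₁ z Y| ≤ 3 / 4 * √(energy z) ^ 3 := by
  have hb : ∀ᵐ Y, |fn (srcG₁ z) Y| ≤ 3 / 2 * √(energy z) * energyDens z Y := by
    filter_upwards [hz.abs_fn_le hu, fn_srcG₁ z, hz.nonneg] with Y h1 h2 h3
    have hs : Real.sin (fn z.2.1 Y) = 2 * Real.sin (fn z.2.1 Y / 2) * Real.cos (fn z.2.1 Y / 2) := by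
      rw [← Real.sin_two_mul]; ring_nf
    rw [h2, hs, energyDens]
    generalize Real.sin (fn z.2.1 Y / 2) = S
    generalize Real.cos (fn z.2.1 Y / 2) = C
    generalize fn z.1 Y = u at *
    have e : (3 / 8 * u * (2 * S * C) ^ 2 + u ^ 3 * C ^ 4) * z.2.2 Y =
        u * ((3 / 2 * (S ^ 2 * C ^ 2) + u ^ 2 * C ^ 4) * z.2.2 Y) := by ring
    have hp : 0 ≤ (3 / 2 * (S ^ 2 * C ^ 2) + u ^ 2 * C ^ 4) * z.2.2 Y := by positivity
    have hq : 0 ≤ u ^ 2 * C ^ 4 * z.2.2 Y := by positivity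
    rw [e, abs_mul, abs_of_nonneg hp]
    calc |u| * ((3 / 2 * (S ^ 2 * C ^ 2) + u ^ 2 * C ^ 4) * z.2.2 Y)
        ≤ √(energy z) * ((3 / 2 * (S ^ 2 * C ^ 2) + u ^ 2 * C ^ 4) * z.2.2 Y) := by gcongr
      _ ≤ √(energy z) * (3 / 2 * ((u ^ 2 * C ^ 4 + S ^ 2 * C ^ 2) * z.2.2 Y)) := by
        refine mul_le_mul_of_nonneg_left ?_ (Real.sqrt_nonneg _)
        linarith
      _ = _ := by ring
  have ib := (integrable_energyDens z).const_mul (3 / 2 * √(energy z))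
  have ig : Integrable (fn (srcG₁ z)) := ib.mono' (aesm_fn _) hb
  have h1 := hz.abs_intL_add_abs_intR_le ig Y
  have h2 : ∫ Z, |fn (srcG₁ z) Z| ≤ 3 / 2 * √(energy z) * energy z := by
    rw [energy_eq_integral z, ← integral_const_mul, ← energy_eq_integral]
    exact integral_mono_ae ig.abs ib hb
  have h3 : √(energy z) ^ 2 = energy z := Real.sq_sqrt hz.energy_nonneg
  rw [stP₁, abs_mul, abs_of_nonneg (by norm_num : (0 : ℝ) ≤ 1 / 2)]
  have h4 := abs_add_le (intL z (srcG₁ z) Y) (intR z (srcG₁ z) Y)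
  have h5 : √(energy z) ^ 3 = √(energy z) * energy z := by rw [pow_succ, h3]; ring
  rw [h5]
  linarith

/-- The integrand of `cross`. -/
def crossDens (z : St) (Y : ℝ) : ℝ :=
  |Real.sin (fn z.2.1 Y / 2) ^ 3 * Real.cos (fn z.2.1 Y / 2)| * z.2.2 Y

/-- `∫ |sin³(v/2) cos(v/2)| ξ`. -/
def cross (z : St) : ℝ := ∫ Y, crossDens z Y

lemma Good.integrable_crossDens (hz : Good z) : Integrable (crossDens z) := by
  have := (integrable_functional contDiff_fS fS_zero contDiff_fS2c fS2c_zero z).abs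
  refine this.congr ?_
  filter_upwards [hz.nonneg] with Y h
  simp only [fS, fS2c, crossDens]
  rw [← mul_assoc, abs_mul, abs_of_nonneg h]
  ring_nf

lemma Good.crossDens_nonneg (hz : Good z) : ∀ᵐ Y, 0 ≤ crossDens z Y := by
  filter_upwards [hz.nonneg] with Y h
  unfold crossDens
  positivity

lemma Good.cross_nonneg (hz : Good z) : 0 ≤ cross z := integral_nonneg_of_ae hz.crossDens_nonneg

lemma Good.abs_stdP₂_le (hz : Good z) (Y : ℝ) : |stdP₂ z Y| ≤ 1 / 4 * cross z := by
  have hb : ∀ᵐ Y, |fn (srcG₂ z) Y| = 2 * crossDens z Y := by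
    filter_upwards [fn_srcG₂ z, hz.nonneg] with Y h2 h3
    have hs : Real.sin (fn z.2.1 Y) = 2 * Real.sin (fn z.2.1 Y / 2) * Real.cos (fn z.2.1 Y / 2) := by
      rw [← Real.sin_two_mul]; ring_nf
    rw [h2, hs, crossDens]
    generalize Real.sin (fn z.2.1 Y / 2) = S
    generalize Real.cos (fn z.2.1 Y / 2) = C
    have e : z.2.2 Y * (2 * S * C) * S ^ 2 = 2 * ((S ^ 3 * C) * z.2.2 Y) := by ring
    rw [e, abs_mul, abs_mul, abs_of_nonneg h3, abs_of_nonneg (by norm_num : (0 : ℝ) ≤ 2)]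
  have ib := hz.integrable_crossDens.const_mul 2
  have ig : Integrable (fn (srcG₂ z)) := ib.mono' (aesm_fn _) (hb.mono fun _ h => h.le)
  have h1 := hz.abs_intL_add_abs_intR_le ig Y
  have h2 : ∫ Z, |fn (srcG₂ z) Z| = 2 * cross z := by
    rw [cross, ← integral_const_mul]
    exact integral_congr_ae hb
  rw [stdP₂, abs_mul, abs_of_nonneg (by norm_num : (0 : ℝ) ≤ 1 / 8)]
  have h4 := abs_sub (intR z (srcG₂ z) Y) (intL z (srcG₂ z) Y)
  linarith

/-- Cauchy–Schwarz for `|sin³ cos| = sin² · |sin cos|` with weight `ξ`, through the discriminant of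
a nonnegative quadratic. -/
lemma Good.sq_cross_le (hz : Good z) : cross z ^ 2 ≤ quartic z * energy z := by
  have key : ∀ l : ℝ, 0 ≤ quartic z * (l * l) + (-2 * cross z) * l + energy₂ z := by
    intro l
    have e : quartic z * (l * l) + (-2 * cross z) * l + energy₂ z = ∫ Y,
        ((l * l) * (fS (fn z.1 Y, fn z.2.1 Y, 0) * (fS3 (fn z.1 Y, fn z.2.1 Y, 0) * z.2.2 Y)) +
          (-2 * l) * crossDens z Y +
          fS (fn z.1 Y, fn z.2.1 Y, 0) * (fSc (fn z.1 Y, fn z.2.1 Y, 0) * z.2.2 Y)) := by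
      have i1 := (integrable_quartic z).const_mul (l * l)
      have i2 := hz.integrable_crossDens.const_mul (-2 * l)
      have a := integral_add (i1.add i2) (integrable_energy₂ z)
      rw [integral_add' i1 i2, integral_const_mul, integral_const_mul] at a
      refine Eq.trans ?_ a.symm
      change _ = l * l * quartic z + -2 * l * cross z + energy₂ z
      ring
    rw [e]
    refine integral_nonneg_of_ae ?_
    filter_upwards [hz.nonneg] with Y h
    simp only [fS, fS3, fSc, crossDens, Pi.zero_apply]
    generalize Real.sin (fn z.2.1 Y / 2) = S
    generalize Real.cos (fn z.2.1 Y / 2) = C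
    have e1 : |S ^ 3 * C| = S ^ 2 * |S * C| := by
      rw [show S ^ 3 * C = S ^ 2 * (S * C) by ring, abs_mul, abs_of_nonneg (sq_nonneg S)]
    have e2 : |S * C| ^ 2 = S ^ 2 * C ^ 2 := by rw [sq_abs, mul_pow]
    rw [e1]
    have : 0 ≤ (l * S ^ 2 - |S * C|) ^ 2 * z.2.2 Y := by positivity
    have e3 : (l * S ^ 2 - |S * C|) ^ 2 =
        l * l * S ^ 4 - 2 * l * (S ^ 2 * |S * C|) + S ^ 2 * C ^ 2 := by
      rw [← e2]; ring
    rw [e3] at this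
    linarith
  have := discrim_le_zero key
  rw [discrim] at this
  have h2 := mul_le_mul_of_nonneg_left hz.energy₂_le hz.quartic_nonneg
  linarith

lemma Good.cross_le (hz : Good z) : cross z ≤ (quartic z + energy z) / 2 := by
  refine abs_le_of_sq_le_sq' ?_ (by linarith [hz.quartic_nonneg, hz.energy_nonneg]) |>.2
  linarith [hz.sq_cross_le, sq_nonneg (quartic z - energy z)]

end SingleState

/-- A bound for `quartic` up to time `T` along the solution starting at `z₀`. -/
def quarticBound (z₀ : St) (T : ℝ) : ℝ :=
  gronwallBound (quartic z₀) (7 / 2 * √(energy z₀) ^ 3 + √(energy z₀) ^ 2)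
    (7 / 2 * √(energy z₀) ^ 5) T

/-- A bound for `P₁ + ∂ₓP₂` up to time `T` along the solution starting at `z₀`. -/
def nonlocalBound (z₀ : St) (T : ℝ) : ℝ :=
  3 / 4 * √(energy z₀) ^ 3 + 1 / 8 * (quarticBound z₀ T + energy z₀)

/-! ### Growth of the quartic integral and of the nonlocal terms along a solution. -/

section

variable {T : ℝ} {w : ℝ → St}

/-- The bounds on `u`, `P₁` and `∂ₓP₂` give `(7e³ + cross) * cross`, with `7 = 4(1 + 3/4)`. The
quadratic term is at most `e² * quartic` by `Good.sq_cross_le`, and the linear one is split by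
`Good.cross_le`. The result is affine in `quartic`, as Grönwall requires. -/
lemma IsSolOn.abs_quartic_deriv_le (h : IsSolOn vfield setK T w)
    (h0 : HasWeakDeriv (fn (w 0).1) (fn (stN (w 0)))) {τ : ℝ} (hτ : τ ∈ Icc 0 T) :
    |∫ Y, 4 * (Real.sin (fn (w τ).2.1 Y / 2) ^ 3 * Real.cos (fn (w τ).2.1 Y / 2) * (w τ).2.2 Y) *
        (fn (w τ).1 Y ^ 3 - (stP₁ (w τ) Y + stdP₂ (w τ) Y))| ≤
      (7 / 2 * √(energy (w 0)) ^ 3 + √(energy (w 0)) ^ 2) * quartic (w τ) +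
        7 / 2 * √(energy (w 0)) ^ 5 := by
  have hz := h.good hτ
  have hu := h.hasWeakDeriv h0 hτ
  have hE := h.energy_eq h0 hτ
  set e := √(energy (w 0)) with he
  have he2 : e ^ 2 = energy (w 0) := Real.sq_sqrt (hE ▸ hz.energy_nonneg)
  have he0 : 0 ≤ e := Real.sqrt_nonneg _
  have hA := hz.quartic_nonneg
  have hJ := hz.cross_nonneg
  have hJ1 := hz.cross_le
  have hJ2 := hz.sq_cross_le
  rw [hE, ← he2] at hJ1 hJ2
  have hb : ∀ᵐ Y, ‖4 * (Real.sin (fn (w τ).2.1 Y / 2) ^ 3 * Real.cos (fn (w τ).2.1 Y / 2) *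
      (w τ).2.2 Y) * (fn (w τ).1 Y ^ 3 - (stP₁ (w τ) Y + stdP₂ (w τ) Y))‖ ≤
      (7 * e ^ 3 + cross (w τ)) * crossDens (w τ) Y := by
    filter_upwards [hz.nonneg, hz.abs_fn_le hu] with Y h1 h2
    have h3 := hz.abs_stP₁_le hu Y
    have h4 := hz.abs_stdP₂_le Y
    rw [hE, ← he] at h2 h3
    have h5 : |fn (w τ).1 Y ^ 3 - (stP₁ (w τ) Y + stdP₂ (w τ) Y)| ≤
        e ^ 3 + (3 / 4 * e ^ 3 + 1 / 4 * cross (w τ)) := by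
      refine (abs_sub _ _).trans (add_le_add ?_ ((abs_add_le _ _).trans (add_le_add h3 h4)))
      rw [abs_pow]
      gcongr
    have h6 : 0 ≤ crossDens (w τ) Y := by unfold crossDens; positivity
    have h7 : |Real.sin (fn (w τ).2.1 Y / 2) ^ 3 * Real.cos (fn (w τ).2.1 Y / 2) * (w τ).2.2 Y| =
        crossDens (w τ) Y := by rw [abs_mul, abs_of_nonneg h1, crossDens]
    rw [Real.norm_eq_abs, abs_mul, abs_mul, h7, abs_of_nonneg (by norm_num : (0 : ℝ) ≤ 4)]
    calc _ ≤ 4 * crossDens (w τ) Y * (e ^ 3 + (3 / 4 * e ^ 3 + 1 / 4 * cross (w τ))) := by gcongr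
      _ = _ := by ring
  have := norm_integral_le_of_norm_le (hz.integrable_crossDens.const_mul _) hb
  rw [integral_const_mul] at this
  change |_| ≤ (7 * e ^ 3 + cross (w τ)) * cross (w τ) at this
  refine this.trans ?_
  have h8 : e ^ 3 * cross (w τ) ≤ e ^ 3 * ((quartic (w τ) + e ^ 2) / 2) := by gcongr
  nlinarith

lemma IsSolOn.quartic_le (h : IsSolOn vfield setK T w)
    (h0 : HasWeakDeriv (fn (w 0).1) (fn (stN (w 0)))) {t : ℝ} (ht : t ∈ Icc 0 T) :
    quartic (w t) ≤ quarticBound (w 0) t := by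
  have key := norm_le_gronwallBound_of_norm_deriv_right_le (f := fun τ => quartic (w τ))
    (f' := fun τ => ∫ Y, 4 * (Real.sin (fn (w τ).2.1 Y / 2) ^ 3 *
      Real.cos (fn (w τ).2.1 Y / 2) * (w τ).2.2 Y) *
        (fn (w τ).1 Y ^ 3 - (stP₁ (w τ) Y + stdP₂ (w τ) Y)))
    (a := 0) (b := T) (δ := quartic (w 0)) (fun τ hτ => (h.quartic_deriv hτ).continuousWithinAt)
    (fun τ hτ => ((hasDerivWithinAt_Icc_iff_Ici hτ).1 (h.quartic_deriv ⟨hτ.1, hτ.2.le⟩)).mono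
      (Ici_subset_Ici.2 hτ.1))
    (by rw [Real.norm_eq_abs, abs_of_nonneg (h.good ⟨le_rfl, ht.1.trans ht.2⟩).quartic_nonneg])
    (fun τ hτ => by
      have hτ' : τ ∈ Icc 0 T := ⟨hτ.1, hτ.2.le⟩
      rw [Real.norm_eq_abs, Real.norm_eq_abs, abs_of_nonneg (h.good hτ').quartic_nonneg]
      exact h.abs_quartic_deriv_le h0 hτ') t ht
  rw [sub_zero] at key
  exact (le_abs_self _).trans key

lemma quarticBound_mono {z₀ : St} (hz : Good z₀) : Monotone (quarticBound z₀) :=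
  gronwallBound_mono hz.quartic_nonneg (by positivity) (by positivity)

lemma IsSolOn.abs_nonlocal_le (h : IsSolOn vfield setK T w)
    (h0 : HasWeakDeriv (fn (w 0).1) (fn (stN (w 0)))) {t : ℝ} (ht : t ∈ Icc 0 T) {T₀ : ℝ}
    (hT : T ≤ T₀) (Y : ℝ) :
    |stP₁ (w t) Y + stdP₂ (w t) Y| ≤ nonlocalBound (w 0) T₀ := by
  have hz := h.good ht
  have h3 := hz.abs_stP₁_le (h.hasWeakDeriv h0 ht) Y
  have h4 := hz.abs_stdP₂_le Y
  have h5 := hz.cross_le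
  rw [h.energy_eq h0 ht] at h3 h5
  have h6 := (h.quartic_le h0 ht).trans
    (quarticBound_mono (h.good ⟨le_rfl, ht.1.trans ht.2⟩) (ht.2.trans hT))
  refine (abs_add_le _ _).trans ?_
  rw [nonlocalBound]
  linarith

end

/-! ### Bounds for `ξ` -/

/-- The functional `p ↦ ∫_s p` on `L^∞`. -/
def setIntegralL (s : Set ℝ) (hs : volume s < ⊤) : Linf →L[ℝ] ℝ :=
  LinearMap.mkContinuous
    { toFun := fun p => ∫ Y in s, p Y
      map_add' := fun p q => by
        have : IsFiniteMeasure (volume.restrict s) := ⟨by simpa using hs⟩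
        have hi : ∀ p : Linf, Integrable (p : ℝ → ℝ) (volume.restrict s) := fun p =>
          ((Lp.memLp p).restrict s).integrable le_top
        rw [← integral_add (hi p) (hi q)]
        exact integral_congr_ae (ae_restrict_of_ae (Lp.coeFn_add p q))
      map_smul' := fun c p => by
        rw [RingHom.id_apply, smul_eq_mul, ← integral_const_mul]
        exact integral_congr_ae (ae_restrict_of_ae (Lp.coeFn_smul c p)) }
    (volume s).toReal (fun p => by
      have := norm_setIntegral_le_of_norm_le_const_ae' (f := (p : ℝ → ℝ)) (C := ‖p‖) hs
        ((Linf.ae_abs_le p).mono fun Y h _ => h)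
      rw [mul_comm]
      exact this)

lemma setIntegralL_apply (s : Set ℝ) (hs : volume s < ⊤) (p : Linf) :
    setIntegralL s hs p = ∫ Y in s, p Y := rfl

lemma Linf.integrableOn (p : Linf) {s : Set ℝ} (hs : volume s < ⊤) : IntegrableOn p s := by
  have : IsFiniteMeasure (volume.restrict s) := ⟨by simpa using hs⟩
  exact ((Lp.memLp p).restrict s).integrable le_top

/-- `e^{Bt} f` is nondecreasing and `e^{-Bt} f` is nonincreasing. -/
lemma bounds_of_abs_deriv_le {f f' : ℝ → ℝ} {T B : ℝ}
    (hf : ∀ t ∈ Icc 0 T, HasDerivWithinAt f (f' t) (Icc 0 T) t)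
    (hB : ∀ t ∈ Icc 0 T, |f' t| ≤ B * f t) {t : ℝ} (ht : t ∈ Icc 0 T) :
    Real.exp (-(B * t)) * f 0 ≤ f t ∧ f t ≤ Real.exp (B * t) * f 0 := by
  have key : ∀ σ : ℝ, ∀ τ ∈ Icc 0 T, HasDerivWithinAt (fun τ => Real.exp (σ * τ) * f τ)
      (Real.exp (σ * τ) * (σ * f τ + f' τ)) (Icc 0 T) τ := by
    intro σ τ hτ
    have h1 : HasDerivAt (fun τ => Real.exp (σ * τ)) (Real.exp (σ * τ) * σ) τ := by
      simpa using ((hasDerivAt_id τ).const_mul σ).exp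
    refine (h1.hasDerivWithinAt.mul (hf τ hτ)).congr_deriv ?_
    ring
  have hint : ∀ {g : ℝ → ℝ} {g' : ℝ → ℝ},
      (∀ τ ∈ Icc 0 T, HasDerivWithinAt g (g' τ) (Icc 0 T) τ) →
      ContinuousOn g (Icc 0 T) ∧ ∀ x ∈ interior (Icc 0 T),
        HasDerivWithinAt g (g' x) (interior (Icc 0 T)) x :=
    fun h => ⟨fun τ hτ => (h τ hτ).continuousWithinAt,
      fun τ hτ => (h τ (interior_subset hτ)).mono interior_subset⟩
  have h00 : (0 : ℝ) ∈ Icc 0 T := ⟨le_rfl, ht.1.trans ht.2⟩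
  have hm : MonotoneOn (fun τ => Real.exp (B * τ) * f τ) (Icc 0 T) :=
    monotoneOn_of_hasDerivWithinAt_nonneg (convex_Icc 0 T) (hint (key B)).1 (hint (key B)).2
      fun x hx => mul_nonneg (Real.exp_pos _).le
        (by linarith [neg_abs_le (f' x), hB x (interior_subset hx)])
  have ha : AntitoneOn (fun τ => Real.exp (-B * τ) * f τ) (Icc 0 T) :=
    antitoneOn_of_hasDerivWithinAt_nonpos (convex_Icc 0 T) (hint (key (-B))).1 (hint (key (-B))).2
      fun x hx => mul_nonpos_of_nonneg_of_nonpos (Real.exp_pos _).le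
        (by linarith [le_abs_self (f' x), hB x (interior_subset hx)])
  have h1 := hm h00 ht ht.1
  have h2 := ha h00 ht ht.1
  simp only [mul_zero, Real.exp_zero, one_mul] at h1 h2
  constructor
  · calc _ ≤ Real.exp (-(B * t)) * (Real.exp (B * t) * f t) := by gcongr
      _ = f t := by rw [← mul_assoc, ← Real.exp_add]; simp
  · calc f t = Real.exp (B * t) * (Real.exp (-B * t) * f t) := by
          rw [← mul_assoc, ← Real.exp_add]; simp
      _ ≤ _ := by gcongr

lemma ae_le_of_setIntegral_le {f g : ℝ → ℝ}
    (hf : ∀ s, volume s < ⊤ → IntegrableOn f s) (hg : ∀ s, volume s < ⊤ → IntegrableOn g s)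
    (h : ∀ s, MeasurableSet s → volume s < ⊤ → ∫ Y in s, f Y ≤ ∫ Y in s, g Y) :
    ∀ᵐ Y, f Y ≤ g Y := by
  have := ae_nonneg_of_forall_setIntegral_nonneg_of_sigmaFinite (μ := volume)
    (f := fun Y => g Y - f Y) (fun s _ hs => (hg s hs).sub (hf s hs)) (fun s hm hs => by
      rw [integral_sub (hg s hs) (hf s hs)]
      exact sub_nonneg.2 (h s hm hs))
  filter_upwards [this] with Y hY
  exact sub_nonneg.1 hY

/-- Evaluation at a point is not defined on `L^∞`, so the scalar inequality is applied to the
integrals of `ξ` over sets of finite measure. These determine the almost everywhere bounds. -/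
lemma IsSolOn.ξ_bounds {T : ℝ} {w : ℝ → St} (h : IsSolOn vfield setK T w)
    (h1 : ∀ᵐ Y, (w 0).2.2 Y = 1) {B : ℝ}
    (hB : ∀ t ∈ Icc 0 T, ∀ᵐ Y, |(vfield (w t)).2.2 Y| ≤ B * (w t).2.2 Y)
    {t : ℝ} (ht : t ∈ Icc 0 T) :
    (∀ᵐ Y, Real.exp (-(B * t)) ≤ (w t).2.2 Y) ∧ ∀ᵐ Y, (w t).2.2 Y ≤ Real.exp (B * t) := by
  have key : ∀ s, MeasurableSet s → volume s < ⊤ →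
      Real.exp (-(B * t)) * ∫ Y in s, (w 0).2.2 Y ≤ ∫ Y in s, (w t).2.2 Y ∧
      ∫ Y in s, (w t).2.2 Y ≤ Real.exp (B * t) * ∫ Y in s, (w 0).2.2 Y := by
    intro s _ hs
    refine bounds_of_abs_deriv_le (f := fun τ => setIntegralL s hs (w τ).2.2)
      (f' := fun τ => setIntegralL s hs (vfield (w τ)).2.2) (fun τ hτ =>
        (setIntegralL s hs).hasFDerivAt.comp_hasDerivWithinAt τ
          (hasDerivWithinAt_ξ (h.deriv τ hτ))) (fun τ hτ => ?_) ht
    rw [setIntegralL_apply, setIntegralL_apply, ← integral_const_mul]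
    exact norm_integral_le_of_norm_le (f := (vfield (w τ)).2.2) (((w τ).2.2.integrableOn hs).const_mul B)
      (ae_restrict_of_ae (hB τ hτ))
  have e : ∀ (s : Set ℝ) (c : ℝ), c * ∫ Y in s, (w 0).2.2 Y = ∫ Y in s, c := by
    intro s c
    rw [← integral_const_mul]
    refine integral_congr_ae (ae_restrict_of_ae ?_)
    filter_upwards [h1] with Y hY
    rw [hY, mul_one]
  have ic : ∀ (c : ℝ) (s : Set ℝ), volume s < ⊤ → IntegrableOn (fun _ => c) s := fun c s hs =>
    integrableOn_const hs.ne
  constructor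
  · refine ae_le_of_setIntegral_le (ic _) (fun s hs => Linf.integrableOn _ hs) fun s hm hs => ?_
    rw [← e]
    exact (key s hm hs).1
  · refine ae_le_of_setIntegral_le (fun s hs => Linf.integrableOn _ hs) (ic _) fun s hm hs => ?_
    rw [← e]
    exact (key s hm hs).2

/-! ### Bounds in `L² ∩ L^∞` -/

lemma norm_le_add_of_ae_le {r p q : L2Linf} {a b : ℝ} (ha : 0 ≤ a) (hb : 0 ≤ b)
    (h : ∀ᵐ Y, |fn r Y| ≤ a * |fn p Y| + b * |fn q Y|) : ‖r‖ ≤ a * ‖p‖ + b * ‖q‖ := by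
  have h1 : ‖r‖ ≤ ‖a • mkA (fun Y => |fn p Y|) + b • mkA fun Y => |fn q Y|‖ := by
    refine norm_le_of_ae_le ?_
    filter_upwards [h, fn_add (a • mkA (fun Y => |fn p Y|)) (b • mkA fun Y => |fn q Y|),
      fn_smul a (mkA fun Y => |fn p Y|), fn_smul b (mkA fun Y => |fn q Y|), fn_mkA (isA_abs p),
      fn_mkA (isA_abs q)] with Y h1 h2 h3 h4 h5 h6
    rw [h2, h3, h4, h5, h6]
    exact h1.trans (le_abs_self _)
  refine h1.trans ((norm_add_le _ _).trans ?_)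
  rw [norm_smul, norm_smul, Real.norm_of_nonneg ha, Real.norm_of_nonneg hb]
  gcongr
  · exact norm_mkA_abs p
  · exact norm_mkA_abs q

/-- A bound for the norms of the one-sided operators. -/
def opBound (c m : ℝ) : ℝ := 2 * (Real.exp m * expMass c)

lemma opBound_nonneg {c m : ℝ} (hc : 0 < c) : 0 ≤ opBound c m := by
  have := expMass_pos hc
  unfold opBound
  positivity

/-! ### Estimates of the vector field linear in the norms of `u` and `v`. -/

section

variable {z : St} {c m : ℝ}

lemma Decays.norm_opLSt_le (h : Decays (den z) c m) (g : L2Linf) :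
    ‖opLSt z g‖ ≤ opBound c m * ‖g‖ := h.isExpKernel.kerL.norm_opA_le g

lemma Decays.norm_opRSt_le (h : Decays (den z) c m) (g : L2Linf) :
    ‖opRSt z g‖ ≤ opBound c m * ‖g‖ := h.isExpKernel.kerR.norm_opA_le g

lemma Decays.norm_vfU_le (h : Decays (den z) c m) :
    ‖vfU z‖ ≤ opBound c m * (‖srcG₁ z‖ + ‖srcG₂ z‖) := by
  have h1 := h.norm_opLSt_le (srcG₁ z)
  have h2 := h.norm_opRSt_le (srcG₁ z)
  have h3 := h.norm_opLSt_le (srcG₂ z)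
  have h4 := h.norm_opRSt_le (srcG₂ z)
  have h5 := mul_nonneg (opBound_nonneg h.pos (m := m)) (norm_nonneg (srcG₂ z))
  rw [vfU]
  refine (norm_sub_le _ _).trans ?_
  rw [norm_smul, norm_smul]
  have h6 := norm_sub_le (opRSt z (srcG₁ z)) (opLSt z (srcG₁ z))
  have h7 := norm_add_le (opLSt z (srcG₂ z)) (opRSt z (srcG₂ z))
  rw [Real.norm_of_nonneg (by norm_num : (0 : ℝ) ≤ 1 / 8), norm_neg,
    Real.norm_of_nonneg (by norm_num : (0 : ℝ) ≤ 1 / 2)]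
  linarith

lemma Decays.norm_vfQ_le (h : Decays (den z) c m) :
    ‖vfQ z‖ ≤ opBound c m * (‖srcG₁ z‖ + ‖srcG₂ z‖) := by
  have h1 := h.norm_opLSt_le (srcG₁ z)
  have h2 := h.norm_opRSt_le (srcG₁ z)
  have h3 := h.norm_opLSt_le (srcG₂ z)
  have h4 := h.norm_opRSt_le (srcG₂ z)
  have h5 := mul_nonneg (opBound_nonneg h.pos (m := m)) (norm_nonneg (srcG₂ z))
  rw [vfQ]
  refine (norm_add_le _ _).trans ?_
  rw [norm_smul, norm_smul]
  have h6 := norm_add_le (opLSt z (srcG₁ z)) (opRSt z (srcG₁ z))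
  have h7 := norm_sub_le (opRSt z (srcG₂ z)) (opLSt z (srcG₂ z))
  rw [Real.norm_of_nonneg (by norm_num : (0 : ℝ) ≤ 1 / 8),
    Real.norm_of_nonneg (by norm_num : (0 : ℝ) ≤ 1 / 2)]
  linarith

/-- The sup bound `e` absorbs two of the three powers of `u`, which leaves an estimate linear in the
norm. -/
lemma norm_srcG₁_le {X e : ℝ} (hX0 : 0 ≤ X) (hX : ∀ᵐ Y, |z.2.2 Y| ≤ X)
    (he : ∀ᵐ Y, |fn z.1 Y| ≤ e) : ‖srcG₁ z‖ ≤ X * (3 / 8 + e ^ 2) * ‖z.1‖ := by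
  have : ‖srcG₁ z‖ ≤ X * (3 / 8 + e ^ 2) * ‖z.1‖ + 0 * ‖z.1‖ := by
    refine norm_le_add_of_ae_le (by positivity) le_rfl ?_
    filter_upwards [hX, he, fn_srcG₁ z] with Y h1 h2 h3
    have h4 := Real.sin_sq_le_one (fn z.2.1 Y)
    have h5 : Real.cos (fn z.2.1 Y / 2) ^ 4 ≤ 1 := by
      have := Real.cos_sq_le_one (fn z.2.1 Y / 2)
      nlinarith [sq_nonneg (Real.cos (fn z.2.1 Y / 2))]
    have h6 : 3 / 8 * fn z.1 Y * Real.sin (fn z.2.1 Y) ^ 2 +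
        fn z.1 Y ^ 3 * Real.cos (fn z.2.1 Y / 2) ^ 4 = fn z.1 Y * (3 / 8 * Real.sin (fn z.2.1 Y) ^ 2
          + |fn z.1 Y| ^ 2 * Real.cos (fn z.2.1 Y / 2) ^ 4) := by rw [sq_abs]; ring
    rw [h3, h6, abs_mul, abs_mul, zero_mul, add_zero]
    have h7 : 0 ≤ 3 / 8 * Real.sin (fn z.2.1 Y) ^ 2
          + |fn z.1 Y| ^ 2 * Real.cos (fn z.2.1 Y / 2) ^ 4 := by positivity
    have h8 : 3 / 8 * Real.sin (fn z.2.1 Y) ^ 2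
          + |fn z.1 Y| ^ 2 * Real.cos (fn z.2.1 Y / 2) ^ 4 ≤ 3 / 8 * 1 + e ^ 2 * 1 := by gcongr
    rw [abs_of_nonneg h7]
    calc _ ≤ |fn z.1 Y| * (3 / 8 * 1 + e ^ 2 * 1) * X := by gcongr
      _ = _ := by ring
  linarith

lemma norm_srcG₂_le {X : ℝ} (hX0 : 0 ≤ X) (hX : ∀ᵐ Y, |z.2.2 Y| ≤ X) :
    ‖srcG₂ z‖ ≤ X * ‖z.2.1‖ := by
  have : ‖srcG₂ z‖ ≤ X * ‖z.2.1‖ + 0 * ‖z.1‖ := by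
    refine norm_le_add_of_ae_le hX0 le_rfl ?_
    filter_upwards [hX, fn_srcG₂ z] with Y h1 h3
    have h4 : |Real.sin (fn z.2.1 Y / 2) ^ 2| ≤ 1 := by
      rw [abs_of_nonneg (sq_nonneg _)]
      exact Real.sin_sq_le_one _
    have h5 := Real.abs_sin_le_abs (x := fn z.2.1 Y)
    rw [h3, abs_mul, abs_mul, zero_mul, add_zero]
    calc _ ≤ X * |fn z.2.1 Y| * 1 := by gcongr
      _ = _ := by ring
  linarith

lemma norm_vfield_v_le (hz : Good z) {e : ℝ} (he : ∀ᵐ Y, |fn z.1 Y| ≤ e) :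
    ‖(vfield z).2.1‖ ≤ (1 + 2 * e ^ 2) * ‖z.1‖ + 2 * ‖vfQ z‖ := by
  refine norm_le_add_of_ae_le (by positivity) (by norm_num) ?_
  filter_upwards [he, hz.fn_vfield_v, hz.fn_vfQ] with Y h1 h2 h3
  have hs := Real.sin_sq_le_one (fn z.2.1 Y / 2)
  have hc := Real.cos_sq_le_one (fn z.2.1 Y / 2)
  rw [h2, ← h3]
  simp only [fv]
  have e1 : -fn z.1 Y * Real.sin (fn z.2.1 Y / 2) ^ 2 + 2 * fn z.1 Y ^ 3 *
      Real.cos (fn z.2.1 Y / 2) ^ 2 - 2 * Real.cos (fn z.2.1 Y / 2) ^ 2 * fn (vfQ z) Y =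
      fn z.1 Y * (-Real.sin (fn z.2.1 Y / 2) ^ 2 + 2 * |fn z.1 Y| ^ 2 *
        Real.cos (fn z.2.1 Y / 2) ^ 2) - 2 * Real.cos (fn z.2.1 Y / 2) ^ 2 * fn (vfQ z) Y := by
    rw [sq_abs]; ring
  rw [e1]
  refine (abs_sub _ _).trans (add_le_add ?_ ?_)
  · rw [abs_mul, mul_comm]
    refine mul_le_mul_of_nonneg_right ?_ (abs_nonneg _)
    have : 2 * |fn z.1 Y| ^ 2 * Real.cos (fn z.2.1 Y / 2) ^ 2 ≤ 2 * e ^ 2 * 1 := by gcongr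
    have h0 : 0 ≤ 2 * |fn z.1 Y| ^ 2 * Real.cos (fn z.2.1 Y / 2) ^ 2 := by positivity
    have := sq_nonneg (Real.sin (fn z.2.1 Y / 2))
    have := sq_nonneg e
    exact abs_le.2 ⟨by linarith, by linarith⟩
  · rw [abs_mul, abs_of_nonneg (by positivity)]
    refine mul_le_mul_of_nonneg_right ?_ (abs_nonneg _)
    linarith

/-- From `sin² = sin⁴ + sin² cos²` and `ξ ≥ r`, the integral of `sin²(v/2)` is at most `(quartic +
energy₂) / r`. Unlike `MemK.decays`, this does not involve `‖v‖`, so the operator bounds do not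
spoil a linear Grönwall estimate. -/
lemma Good.decays_den_of_le (hz : Good z) {r A : ℝ} (hr : 0 < r) (hξ : ∀ᵐ Y, r ≤ z.2.2 Y)
    (hA : quartic z ≤ A) : Decays (den z) r (2 * r * ((A + energy z) / r)) := by
  refine decays_den hr hξ ((le_div_iff₀ hr).2 ?_)
  rw [← integral_mul_const]
  refine le_trans ?_ (add_le_add hA hz.energy₂_le)
  rw [quartic, energy₂, ← integral_add (integrable_quartic z) (integrable_energy₂ z)]
  refine integral_mono_ae ((integrable_half_sin_sq z.2.1).mul_const r)
    ((integrable_quartic z).add (integrable_energy₂ z)) ?_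
  filter_upwards [hξ] with Y h
  simp only [fS, fS3, fSc]
  have h1 := mul_le_mul_of_nonneg_left h (sq_nonneg (Real.sin (fn z.2.1 Y / 2)))
  have h2 := Real.sin_sq_add_cos_sq (fn z.2.1 Y / 2)
  generalize Real.sin (fn z.2.1 Y / 2) = S at *
  generalize Real.cos (fn z.2.1 Y / 2) = C at *
  have e : S * (S ^ 3 * z.2.2 Y) + S * (S * C ^ 2 * z.2.2 Y) =
    S ^ 2 * z.2.2 Y * (S ^ 2 + C ^ 2) := by ring
  rw [e, h2]
  linarith

end

/-- Solutions starting from compatible data stay in a fixed set of the exhaustion on bounded time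
intervals. -/
theorem exists_apriori_bound {z₀ : St} (hz₀ : Good z₀)
    (hu : HasWeakDeriv (fn z₀.1) (fn (stN z₀))) (h1 : ∀ᵐ Y, z₀.2.2 Y = 1) (T₀ : ℝ) :
    ∃ R, ∀ T, 0 ≤ T → T ≤ T₀ → ∀ w : ℝ → St, w 0 = z₀ → IsSolOn vfield setK T w →
      w T ∈ setK R := by
  set e := √(energy z₀)
  have he0 : 0 ≤ e := Real.sqrt_nonneg _
  set q := nonlocalBound z₀ T₀
  -- Bounds the factor `2u³ + u - 2(P₁ + ∂ₓP₂)`, hence the logarithmic growth rate of `ξ`.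
  set B := 2 * e ^ 3 + e + 2 * |q|
  have hB0 : 0 ≤ B := by positivity
  set X := Real.exp (B * T₀)
  have hX0 : 0 < X := Real.exp_pos _
  set r := Real.exp (-(B * T₀))
  have hr : 0 < r := Real.exp_pos _
  set m := 2 * r * ((quarticBound z₀ T₀ + energy z₀) / r)
  -- `11/8` is `3/8` from the first source plus `1` from the second.
  set K₁ := opBound r m * (X * (11 / 8 + e ^ 2))
  have hop : 0 ≤ opBound r m := opBound_nonneg hr
  have hK₁ : 0 ≤ K₁ := by positivity
  set K := 1 + 2 * e ^ 2 + 2 * K₁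
  have hK : 0 ≤ K := by positivity
  -- The first summand bounds `u` and `v`, the second bounds `ξ`. The lower bound for `ξ` is `r =
  -- X⁻¹`, which is at least the inverse of the sum.
  refine ⟨gronwallBound ‖(z₀.1, z₀.2.1)‖ K 0 T₀ + X, ?_⟩
  intro T hT0 hT w hw0 hw
  have h0 : HasWeakDeriv (fn (w 0).1) (fn (stN (w 0))) := by rwa [hw0]
  have hTT : T ∈ Icc 0 T := ⟨hT0, le_rfl⟩
  have hU : ∀ t ∈ Icc 0 T, ∀ᵐ Y, |fn (w t).1 Y| ≤ e := fun t ht => by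
    have := (hw.good ht).abs_fn_le (hw.hasWeakDeriv h0 ht)
    rwa [hw.energy_eq h0 ht, hw0] at this
  have hQ : ∀ t ∈ Icc 0 T, ∀ Y, |stP₁ (w t) Y + stdP₂ (w t) Y| ≤ |q| := fun t ht Y => by
    have := hw.abs_nonlocal_le h0 ht hT Y
    rw [hw0] at this
    exact this.trans (le_abs_self _)
  have hξ' : ∀ t ∈ Icc 0 T, ∀ᵐ Y, |(vfield (w t)).2.2 Y| ≤ B * (w t).2.2 Y := fun t ht => by
    filter_upwards [hU t ht, (hw.good ht).coeFn_vfield_ξ, (hw.good ht).nonneg] with Y a1 a2 a3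
    rw [a2, abs_mul, abs_of_nonneg a3, mul_comm]
    refine mul_le_mul_of_nonneg_right ?_ a3
    simp only [fξ]
    rw [abs_mul]
    have b1 : |2 * fn (w t).1 Y ^ 3 + fn (w t).1 Y - 2 * (stP₁ (w t) Y + stdP₂ (w t) Y)| ≤ B := by
      refine (abs_sub _ _).trans (add_le_add ((abs_add_le _ _).trans (add_le_add ?_ a1)) ?_)
      · rw [abs_mul, abs_pow, abs_of_nonneg (by norm_num : (0 : ℝ) ≤ 2)]
        gcongr
      · rw [abs_mul, abs_of_nonneg (by norm_num : (0 : ℝ) ≤ 2)]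
        exact mul_le_mul_of_nonneg_left (hQ t ht Y) (by norm_num)
    calc _ ≤ B * 1 := mul_le_mul b1 (Real.abs_sin_le_one _) (abs_nonneg _) hB0
      _ = B := mul_one B
  have hlow : ∀ t ∈ Icc 0 T, ∀ᵐ Y, r ≤ (w t).2.2 Y := fun t ht => by
    filter_upwards [(hw.ξ_bounds (by rwa [hw0]) hξ' ht).1] with Y hY
    refine le_trans (Real.exp_le_exp.2 (neg_le_neg ?_)) hY
    exact mul_le_mul_of_nonneg_left (ht.2.trans hT) hB0
  have hupp : ∀ t ∈ Icc 0 T, ∀ᵐ Y, |(w t).2.2 Y| ≤ X := fun t ht => by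
    filter_upwards [(hw.ξ_bounds (by rwa [hw0]) hξ' ht).2, (hw.good ht).nonneg] with Y hY hY0
    rw [abs_of_nonneg hY0]
    refine hY.trans (Real.exp_le_exp.2 ?_)
    exact mul_le_mul_of_nonneg_left (ht.2.trans hT) hB0
  have hder : ∀ t ∈ Icc 0 T, HasDerivWithinAt (fun τ => ((w τ).1, (w τ).2.1))
      ((vfield (w t)).1, (vfield (w t)).2.1) (Icc 0 T) t := fun t ht =>
    (hasDerivWithinAt_u (hw.deriv t ht)).prodMk (hasDerivWithinAt_v (hw.deriv t ht))
  have hgr : ∀ t ∈ Icc 0 T, ‖((vfield (w t)).1, (vfield (w t)).2.1)‖ ≤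
      K * ‖((w t).1, (w t).2.1)‖ + 0 := fun t ht => by
    have hz := hw.good ht
    have hA : quartic (w t) ≤ quarticBound z₀ T₀ := by
      have := hw.quartic_le h0 ht
      rw [hw0] at this
      exact this.trans (quarticBound_mono hz₀ (ht.2.trans hT))
    have hdec := hz.decays_den_of_le hr (hlow t ht) hA
    rw [hw.energy_eq h0 ht, hw0] at hdec
    set n := ‖((w t).1, (w t).2.1)‖
    have n1 : ‖(w t).1‖ ≤ n := norm_fst_le ((w t).1, (w t).2.1)
    have n2 : ‖(w t).2.1‖ ≤ n := norm_snd_le ((w t).1, (w t).2.1)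
    have g1 := norm_srcG₁_le hX0.le (hupp t ht) (hU t ht)
    have g2 := norm_srcG₂_le hX0.le (hupp t ht)
    have g3 : ‖srcG₁ (w t)‖ + ‖srcG₂ (w t)‖ ≤ X * (11 / 8 + e ^ 2) * n := by
      have a1 : X * (3 / 8 + e ^ 2) * ‖(w t).1‖ ≤ X * (3 / 8 + e ^ 2) * n := by gcongr
      have a2 : X * ‖(w t).2.1‖ ≤ X * n := by gcongr
      linarith
    have g4 : opBound r m * (‖srcG₁ (w t)‖ + ‖srcG₂ (w t)‖) ≤ K₁ * n :=
      (mul_le_mul_of_nonneg_left g3 hop).trans_eq (by ring)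
    have hn : 0 ≤ n := norm_nonneg _
    have hK₁n : 0 ≤ K₁ * n := by positivity
    have hen : 0 ≤ e ^ 2 * n := by positivity
    rw [add_zero]
    refine max_le ?_ ?_
    · refine (hdec.norm_vfU_le.trans g4).trans ?_
      have : K * n = n + 2 * (e ^ 2 * n) + 2 * (K₁ * n) := by ring
      linarith
    · refine (norm_vfield_v_le hz (hU t ht)).trans ?_
      have a1 := hdec.norm_vfQ_le.trans g4
      have a2 : (1 + 2 * e ^ 2) * ‖(w t).1‖ ≤ (1 + 2 * e ^ 2) * n := by gcongr
      have : K * n = (1 + 2 * e ^ 2) * n + 2 * (K₁ * n) := by ring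
      linarith
  have hG := norm_le_gronwallBound_of_norm_deriv_right_le
    (f := fun τ => ((w τ).1, (w τ).2.1)) (f' := fun t => ((vfield (w t)).1, (vfield (w t)).2.1))
    (a := 0) (b := T) (δ := ‖(z₀.1, z₀.2.1)‖) (K := K) (ε := 0)
    (fun t ht => (hder t ht).continuousWithinAt)
    (fun t ht => ((hasDerivWithinAt_Icc_iff_Ici ht).1 (hder t ⟨ht.1, ht.2.le⟩)).mono
      (Ici_subset_Ici.2 ht.1))
    (by rw [hw0]) (fun t ht => hgr t ⟨ht.1, ht.2.le⟩) T hTT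
  rw [sub_zero] at hG
  have hG' := hG.trans (gronwallBound_mono (norm_nonneg _) le_rfl hK hT)
  have hG0 := (norm_nonneg _).trans hG'
  refine ⟨by linarith, ?_, ?_, ?_, ?_⟩
  · exact ((norm_fst_le ((w T).1, (w T).2.1)).trans hG').trans (by linarith)
  · exact ((norm_snd_le ((w T).1, (w T).2.1)).trans hG').trans (by linarith)
  · exact (Linf.norm_le hX0.le (hupp T hTT)).trans (by linarith)
  · filter_upwards [hlow T hTT] with Y hY
    refine le_trans ?_ hY
    have : r = X⁻¹ := Real.exp_neg _
    rw [this]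
    exact inv_anti₀ hX0 (by linarith)

/-! ### Elements of `H¹ ∩ W^{1,4}` -/

lemma memLp_sobFn (u : H1W14) : MemLp (sobFn u) 2 := Lp.memLp u.1.fst.fst

lemma memLp_sobDeriv (u : H1W14) : MemLp (sobDeriv u) 2 := Lp.memLp u.1.fst.snd

lemma memLp_four_sobDeriv (u : H1W14) : MemLp (sobDeriv u) 4 :=
  (Lp.memLp u.1.snd.snd).ae_eq (EventuallyEq.symm u.2.2.1)

lemma hasWeakDeriv_sobFn (u : H1W14) : HasWeakDeriv (sobFn u) (sobDeriv u) := u.2.2.2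

lemma measurable_sobFn (u : H1W14) : Measurable (sobFn u) :=
  (Lp.stronglyMeasurable u.1.fst.fst).measurable

lemma measurable_sobDeriv (u : H1W14) : Measurable (sobDeriv u) :=
  (Lp.stronglyMeasurable u.1.fst.snd).measurable

lemma exists_isPrim_sobFn (u : H1W14) : ∃ G, IsPrim G (sobDeriv u) ∧ sobFn u =ᵐ[volume] G :=
  (hasWeakDeriv_sobFn u).exists_isPrim ((memLp_sobFn u).locallyIntegrable (by norm_num))
    ((memLp_sobDeriv u).locallyIntegrable (by norm_num))

lemma ae_abs_sobFn_le (u : H1W14) : ∀ᵐ Y, |sobFn u Y| ≤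
    (eLpNorm (sobFn u) 2 volume).toReal + (eLpNorm (sobDeriv u) 2 volume).toReal := by
  obtain ⟨G, hG, hGu⟩ := exists_isPrim_sobFn u
  filter_upwards [hGu] with Y hY
  rw [hY, eLpNorm_congr_ae hGu]
  exact hG.abs_le_of_sq ((memLp_sobFn u).ae_eq hGu) (memLp_sobDeriv u) Y

lemma isA_sobFn (u : H1W14) : IsA (sobFn u) :=
  ⟨memLp_sobFn u, memLp_top_of_bound (memLp_sobFn u).1 _ (ae_abs_sobFn_le u)⟩

lemma integrable_sobDeriv_sq (u : H1W14) : Integrable fun x => sobDeriv u x ^ 2 :=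
  (memLp_sobDeriv u).integrable_sq

lemma integrable_sobDeriv_four (u : H1W14) : Integrable fun x => sobDeriv u x ^ 4 := by
  have := (memLp_four_sobDeriv u).integrable_norm_rpow (by norm_num) (by norm_num)
  refine this.congr (ae_of_all _ fun x => ?_)
  norm_num [Even.pow_abs]

/-! ### The initial change of variables -/

section

variable (u₀ : H1W14)

/-- The density `(1 + u₀'²)²`. -/
def dens (x : ℝ) : ℝ := (1 + sobDeriv u₀ x ^ 2) ^ 2

lemma one_le_dens (x : ℝ) : 1 ≤ dens u₀ x := by
  rw [dens]
  nlinarith [sq_nonneg (sobDeriv u₀ x), sq_nonneg (sobDeriv u₀ x ^ 2)]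

lemma measurable_dens : Measurable (dens u₀) :=
  ((measurable_const.add ((measurable_sobDeriv u₀).pow_const 2))).pow_const 2

lemma isPrim_Y₀ : IsPrim (Y₀ u₀) (dens u₀) := by
  have := IsPrim.of_integral 0 (locallyIntegrable_of_intervalIntegrable (Y₀_integrable u₀))
  simp only [zero_add] at this
  exact this

lemma strictMono_Y₀ : StrictMono (Y₀ u₀) := by
  intro a b hab
  have h := (isPrim_Y₀ u₀).sub_eq a b
  have h1 : ∫ _ in a..b, (1 : ℝ) ≤ ∫ t in a..b, dens u₀ t :=
    intervalIntegral.integral_mono_on hab.le intervalIntegrable_const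
      ((isPrim_Y₀ u₀).intervalIntegrable a b) fun x _ => one_le_dens u₀ x
  simp at h1
  linarith

lemma Y₀_x₀ (Y : ℝ) : Y₀ u₀ (x₀ u₀ Y) = Y :=
  Function.rightInverse_invFun (Y₀_bijective u₀).surjective Y

lemma x₀_Y₀ (x : ℝ) : x₀ u₀ (Y₀ u₀ x) = x :=
  Function.leftInverse_invFun (Y₀_bijective u₀).injective x

lemma x₀_zero : x₀ u₀ 0 = 0 := by
  have : Y₀ u₀ 0 = 0 := by simp [Y₀]
  conv_lhs => rw [← this]
  exact x₀_Y₀ u₀ 0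

lemma strictMono_x₀ : StrictMono (x₀ u₀) := by
  intro a b hab
  rw [← (strictMono_Y₀ u₀).lt_iff_lt, Y₀_x₀, Y₀_x₀]
  exact hab

lemma measurable_x₀ : Measurable (x₀ u₀) := (strictMono_x₀ u₀).monotone.measurable

lemma preimage_x₀_Ioc (a b : ℝ) : x₀ u₀ ⁻¹' Ioc a b = Ioc (Y₀ u₀ a) (Y₀ u₀ b) := by
  ext Y
  simp only [mem_preimage, mem_Ioc]
  rw [← (strictMono_Y₀ u₀).lt_iff_lt, ← (strictMono_Y₀ u₀).le_iff_le, Y₀_x₀]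

/-- The change of variables `dY = (1 + u₀'²)² dx`, as an identity of measures. Half-open intervals
determine both sides, and there it is the definition of `Y₀`. -/
lemma map_x₀ : Measure.map (x₀ u₀) volume =
    volume.withDensity fun x => ENNReal.ofReal (dens u₀ x) := by
  have key : ∀ a b : ℝ, a < b → Measure.map (x₀ u₀) volume (Ioc a b) =
      ENNReal.ofReal (Y₀ u₀ b - Y₀ u₀ a) := fun a b _ => by
    rw [Measure.map_apply (measurable_x₀ u₀) measurableSet_Ioc, preimage_x₀_Ioc, Real.volume_Ioc]
  refine Measure.ext_of_Ioc' _ _ (fun a b hab => ?_) fun a b hab => ?_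
  · rw [key a b hab]
    exact ENNReal.ofReal_ne_top
  · rw [key a b hab, withDensity_apply _ measurableSet_Ioc, (isPrim_Y₀ u₀).sub_eq,
      intervalIntegral.integral_of_le hab.le, ofReal_integral_eq_lintegral_ofReal]
    · exact ((isPrim_Y₀ u₀).intervalIntegrable a b).1
    · exact ae_of_all _ fun x => zero_le_one.trans (one_le_dens u₀ x)

lemma map_x₀_absolutelyContinuous : Measure.map (x₀ u₀) volume ≪ volume := by
  rw [map_x₀]
  exact withDensity_absolutelyContinuous _ _

variable {u₀}

/-- Preimages of null sets under `x₀` are null, so composing with `x₀` respects almost everywhere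
equality; `u₀'` is given only up to null sets. -/
lemma ae_comp_x₀ {p : ℝ → Prop} (h : ∀ᵐ x, p x) : ∀ᵐ Y, p (x₀ u₀ Y) :=
  ae_of_ae_map (measurable_x₀ u₀).aemeasurable ((map_x₀_absolutelyContinuous u₀).ae_le h)

lemma memLp_two_comp_x₀ {f : ℝ → ℝ} (hf : Measurable f)
    (hi : Integrable fun x => dens u₀ x * f x ^ 2) : MemLp (fun Y => f (x₀ u₀ Y)) 2 := by
  have hfx : Measurable fun Y => f (x₀ u₀ Y) := hf.comp (measurable_x₀ u₀)
  rw [memLp_two_iff_integrable_sq hfx.aestronglyMeasurable]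
  have h1 : Integrable (fun x => f x ^ 2) (Measure.map (x₀ u₀) volume) := by
    rw [map_x₀, integrable_withDensity_iff_integrable_smul' (measurable_dens u₀).ennreal_ofReal
      (ae_of_all _ fun x => ENNReal.ofReal_lt_top)]
    refine hi.congr (ae_of_all _ fun x => ?_)
    simp only [ENNReal.toReal_ofReal (zero_le_one.trans (one_le_dens u₀ x)), smul_eq_mul]
  exact (integrable_map_measure (hf.pow_const 2).aestronglyMeasurable
    (measurable_x₀ u₀).aemeasurable).1 h1

lemma integral_comp_x₀ {f : ℝ → ℝ} (hf : Measurable f) (a b : ℝ) :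
    ∫ Y in Y₀ u₀ a..Y₀ u₀ b, f (x₀ u₀ Y) = ∫ x in a..b, dens u₀ x * f x := by
  have key : ∀ a b, ∫ Y in Ioc (Y₀ u₀ a) (Y₀ u₀ b), f (x₀ u₀ Y) =
      ∫ x in Ioc a b, dens u₀ x * f x := by
    intro a b
    rw [← preimage_x₀_Ioc, ← setIntegral_map measurableSet_Ioc hf.aestronglyMeasurable
      (measurable_x₀ u₀).aemeasurable, map_x₀,
      setIntegral_withDensity_eq_setIntegral_toReal_smul (measurable_dens u₀).ennreal_ofReal
        (ae_of_all _ fun x => ENNReal.ofReal_lt_top) _ measurableSet_Ioc]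
    refine integral_congr_ae (ae_of_all _ fun x => ?_)
    simp only [ENNReal.toReal_ofReal (zero_le_one.trans (one_le_dens u₀ x)), smul_eq_mul]
  rw [intervalIntegral, intervalIntegral, key, key]

variable (u₀)

/-- The weight expands to `1 + 2u₀'² + u₀'⁴`. The first term uses `u₀ ∈ L²`; the other two use that
`u₀` is bounded and `u₀'` lies in `L² ∩ L⁴`. -/
lemma isA_sobFn_comp_x₀ : IsA fun Y => sobFn u₀ (x₀ u₀ Y) := by
  set M := (eLpNorm (sobFn u₀) 2 volume).toReal + (eLpNorm (sobDeriv u₀) 2 volume).toReal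
  have hM : ∀ᵐ x, |sobFn u₀ x| ≤ M := ae_abs_sobFn_le u₀
  have hm := (measurable_sobFn u₀).comp (measurable_x₀ u₀)
  refine ⟨memLp_two_comp_x₀ (measurable_sobFn u₀) ?_,
    memLp_top_of_bound hm.aestronglyMeasurable M (ae_comp_x₀ hM)⟩
  refine (((memLp_sobFn u₀).integrable_sq).add (((integrable_sobDeriv_sq u₀).const_mul
    (2 * M ^ 2)).add ((integrable_sobDeriv_four u₀).const_mul (M ^ 2)))).mono'
    ((measurable_dens u₀).mul ((measurable_sobFn u₀).pow_const 2)).aestronglyMeasurable ?_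
  filter_upwards [hM] with x hx
  have h1 : sobFn u₀ x ^ 2 ≤ M ^ 2 := sq_le_sq' (abs_le.1 hx).1 (abs_le.1 hx).2
  have h2 := mul_le_mul_of_nonneg_right h1 (sq_nonneg (sobDeriv u₀ x))
  have h3 := mul_le_mul_of_nonneg_right h1 (sq_nonneg (sobDeriv u₀ x ^ 2))
  simp only [Pi.add_apply]
  rw [Real.norm_of_nonneg (by unfold dens; positivity), dens]
  linarith

lemma isA_arctan_comp_x₀ : IsA fun Y => 2 * Real.arctan (sobDeriv u₀ (x₀ u₀ Y)) := by
  have hm : Measurable fun x => 2 * Real.arctan (sobDeriv u₀ x) :=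
    (Real.measurable_arctan.comp (measurable_sobDeriv u₀)).const_mul 2
  have hb : ∀ y : ℝ, |Real.arctan y| ≤ 2 := fun y => by
    have h1 := Real.arctan_lt_pi_div_two y
    have h2 := Real.neg_pi_div_two_lt_arctan y
    have h3 := Real.pi_le_four
    exact abs_le.2 ⟨by linarith, by linarith⟩
  have hl0 : ∀ y : ℝ, 0 ≤ y → |Real.arctan y| ≤ y := fun y hy => by
    rw [abs_of_nonneg (Real.arctan_nonneg.2 hy)]
    conv_rhs => rw [← Real.tan_arctan y]
    exact Real.le_tan (Real.arctan_nonneg.2 hy) (Real.arctan_lt_pi_div_two y)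
  have hl : ∀ y : ℝ, |Real.arctan y| ≤ |y| := fun y => by
    rcases le_total 0 y with hy | hy
    · exact (hl0 y hy).trans (le_abs_self y)
    · have := hl0 (-y) (neg_nonneg.2 hy)
      rw [Real.arctan_neg, abs_neg] at this
      exact this.trans (neg_le_abs y)
  refine ⟨memLp_two_comp_x₀ hm ?_, memLp_top_of_bound
    (hm.comp (measurable_x₀ u₀)).aestronglyMeasurable 4 (ae_of_all _ fun Y => ?_)⟩
  -- In `4 arctan²(y) (1 + 2y² + y⁴)`, the bound `arctan² ≤ y²` serves the first term and `arctan² ≤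
  -- 4` the other two: `4 + 32 = 36` and `16`.
  · refine (((integrable_sobDeriv_sq u₀).const_mul 36).add
      ((integrable_sobDeriv_four u₀).const_mul 16)).mono'
      ((measurable_dens u₀).mul (hm.pow_const 2)).aestronglyMeasurable (ae_of_all _ fun x => ?_)
    simp only [Pi.add_apply]
    rw [Real.norm_of_nonneg (by unfold dens; positivity), dens]
    have h1 : Real.arctan (sobDeriv u₀ x) ^ 2 ≤ 2 ^ 2 := by
      rw [← sq_abs]
      exact pow_le_pow_left₀ (abs_nonneg _) (hb _) 2
    have h2 : Real.arctan (sobDeriv u₀ x) ^ 2 ≤ sobDeriv u₀ x ^ 2 := sq_le_sq.2 (hl _)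
    have h3 := mul_le_mul_of_nonneg_right h1 (sq_nonneg (sobDeriv u₀ x))
    have h4 := mul_le_mul_of_nonneg_right h1 (sq_nonneg (sobDeriv u₀ x ^ 2))
    linarith
  · rw [Real.norm_eq_abs, abs_mul, abs_of_nonneg (by norm_num : (0 : ℝ) ≤ 2)]
    linarith [hb (sobDeriv u₀ (x₀ u₀ Y))]

/-- The chain rule in integrated form: changing variables in the integral of the right-hand side
cancels the weight and leaves the integral of `u₀'`. -/
lemma hasWeakDeriv_sobFn_comp_x₀ : HasWeakDeriv (fun Y => sobFn u₀ (x₀ u₀ Y))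
    (fun Y => sobDeriv u₀ (x₀ u₀ Y) / dens u₀ (x₀ u₀ Y)) := by
  obtain ⟨G, hG, hGu⟩ := exists_isPrim_sobFn u₀
  have hm : Measurable fun x => sobDeriv u₀ x / dens u₀ x :=
    (measurable_sobDeriv u₀).div (measurable_dens u₀)
  have hp : ∀ x, 0 < dens u₀ x := fun x => zero_lt_one.trans_le (one_le_dens u₀ x)
  have hprim : IsPrim (fun Y => G (x₀ u₀ Y))
      (fun Y => sobDeriv u₀ (x₀ u₀ Y) / dens u₀ (x₀ u₀ Y)) := by
    refine ⟨?_, fun Y => ?_⟩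
    · have : MemLp (fun Y => sobDeriv u₀ (x₀ u₀ Y) / dens u₀ (x₀ u₀ Y)) ∞ :=
        memLp_top_of_bound (hm.comp (measurable_x₀ u₀)).aestronglyMeasurable 1
          (ae_of_all _ fun Y => by
            rw [Real.norm_eq_abs, abs_div, abs_of_pos (hp _), div_le_one (hp _), dens]
            have h := sq_abs (sobDeriv u₀ (x₀ u₀ Y))
            rw [← h]
            nlinarith [sq_nonneg (|sobDeriv u₀ (x₀ u₀ Y)| - 1),
              sq_nonneg (|sobDeriv u₀ (x₀ u₀ Y)| ^ 2)])
      exact this.locallyIntegrable le_top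
    · have h := integral_comp_x₀ (u₀ := u₀) hm 0 (x₀ u₀ Y)
      have h0 : Y₀ u₀ 0 = 0 := by simp [Y₀]
      rw [h0, Y₀_x₀] at h
      rw [h, x₀_zero, hG.eq (x₀ u₀ Y)]
      congr 2
      funext x
      field_simp [(hp x).ne']
  exact hprim.hasWeakDeriv.congr ((ae_comp_x₀ (p := fun x => sobFn u₀ x = G x) hGu).mono
    fun _ h => h.symm) (EventuallyEq.refl _ _)

/-- The initial datum as a state. -/
def initSt : St :=
  (mkA fun Y => sobFn u₀ (x₀ u₀ Y), mkA fun Y => 2 * Real.arctan (sobDeriv u₀ (x₀ u₀ Y)),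
    (memLp_top_const (1 : ℝ)).toLp)

lemma fn_initSt_u : ∀ᵐ Y, fn (initSt u₀).1 Y = sobFn u₀ (x₀ u₀ Y) := fn_mkA (isA_sobFn_comp_x₀ u₀)

lemma fn_initSt_v : ∀ᵐ Y, fn (initSt u₀).2.1 Y = 2 * Real.arctan (sobDeriv u₀ (x₀ u₀ Y)) :=
  fn_mkA (isA_arctan_comp_x₀ u₀)

lemma coeFn_initSt_ξ : ∀ᵐ Y, (initSt u₀).2.2 Y = 1 := (memLp_top_const (1 : ℝ)).coeFn_toLp

lemma exists_initSt_mem : ∃ R, initSt u₀ ∈ setK R := by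
  have h1 := norm_nonneg (initSt u₀).1
  have h2 := norm_nonneg (initSt u₀).2.1
  have h3 := norm_nonneg (initSt u₀).2.2
  refine ⟨‖(initSt u₀).1‖ + ‖(initSt u₀).2.1‖ + ‖(initSt u₀).2.2‖ + 1, by positivity, by linarith,
    by linarith, by linarith, ?_⟩
  filter_upwards [coeFn_initSt_ξ u₀] with Y hY
  rw [hY]
  exact inv_le_one_of_one_le₀ (by linarith)

/-- With `v/2 = arctan y` and `ξ = 1`, `sin(v/2) cos³(v/2)` equals `y / (1 + y²)²`, the derivative
computed in `hasWeakDeriv_sobFn_comp_x₀`. -/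
lemma hasWeakDeriv_initSt : HasWeakDeriv (fn (initSt u₀).1) (fn (stN (initSt u₀))) := by
  refine (hasWeakDeriv_sobFn_comp_x₀ u₀).congr
    (EventuallyEq.symm (fn_initSt_u u₀)) ?_
  filter_upwards [fn_stN (initSt u₀), fn_initSt_v u₀, coeFn_initSt_ξ u₀] with Y h1 h2 h3
  rw [h1, h2, h3, mul_div_cancel_left₀ _ two_ne_zero, Real.sin_arctan, Real.cos_arctan, dens]
  generalize sobDeriv u₀ (x₀ u₀ Y) = y
  have h : √(1 + y ^ 2) ^ 2 = 1 + y ^ 2 := Real.sq_sqrt (by positivity)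
  have h0 : √(1 + y ^ 2) ≠ 0 := by positivity
  generalize √(1 + y ^ 2) = s at *
  rw [← h]
  field_simp

end

/-! ### From `X` to the state space and back -/

lemma eLpNorm_two_fn_le (p : L2Linf) : eLpNorm (fn p) 2 volume ≤ ENNReal.ofReal ‖p‖ := by
  rw [← ENNReal.ofReal_toReal (memLp_two_fn p).eLpNorm_ne_top, norm_L2Linf_eq]
  exact ENNReal.ofReal_le_ofReal (le_add_of_nonneg_right ENNReal.toReal_nonneg)

/-- Interpolation: the square of the `L⁴` norm is the `L²` norm of the square, at most the product
of the `L^∞` and `L²` norms. -/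
lemma eLpNorm_four_fn_le (p : L2Linf) : eLpNorm (fn p) 4 volume ≤ ENNReal.ofReal ‖p‖ := by
  have h1 : eLpNorm (fun Y => ‖fn p Y‖ ^ (2 : ℝ)) 2 volume = eLpNorm (fn p) 4 volume ^ (2 : ℝ) := by
    rw [eLpNorm_norm_rpow (fn p) (by norm_num : (0 : ℝ) < 2)]
    norm_num
  have h2 : eLpNorm (fun Y => ‖fn p Y‖ ^ (2 : ℝ)) 2 volume ≤
      ENNReal.ofReal ‖p‖ * eLpNorm (fn p) 2 volume := by
    refine eLpNorm_le_mul_eLpNorm_of_ae_le_mul ?_ 2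
    filter_upwards [ae_abs_fn_le p] with Y hY
    rw [Real.rpow_two, Real.norm_of_nonneg (sq_nonneg _), sq]
    exact mul_le_mul_of_nonneg_right hY (norm_nonneg _)
  have h3 : eLpNorm (fn p) 4 volume ^ (2 : ℝ) ≤ ENNReal.ofReal ‖p‖ ^ (2 : ℝ) := by
    rw [← h1, ENNReal.rpow_two, sq]
    exact h2.trans (by gcongr; exact eLpNorm_two_fn_le p)
  exact (ENNReal.rpow_le_rpow_iff (by norm_num)).1 h3

lemma memLp_four_fn (p : L2Linf) : MemLp (fn p) 4 :=
  ⟨aesm_fn p, (eLpNorm_four_fn_le p).trans_lt ENNReal.ofReal_lt_top⟩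

/-- The inclusion of `L² ∩ L^∞` into `L⁴`. -/
def toL4 : L2Linf →L[ℝ] Lp ℝ 4 (volume : Measure ℝ) :=
  LinearMap.mkContinuous
    { toFun := fun p => (memLp_four_fn p).toLp
      map_add' := fun p q => by
        rw [← MemLp.toLp_add]
        exact MemLp.toLp_congr _ _ (fn_add p q)
      map_smul' := fun c p => by
        rw [RingHom.id_apply, ← MemLp.toLp_const_smul]
        exact MemLp.toLp_congr _ _ (fn_smul c p) } 1 fun p => by
    rw [one_mul]
    change ‖(memLp_four_fn p).toLp‖ ≤ ‖p‖
    rw [Lp.norm_toLp]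
    exact ENNReal.toReal_le_of_le_ofReal (norm_nonneg _) (eLpNorm_four_fn_le p)

lemma coeFn_toL4 (p : L2Linf) : (toL4 p : ℝ → ℝ) =ᵐ[volume] fn p := (memLp_four_fn p).coeFn_toLp

/-- A pair of functions in `L² ∩ L^∞` as an element of the ambient space of `H¹ ∩ W^{1,4}`. -/
def sobPair : L2Linf × L2Linf →L[ℝ] SobAmbient :=
  (WithLp.prodContinuousLinearEquiv 1 ℝ _ _).symm.toContinuousLinearMap.comp
    (((WithLp.prodContinuousLinearEquiv 2 ℝ _ _).symm.toContinuousLinearMap.comp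
      (toL2.prodMap toL2)).prod
    ((WithLp.prodContinuousLinearEquiv 4 ℝ _ _).symm.toContinuousLinearMap.comp
      (toL4.prodMap toL4)))

lemma sobPair_mem {p n : L2Linf} (h : HasWeakDeriv (fn p) (fn n)) : sobPair (p, n) ∈ H1W14 :=
  ⟨(coeFn_toL4 p).symm, (coeFn_toL4 n).symm, h⟩

open Classical in
/-- The element of `H¹ ∩ W^{1,4}` with weak derivative `n`. -/
def toSob (p n : L2Linf) : H1W14 :=
  if h : HasWeakDeriv (fn p) (fn n) then ⟨sobPair (p, n), sobPair_mem h⟩ else 0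

lemma coe_toSob {p n : L2Linf} (h : HasWeakDeriv (fn p) (fn n)) :
    (toSob p n : SobAmbient) = sobPair (p, n) := by
  rw [toSob, dif_pos h]

lemma sobFn_toSob {p n : L2Linf} (h : HasWeakDeriv (fn p) (fn n)) : sobFn (toSob p n) = fn p := by
  rw [sobFn, coe_toSob h]
  rfl

lemma hasDerivWithinAt_coe_iff {E : Type*} [NormedAddCommGroup E] [NormedSpace ℝ E]
    {S : Submodule ℝ E} {f : ℝ → S} {f' : S} {s : Set ℝ} {t : ℝ} :
    HasDerivWithinAt (fun τ => (f τ : E)) f' s t ↔ HasDerivWithinAt f f' s t := by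
  rw [hasDerivWithinAt_iff_isLittleO, hasDerivWithinAt_iff_isLittleO,
    ← Asymptotics.isLittleO_norm_left, ← Asymptotics.isLittleO_norm_left (f' := fun x' => f x' - f t - (x' - t) • f')]
  rfl

/-- On compatible pairs `toSob` is the continuous linear map `sobPair`, and the subspace carries the
ambient norm, so derivatives pass through. -/
lemma hasDerivWithinAt_toSob {p n : ℝ → L2Linf} {p' n' : L2Linf} {s : Set ℝ} {t : ℝ} (ht : t ∈ s)
    (hpn : ∀ τ ∈ s, HasWeakDeriv (fn (p τ)) (fn (n τ))) (hpn' : HasWeakDeriv (fn p') (fn n'))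
    (hp : HasDerivWithinAt p p' s t) (hn : HasDerivWithinAt n n' s t) :
    HasDerivWithinAt (fun τ => toSob (p τ) (n τ)) (toSob p' n') s t := by
  rw [← hasDerivWithinAt_coe_iff, coe_toSob hpn']
  refine HasDerivWithinAt.congr (sobPair.hasFDerivAt.comp_hasDerivWithinAt t (hp.prodMk hn))
    (fun τ hτ => coe_toSob (hpn τ hτ)) (coe_toSob (hpn t ht))

/-- The embedding of `H¹ ∩ W^{1,4}` into `L² ∩ L^∞`. -/
def sobToA : H1W14 →L[ℝ] L2Linf :=
  LinearMap.mkContinuous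
    { toFun := fun u => mkA (sobFn u)
      map_add' := fun u u' => by
        refine fn_ext ?_
        filter_upwards [fn_mkA (isA_sobFn (u + u')), fn_mkA (isA_sobFn u), fn_mkA (isA_sobFn u'),
          fn_add (mkA (sobFn u)) (mkA (sobFn u')), Lp.coeFn_add u.1.fst.fst u'.1.fst.fst]
          with Y h1 h2 h3 h4 h5
        rw [h1, h4, h2, h3]
        exact h5
      map_smul' := fun c u => by
        refine fn_ext ?_
        filter_upwards [fn_mkA (isA_sobFn (c • u)), fn_mkA (isA_sobFn u),
          fn_smul c (mkA (sobFn u)), Lp.coeFn_smul c u.1.fst.fst] with Y h1 h2 h3 h4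
        rw [h1, RingHom.id_apply, h3, h2]
        exact h4 } 3 fun u => by
    have h0 : ‖u.1.fst‖ ≤ ‖u‖ := WithLp.norm_fst_le _ u.1
    have h1 : (eLpNorm (sobFn u) 2 volume).toReal ≤ ‖u‖ :=
      (WithLp.norm_fst_le _ u.1.fst).trans h0
    have h2 : (eLpNorm (sobDeriv u) 2 volume).toReal ≤ ‖u‖ :=
      (WithLp.norm_snd_le _ u.1.fst).trans h0
    have h3 := norm_mkA_le (f := sobFn u) (C₁ := ‖u‖) (C₂ := ‖u‖ + ‖u‖) (norm_nonneg _)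
      (by positivity) (isA_sobFn u) (by
        rw [← ENNReal.ofReal_toReal (memLp_sobFn u).eLpNorm_ne_top]
        exact ENNReal.ofReal_le_ofReal h1)
      ((ae_abs_sobFn_le u).mono fun Y h => h.trans (add_le_add h1 h2))
    change ‖mkA (sobFn u)‖ ≤ 3 * ‖u‖
    linarith

lemma fn_sobToA (u : H1W14) : fn (sobToA u) =ᵐ[volume] sobFn u := fn_mkA (isA_sobFn u)

/-- The state underlying a point of `X`. -/
def toSt : X →L[ℝ] St :=
  (sobToA.prodMap (WithLp.prodContinuousLinearEquiv 1 ℝ _ _).toContinuousLinearMap).comp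
    (WithLp.prodContinuousLinearEquiv 1 ℝ _ _).toContinuousLinearMap

lemma toSt_apply (z : X) : toSt z = (sobToA z.fst, z.snd.fst, z.snd.snd) := rfl

lemma reps_toSt (z : X) : Reps (toSt z) z.u z.v z.ξ :=
  ⟨fn_sobToA z.fst, EventuallyEq.refl _ _, EventuallyEq.refl _ _⟩

lemma hasDerivWithinAt_toSt {w : ℝ → X} {d : X} {s : Set ℝ} {t : ℝ}
    (h : HasDerivWithinAt w d s t) :
    HasDerivWithinAt (fun τ => toSt (w τ)) (toSt d) s t :=
  HasFDerivAt.comp_hasDerivWithinAt (F := X) (E := St) (f := w) t toSt.hasFDerivAt h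

/-- The weak derivative is determined by the function, and the `L⁴` components by the `L²` ones.
Hence passing to `St` loses nothing. -/
lemma sobFn_injective {u u' : H1W14} (h : sobFn u =ᵐ[volume] sobFn u') : u = u' := by
  have hd : sobDeriv u =ᵐ[volume] sobDeriv u' :=
    (hasWeakDeriv_sobFn u).unique ((hasWeakDeriv_sobFn u').congr h.symm (EventuallyEq.refl _ _))
      ((memLp_sobDeriv u).locallyIntegrable (by norm_num))
      ((memLp_sobDeriv u').locallyIntegrable (by norm_num))
  have e1 : u.1.fst.fst = u'.1.fst.fst := Lp.ext h
  have e2 : u.1.fst.snd = u'.1.fst.snd := Lp.ext hd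
  have e3 : u.1.snd.fst = u'.1.snd.fst :=
    Lp.ext ((EventuallyEq.symm u.2.1).trans (h.trans u'.2.1))
  have e4 : u.1.snd.snd = u'.1.snd.snd :=
    Lp.ext ((EventuallyEq.symm u.2.2.1).trans (hd.trans u'.2.2.1))
  refine Subtype.ext (WithLp.ofLp_injective 1 (Prod.ext ?_ ?_))
  · exact WithLp.ofLp_injective 2 (Prod.ext e1 e2)
  · exact WithLp.ofLp_injective 4 (Prod.ext e3 e4)

lemma toSt_injective : Function.Injective toSt := by
  intro z z' h
  rw [toSt_apply, toSt_apply, Prod.mk.injEq, Prod.mk.injEq] at h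
  refine WithLp.ofLp_injective 1 (Prod.ext ?_ (WithLp.ofLp_injective 1 (Prod.ext h.2.1 h.2.2)))
  refine sobFn_injective ((fn_sobToA z.fst).symm.trans ?_)
  rw [h.1]
  exact fn_sobToA z'.fst

/-- The right-hand side of the system in terms of the vector field on states. -/
lemma Reps.isRHS {z d : X} {s s' : St} (r : Reps s z.u z.v z.ξ) (r' : Reps s' d.u d.v d.ξ)
    (hs : Good s) (h : s' = vfield s) : IsRHS z d := by
  subst h
  refine ⟨r.converges hs, ?_, ?_, ?_⟩
  · filter_upwards [hs.fn_vfU, r'.u] with Y h1 h2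
    rw [r.dxP₁_eq hs, r.P₂_eq hs]
    exact h2.symm.trans h1
  · filter_upwards [hs.fn_vfield_v, r'.v, r.u, r.v] with Y h1 h2 h3 h4
    rw [r.P₁_eq hs, r.dxP₂_eq hs]
    refine h2.symm.trans (h1.trans ?_)
    rw [h3, h4, fv]
  · filter_upwards [hs.coeFn_vfield_ξ, r'.ξ, r.u, r.v, r.ξ] with Y h1 h2 h3 h4 h5
    rw [r.P₁_eq hs, r.dxP₂_eq hs]
    refine h2.symm.trans (h1.trans ?_)
    rw [h3, h4, h5, fξ]
    exact (mul_assoc _ _ _).symm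

lemma Reps.eq_vfield {z d : X} {s s' : St} (r : Reps s z.u z.v z.ξ) (r' : Reps s' d.u d.v d.ξ)
    (hs : Good s) (h : IsRHS z d) : s' = vfield s := by
  refine Prod.ext (fn_ext ?_) (Prod.ext (fn_ext ?_) (Lp.ext ?_))
  · filter_upwards [hs.fn_vfU, r'.u, h.u_eq] with Y h1 h2 h3
    rw [r.dxP₁_eq hs, r.P₂_eq hs] at h3
    exact h2.trans (h3.trans h1.symm)
  · filter_upwards [hs.fn_vfield_v, r'.v, r.u, r.v, h.v_eq] with Y h1 h2 h3 h4 h5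
    rw [r.P₁_eq hs, r.dxP₂_eq hs] at h5
    refine h2.trans (h5.trans (Eq.trans ?_ h1.symm))
    rw [h3, h4, fv]
  · filter_upwards [hs.coeFn_vfield_ξ, r'.ξ, r.u, r.v, r.ξ, h.ξ_eq] with Y h1 h2 h3 h4 h5 h6
    rw [r.P₁_eq hs, r.dxP₂_eq hs] at h6
    refine h2.trans (h6.trans (Eq.trans ?_ h1.symm))
    rw [h3, h4, h5, fξ]
    exact mul_assoc _ _ _

lemma toSt_eq_initSt {u₀ : H1W14} {z : X} (h : IsInitial u₀ z) : toSt z = initSt u₀ := by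
  have r := reps_toSt z
  refine Prod.ext (fn_ext ?_) (Prod.ext (fn_ext ?_) (Lp.ext ?_))
  · filter_upwards [r.u, h.u_eq, fn_initSt_u u₀] with Y h1 h2 h3
    rw [h1, h2, h3]
  · filter_upwards [r.v, h.v_eq, fn_initSt_v u₀] with Y h1 h2 h3
    rw [h1, h2, h3]
  · filter_upwards [r.ξ, h.ξ_eq, coeFn_initSt_ξ u₀] with Y h1 h2 h3
    rw [h1, h2, h3]

lemma isInitial_of_toSt_eq {u₀ : H1W14} {z : X} (h : toSt z = initSt u₀) : IsInitial u₀ z := by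
  have r := reps_toSt z
  rw [h] at r
  refine ⟨?_, ?_, ?_⟩
  · filter_upwards [r.u, fn_initSt_u u₀] with Y h1 h2
    rw [← h1, h2]
  · filter_upwards [r.v, fn_initSt_v u₀] with Y h1 h2
    rw [← h1, h2]
  · filter_upwards [r.ξ, coeFn_initSt_ξ u₀] with Y h1 h2
    rw [← h1, h2]

/-- The point of `X` with components `u`, `v`, `ξ` and weak derivative `n` of `u`. -/
def ofSt (z : St) (n : L2Linf) : X := WithLp.toLp 1 (toSob z.1 n, WithLp.toLp 1 (z.2.1, z.2.2))

lemma toSt_ofSt {z : St} {n : L2Linf} (h : HasWeakDeriv (fn z.1) (fn n)) : toSt (ofSt z n) = z := by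
  rw [toSt_apply]
  refine Prod.ext (fn_ext ?_) rfl
  have := fn_sobToA (toSob z.1 n)
  rw [sobFn_toSob h] at this
  exact this

lemma hasDerivWithinAt_toLp {E F : Type*} [NormedAddCommGroup E] [NormedSpace ℝ E]
    [NormedAddCommGroup F] [NormedSpace ℝ F] {f : ℝ → E} {g : ℝ → F} {f' : E} {g' : F} {s : Set ℝ}
    {t : ℝ} (hf : HasDerivWithinAt f f' s t) (hg : HasDerivWithinAt g g' s t) :
    HasDerivWithinAt (fun τ => WithLp.toLp 1 (f τ, g τ)) (WithLp.toLp 1 (f', g')) s t :=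
  ((WithLp.prodContinuousLinearEquiv 1 ℝ E F).symm.toContinuousLinearMap.hasFDerivAt
    (x := (f t, g t))).comp_hasDerivWithinAt t (hf.prodMk hg)

lemma hasDerivWithinAt_ofSt {w : ℝ → St} {n : ℝ → L2Linf} {w' : St} {n' : L2Linf} {s : Set ℝ}
    {t : ℝ} (ht : t ∈ s) (h : ∀ τ ∈ s, HasWeakDeriv (fn (w τ).1) (fn (n τ)))
    (h' : HasWeakDeriv (fn w'.1) (fn n')) (hw : HasDerivWithinAt w w' s t)
    (hn : HasDerivWithinAt n n' s t) :
    HasDerivWithinAt (fun τ => ofSt (w τ) (n τ)) (ofSt w' n') s t := by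
  have h1 := hasDerivWithinAt_toSob ht h h' (hasDerivWithinAt_u hw) hn
  have h2 := hasDerivWithinAt_toLp (E := L2Linf) (F := Linf) (hasDerivWithinAt_v hw) (hasDerivWithinAt_ξ hw)
  unfold ofSt
  exact hasDerivWithinAt_toLp (E := H1W14) (F := WithLp 1 (L2Linf × Linf)) h1 h2

/-! ### Existence and uniqueness -/

lemma exists_isSolOn_initSt (u₀ : H1W14) :
    ∃ w : ℝ → St, w 0 = initSt u₀ ∧ ∀ T, IsSolOn vfield setK T w := by
  obtain ⟨R, hR⟩ := exists_initSt_mem u₀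
  exact isLipschitzExhaustion_vfield.exists_global _ ⟨R, hR⟩
    (exists_apriori_bound (MemK.good hR) (hasWeakDeriv_initSt u₀) (coeFn_initSt_ξ u₀))

/-- Both `u` and its derivative `stN` are differentiable curves in `L² ∩ L^∞`, and their time
derivatives are again a function and its weak derivative. This is differentiability in the norm of
`H¹ ∩ W^{1,4}`. -/
lemma isGlobalSolution_ofSt {u₀ : H1W14} {w : ℝ → St} (h0 : w 0 = initSt u₀)
    (hw : ∀ T, IsSolOn vfield setK T w) :
    IsGlobalSolution u₀ fun t => ofSt (w t) (stN (w t)) := by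
  have hu0 : HasWeakDeriv (fn (w 0).1) (fn (stN (w 0))) := by
    rw [h0]
    exact hasWeakDeriv_initSt u₀
  have hu : ∀ t ∈ Ici (0 : ℝ), HasWeakDeriv (fn (w t).1) (fn (stN (w t))) := fun t ht =>
    (hw t).hasWeakDeriv hu0 ⟨ht, le_rfl⟩
  refine ⟨isInitial_of_toSt_eq ?_, fun T hT => ?_⟩
  · rw [toSt_ofSt hu0, h0]
  -- The longer interval keeps `T` away from the right end, where the derivative would be one-sided.
  · have hTI : T ∈ Icc 0 (T + 1) := ⟨hT, by linarith⟩
    have hz : Good (w T) := (hw (T + 1)).good hTI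
    have hd : HasDerivWithinAt w (vfield (w T)) (Ici 0) T :=
      (hasDerivWithinAt_Icc_iff_Ici ⟨hT, by linarith⟩).1 ((hw (T + 1)).deriv T hTI)
    obtain ⟨e, he, hfe⟩ := deriv_stN hz hd
    have he' : HasWeakDeriv (fn (vfield (w T)).1) (fn e) :=
      hz.hasWeakDeriv_vfU.congr (EventuallyEq.refl _ _) (EventuallyEq.symm hfe)
    refine ⟨ofSt (vfield (w T)) e, (reps_toSt _).isRHS (reps_toSt _) ?_ ?_, hasDerivWithinAt_ofSt hT hu he' hd he⟩
    · rwa [toSt_ofSt (hu T hT)]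
    · rw [toSt_ofSt he', toSt_ofSt (hu T hT)]

/-- A competing solution carries no lower bound for `ξ`, and its right-hand side is identified with
`vfield` only at states of some `setK R`. The continuation argument in `IsLipschitzExhaustion.eqOn`
needs no more than that. -/
lemma IsGlobalSolution.toSt_eqOn {u₀ : H1W14} {w : ℝ → St} (h0 : w 0 = initSt u₀)
    (hw : ∀ T, IsSolOn vfield setK T w) {w' : ℝ → X} (h : IsGlobalSolution u₀ w') {T : ℝ}
    (hT : 0 ≤ T) : toSt (w' T) = w T := by
  have hder : ∀ t ∈ Icc 0 T, ∃ d, IsRHS (w' t) d ∧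
      HasDerivWithinAt (fun τ => toSt (w' τ)) (toSt d) (Icc 0 T) t := fun t ht => by
    obtain ⟨d, hd, hd'⟩ := h.ode t ht.1
    exact ⟨d, hd, (hasDerivWithinAt_toSt hd').mono Icc_subset_Ici_self⟩
  refine isLipschitzExhaustion_vfield.eqOn (w' := fun τ => toSt (w' τ)) (hw T)
    (fun t ht => ?_) (fun t ht hR => ?_) ?_ ⟨hT, le_rfl⟩
  · obtain ⟨d, _, hd⟩ := hder t ht
    exact hd.continuousWithinAt
  · obtain ⟨d, hd, hd'⟩ := hder t ht
    obtain ⟨R, hR⟩ := hR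
    rw [(reps_toSt _).eq_vfield (reps_toSt d) (MemK.good hR) hd] at hd'
    exact hd'
  · rw [h0]
    exact toSt_eq_initSt h.initial

end Novikov

end

theorem theorem4p2 (u₀ : Novikov.H1W14) :
    ∃ w : ℝ → Novikov.X, Novikov.IsGlobalSolution u₀ w ∧
      ∀ w' : ℝ → Novikov.X, Novikov.IsGlobalSolution u₀ w' →
        ∀ T : ℝ, 0 ≤ T → w' T = w T := by
  obtain ⟨w, h0, hw⟩ := Novikov.exists_isSolOn_initSt u₀
  have h := Novikov.isGlobalSolution_ofSt h0 hw
  exact ⟨_, h, fun w' h' T hT => Novikov.toSt_injective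
    ((h'.toSt_eqOn h0 hw hT).trans (h.toSt_eqOn h0 hw hT).symm)⟩
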